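/- **Model.** Let $\mathbb F$ be a field. A *program* over $\mathbb F$ is a finite sequence of operations, each applying $+,-,\cdot,/$ (with $x/0:=0$) or the zero test "if $a=0$ then $b$ else $c$" to inputs, earlier results and constants of $\mathbb F$; its outputs are chosen among these values. Its *cost* is the number of its operations. Polynomials of bounded degree are given and returned as lists of coefficients. Let $\omega, c\in\mathbb R$. We consider the fields $\mathbb F$ over which, for every $n$, two $n\times n$ matrices can be multiplied by a program of cost at most $c\,n^{\omega}$. Write $\tilde O(g)$ for $O\big(g\,(1+\log(1+g))^{k}\big)$, with some constant $k$. **Lemma.** Let $\mathbb F$ be such a field and let $n,d\ge 0$. There is a preprocessing program, depending only on $\mathbb F,n,d$, that turns every $A\in\mathbb F[X]^{n\times n}$ with entries of degree at most $d$ and $\det(A)\ne0$ into a list of stored field elements, with the following property. For every set $S$ of $f$ positions in an $n\times n$ matrix and every position $(i,j)$ there is a query program that, for every such $A$ and every $C\in\mathbb F[X]^{n\times n}$ that vanishes outside $S$, has entries of degree at most $d$ and satisfies $\det(A+C)\ne 0$, computes the entry $\operatorname{adj}(A+C)_{i,j}$ from the elements stored for $A$ and the coefficients of the entries of $C$ at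 the positions in $S$. 1. If $d\ge 1$, the preprocessing costs $\tilde O(d\,n^{\omega+1})$ operations and each query costs $\tilde O(d\,n\,f^{\omega+1})$ operations. 2. If $d=0$ and $\omega>2$, the preprocessing costs $O(n^{\omega})$ operations and each query costs $O(f^{\omega})$ operations. The constants hidden in these bounds (including $k$) depend only on $\omega$ and $c$; they do not depend on $\mathbb F,n,d,f,A,C,i,j$. -/

import Mathlib

universe u

/-! Straight-line arithmetic programs with zero tests over a field, and the number of
operations they perform. -/

namespace ArithProg

/-- An operand: a stored field element (named by `ι`) or a constant of the field. -/
inductive Operand (F : Type u) (ι : Type) : Type u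
  | var (i : ι) : Operand F ι
  | const (a : F) : Operand F ι

/-- One operation: an arithmetic operation of the field, or a zero test
(`ifZero a b c` is `b` if `a = 0`, and `c` otherwise). -/
inductive Instr (F : Type u) (ι : Type) : Type u
  | add (a b : Operand F ι) : Instr F ι
  | sub (a b : Operand F ι) : Instr F ι
  | mul (a b : Operand F ι) : Instr F ι
  | div (a b : Operand F ι) : Instr F ι
  | ifZero (a b c : Operand F ι) : Instr F ι

/-- `Program F κ ι` is a program with inputs indexed by `ι` and outputs indexed by `κ`.
It is a finite sequence of operations. Each operation may use constants, inputs and all earlier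
results, and stores one new field element: after a step the stored elements are indexed
by `Option ι`, where `some i` is the old element `i` and `none` is the new result.
At the end each output is designated among the stored elements and constants. -/
inductive Program (F : Type u) (κ : Type) : Type → Type (max 1 u)
  | ret {ι : Type} (out : κ → Operand F ι) : Program F κ ι
  | step {ι : Type} (ins : Instr F ι) (rest : Program F κ (Option ι)) : Program F κ ι

/-- The value of an operand when the stored elements are `x`. -/
def Operand.eval {F : Type u} {ι : Type} (x : ι → F) : Operand F ι → F
  | .var i => x i
  | .const a => a

open Classical in
/-- The result of one operation when the stored elements are `x`.
Division by zero returns `0`. -/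
noncomputable def Instr.eval {F : Type u} [Field F] {ι : Type} (x : ι → F) : Instr F ι → F
  | .add a b => a.eval x + b.eval x
  | .sub a b => a.eval x - b.eval x
  | .mul a b => a.eval x * b.eval x
  | .div a b => a.eval x / b.eval x
  | .ifZero a b c => if a.eval x = 0 then b.eval x else c.eval x

/-- The output of a program on the input `x`. -/
noncomputable def Program.eval {F : Type u} [Field F] {κ : Type} :
    {ι : Type} → Program F κ ι → (ι → F) → (κ → F)
  | _, .ret out, x => fun o => (out o).eval x
  | _, .step ins rest, x => rest.eval (fun o => o.elim (ins.eval x) x)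

/-- The number of operations of a program. -/
def Program.cost {F : Type u} {κ : Type} : {ι : Type} → Program F κ ι → ℕ
  | _, .ret _ => 0
  | _, .step _ rest => rest.cost + 1

end ArithProg

/-- Over `F`, two `n × n` matrices can be multiplied with at most `c * n ^ ω` operations,
for every `n`. -/
def MatMulIn (F : Type u) [Field F] (ω c : ℝ) : Prop :=
  ∀ n : ℕ, ∃ P : ArithProg.Program F (Fin n × Fin n) ((Fin n × Fin n) ⊕ (Fin n × Fin n)),
    (P.cost : ℝ) ≤ c * (n : ℝ) ^ ω ∧
    ∀ (A B : Matrix (Fin n) (Fin n) F) (i j : Fin n),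
      P.eval (Sum.elim (fun p => A p.1 p.2) (fun p => B p.1 p.2)) (i, j) = (A * B) i j

/-- The bound `g` up to polylogarithmic factors, with exponent `k` of the logarithm. -/
noncomputable def softBound (k : ℕ) (g : ℝ) : ℝ := g * (1 + Real.log (1 + g)) ^ k

/-- Every entry of the polynomial matrix `A` has degree at most `d`. -/
def DegreeLE {F : Type u} [Field F] {n : ℕ} (d : ℕ)
    (A : Matrix (Fin n) (Fin n) (Polynomial F)) : Prop :=
  ∀ i j, (A i j).natDegree ≤ d

/-- The input presenting an `n × n` matrix of degree at most `d`: all coefficients of all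
entries. -/
def denseCoeffs {F : Type u} [Field F] {n : ℕ} (d : ℕ)
    (A : Matrix (Fin n) (Fin n) (Polynomial F)) : Fin n × Fin n × Fin (d + 1) → F :=
  fun p => (A p.1 p.2.1).coeff p.2.2

/-- The input presenting a matrix of degree at most `d` that vanishes outside the positions
in `S`: the coefficients of the entries at the positions in `S`. -/
def sparseCoeffs {F : Type u} [Field F] {n : ℕ} (d : ℕ) (S : Finset (Fin n × Fin n))
    (C : Matrix (Fin n) (Fin n) (Polynomial F)) : {p // p ∈ S} × Fin (d + 1) → F :=
  fun p => (C p.1.1.1 p.1.1.2).coeff p.2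

/-- The polynomial with the coefficients `a 0, …, a m`. -/
noncomputable def polyOfCoeffs {F : Type u} [Field F] {m : ℕ} (a : Fin (m + 1) → F) :
    Polynomial F :=
  ∑ t : Fin (m + 1), Polynomial.monomial (t : ℕ) (a t)

-- Evaluate the polynomial matrices at `2 ^ k > 3 n d` points of the field. At a point where `A` is
-- invertible, the stored determinant and inverse of `A` give the determinant and inverse of `A + C`
-- by the low-rank update formulas (`det_inv_update`). These only require the determinant and
-- inverse of an `f × f` matrix. At the remaining points nothing useful is stored, and no choice of
-- points avoids them for all `A`. The computed quantities are therefore `det A * det (A + C)` and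
-- its product with the wanted entry of `adj (A + C)`. Both vanish where `det A` does, so their
-- values are available at every point. Both have degree at most `3 n d`, so interpolation recovers
-- them, and an exact division of polynomials yields the entry (`dynAdj_of_injOn`). Preprocessing
-- likewise divides `det A * adj A` by `det A`.
--
-- Determinants and inverses over a field come from an invertible inner inverse: an invertible `U`
-- with `A U A = A`. Such a `U` exists for singular `A` too, so block recursion needs neither
-- pivoting nor a case distinction on ranks (`exists_inner_inverse`). The matrix `A` is invertible
-- iff `A U = 1`, and then `det A = 1 / det U`. The recursion has four calls of half the size. It
-- costs `O(n ^ ω)` for `ω > 2`, and one more logarithm at `ω = 2`.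
--
-- Polynomials are multiplied in quasilinear time over an arbitrary field by fast Fourier transforms
-- over `F[y] / (y ^ q - 1)`, with `q` a power of `2` or `3` and `y` as the root of unity
-- (`PolyMul.step`). Multipoint evaluation, interpolation and exact division follow. A field with
-- too few elements is replaced by its extension of degree `k`, whose arithmetic is simulated with
-- polylogarithmic overhead (`DynAdj.restrict`).
--
-- For `d = 0` a single evaluation and a division in the field suffice, so that no logarithm appears
-- (`dynAdj_const`). The hypothesis on matrix multiplication itself forces `ω ≥ 2` and `c ≥ 1`,
-- because the `n ^ 2` entries of a product need separate operations.
--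
-- Costs are first counted in an abstract calculus: a computation enlarges a set of known functions
-- of an unspecified state. Such computations are compiled into programs at the end.

universe v w

/-! ### A cost calculus for functions of a state. -/

section AdjugateMaintenance

open Polynomial

/-- A set of `F`-valued functions of a state, containing the constant functions. -/
structure Know (F : Type u) (X : Type v) where
  carrier : Set (X → F)
  const_mem' : ∀ a : F, (fun _ => a) ∈ carrier

namespace Know

variable {F : Type u} {X : Type v}

instance : Membership (X → F) (Know F X) := ⟨fun S g => g ∈ S.carrier⟩

instance : Preorder (Know F X) where
  le S T := ∀ g, g ∈ S → g ∈ T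
  le_refl _ _ h := h
  le_trans _ _ _ h₁ h₂ g hg := h₂ g (h₁ g hg)

theorem const_mem (S : Know F X) (a : F) : (fun _ => a) ∈ S := S.const_mem' a

/-- Adjoin the functions in `T`. -/
def extend (S : Know F X) (T : Set (X → F)) : Know F X :=
  ⟨S.carrier ∪ T, fun a => Or.inl (S.const_mem' a)⟩

theorem le_extend (S : Know F X) (T : Set (X → F)) : S ≤ S.extend T := fun _ h => Or.inl h

theorem mem_extend {S : Know F X} {T : Set (X → F)} {g : X → F} (h : g ∈ T) : g ∈ S.extend T :=
  Or.inr h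

end Know

section Calculus

variable {F : Type u} [Field F] {X : Type v}

open Classical in
/-- The zero test, statewise. -/
noncomputable def selectZero (a b c : X → F) : X → F := fun x => if a x = 0 then b x else c x

/-- `g` is the result of one operation on known functions. -/
inductive IsOp (S : Know F X) : (X → F) → Prop
  | add {a b : X → F} : a ∈ S → b ∈ S → IsOp S (fun x => a x + b x)
  | sub {a b : X → F} : a ∈ S → b ∈ S → IsOp S (fun x => a x - b x)
  | mul {a b : X → F} : a ∈ S → b ∈ S → IsOp S (fun x => a x * b x)
  | div {a b : X → F} : a ∈ S → b ∈ S → IsOp S (fun x => a x / b x)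
  | sel {a b c : X → F} : a ∈ S → b ∈ S → c ∈ S → IsOp S (selectZero a b c)

/-- All entries of a state-dependent matrix are known. -/
def KnM {m n : Type*} (S : Know F X) (A : X → Matrix m n F) : Prop :=
  ∀ i j, (fun x => A x i j) ∈ S

/-- All coefficients of a state-dependent polynomial are known. -/
def KnP (S : Know F X) (p : X → F[X]) : Prop := ∀ i, (fun x => (p x).coeff i) ∈ S

/-- The functions in `S'` are computed from those in `S` at total cost `c`, where one
operation costs `1` and one product of `n × n` matrices costs `μ n`. -/
inductive Reach (μ : ℕ → ℝ) : Know F X → ℝ → Know F X → Prop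
  | refl (S : Know F X) : Reach μ S 0 S
  | op {S S' : Know F X} {c : ℝ} {g : X → F} :
      IsOp S g → Reach μ (S.extend {g}) c S' → Reach μ S (c + 1) S'
  | matMul {S S' : Know F X} {c : ℝ} (n : ℕ) (A B : X → Matrix (Fin n) (Fin n) F) :
      KnM S A → KnM S B →
      Reach μ (S.extend (Set.range fun (p : Fin n × Fin n) x => (A x * B x) p.1 p.2)) c S' →
      Reach μ S (c + μ n) S'

/-- From `S` one can reach, at cost at most `c`, a knowledge with the property `Φ`. -/
def Attains (μ : ℕ → ℝ) (S : Know F X) (Φ : Know F X → Prop) (c : ℝ) : Prop :=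
  ∃ c' S', Reach μ S c' S' ∧ c' ≤ c ∧ Φ S'

variable {μ : ℕ → ℝ} {S S' : Know F X}

theorem KnM.mono {m n : Type*} {A : X → Matrix m n F} (h : KnM S A) (hS : S ≤ S') : KnM S' A :=
  fun i j => hS _ (h i j)

theorem KnP.mono {p : X → F[X]} (h : KnP S p) (hS : S ≤ S') : KnP S' p := fun i => hS _ (h i)

theorem Reach.le {c : ℝ} (h : Reach μ S c S') : S ≤ S' := by
  induction h with
  | refl S => exact le_refl _
  | op _ _ ih => exact (Know.le_extend _ _).trans ih
  | matMul _ _ _ _ _ _ ih => exact (Know.le_extend _ _).trans ih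

theorem Reach.trans {a b : ℝ} {S'' : Know F X} (h : Reach μ S a S') (h' : Reach μ S' b S'') :
    Reach μ S (a + b) S'' := by
  induction h with
  | refl S => simpa using h'
  | op hg _ ih =>
    rw [add_right_comm]
    exact Reach.op hg (ih h')
  | matMul n A B hA hB _ ih =>
    rw [add_right_comm]
    exact Reach.matMul n A B hA hB (ih h')

namespace Attains

variable {Φ Ψ : Know F X → Prop} {a b c : ℝ}

theorem pure (h : Φ S) (hc : 0 ≤ c) : Attains μ S Φ c := ⟨0, S, Reach.refl S, hc, h⟩

theorem mono_cost (h : Attains μ S Φ a) (hab : a ≤ b) : Attains μ S Φ b := by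
  obtain ⟨c', S', h₁, h₂, h₃⟩ := h
  exact ⟨c', S', h₁, h₂.trans hab, h₃⟩

theorem imp (h : Attains μ S Φ a) (hΦ : ∀ S', S ≤ S' → Φ S' → Ψ S') : Attains μ S Ψ a := by
  obtain ⟨c', S', h₁, h₂, h₃⟩ := h
  exact ⟨c', S', h₁, h₂, hΦ S' h₁.le h₃⟩

/-- The continuation receives the remaining budget `c - a`. A chain of binds thus leaves a single
inequality, between the total and the sum of its steps, at its last step. -/
theorem bind (h : Attains μ S Φ a) (h' : ∀ S', S ≤ S' → Φ S' → Attains μ S' Ψ (c - a)) :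
    Attains μ S Ψ c := by
  obtain ⟨c₁, S₁, h₁, h₂, h₃⟩ := h
  obtain ⟨c₂, S₂, h₄, h₅, h₆⟩ := h' S₁ h₁.le h₃
  exact ⟨c₁ + c₂, S₂, h₁.trans h₄, by linarith, h₆⟩

theorem of_isOp {g : X → F} (h : IsOp S g) : Attains μ S (fun S' => g ∈ S') 1 :=
  ⟨0 + 1, _, Reach.op h (Reach.refl _), by simp, Know.mem_extend rfl⟩

section Ops
variable {f g e : X → F}

theorem add (hf : f ∈ S) (hg : g ∈ S) : Attains μ S (fun S' => (fun x => f x + g x) ∈ S') 1 :=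
  of_isOp (.add hf hg)
theorem sub (hf : f ∈ S) (hg : g ∈ S) : Attains μ S (fun S' => (fun x => f x - g x) ∈ S') 1 :=
  of_isOp (.sub hf hg)
theorem mul (hf : f ∈ S) (hg : g ∈ S) : Attains μ S (fun S' => (fun x => f x * g x) ∈ S') 1 :=
  of_isOp (.mul hf hg)
theorem div (hf : f ∈ S) (hg : g ∈ S) : Attains μ S (fun S' => (fun x => f x / g x) ∈ S') 1 :=
  of_isOp (.div hf hg)
theorem sel (he : e ∈ S) (hf : f ∈ S) (hg : g ∈ S) :
    Attains μ S (fun S' => selectZero e f g ∈ S') 1 :=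
  of_isOp (.sel he hf hg)

end Ops

/-- The tasks are carried out one after another. Each must therefore be solvable from every larger
knowledge, and its result must survive later enlargements. -/
theorem forall_finset {ι : Type*} (s : Finset ι) {Φ : ι → Know F X → Prop} {c : ι → ℝ}
    (mono : ∀ i ∈ s, ∀ S₁ S₂, S₁ ≤ S₂ → Φ i S₁ → Φ i S₂)
    (h : ∀ i ∈ s, ∀ S', S ≤ S' → Attains μ S' (Φ i) (c i)) :
    Attains μ S (fun S' => ∀ i ∈ s, Φ i S') (∑ i ∈ s, c i) := by
  classical
  induction s using Finset.induction_on with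
  | empty => exact pure (by simp) (by simp)
  | insert i s hi ih =>
    refine bind (ih (fun j hj => mono j (Finset.mem_insert_of_mem hj))
      (fun j hj => h j (Finset.mem_insert_of_mem hj))) fun S' hS hs => ?_
    rw [Finset.sum_insert hi, add_sub_cancel_right]
    refine imp (h i (Finset.mem_insert_self _ _) S' hS) fun S'' hS' hi' j hj => ?_
    rcases Finset.mem_insert.1 hj with rfl | hj
    · exact hi'
    · exact mono j (Finset.mem_insert_of_mem hj) _ _ hS' (hs j hj)

theorem forall_fintype {ι : Type*} [Fintype ι] {Φ : ι → Know F X → Prop} {c : ℝ}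
    (mono : ∀ i S₁ S₂, S₁ ≤ S₂ → Φ i S₁ → Φ i S₂)
    (h : ∀ i S', S ≤ S' → Attains μ S' (Φ i) c) :
    Attains μ S (fun S' => ∀ i, Φ i S') (Fintype.card ι * c) := by
  refine (imp (forall_finset Finset.univ (fun i _ => mono i) (fun i _ => h i))
    fun S' _ hs i => hs i (Finset.mem_univ i)).mono_cost ?_
  simp

theorem forall_lt {N : ℕ} {Φ : ℕ → Know F X → Prop} {c : ℝ}
    (mono : ∀ i S₁ S₂, S₁ ≤ S₂ → Φ i S₁ → Φ i S₂)
    (h : ∀ i < N, ∀ S', S ≤ S' → Attains μ S' (Φ i) c) :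
    Attains μ S (fun S' => ∀ i < N, Φ i S') (N * c) := by
  refine (imp (forall_finset (Finset.range N) (fun i _ => mono i)
    (fun i hi => h i (Finset.mem_range.1 hi)))
    fun S' _ hs i hi => hs i (Finset.mem_range.2 hi)).mono_cost ?_
  simp

theorem family {ι : Type*} [Fintype ι] {v : ι → X → F} {c : ℝ}
    (h : ∀ i S', S ≤ S' → Attains μ S' (fun T => v i ∈ T) c) :
    Attains μ S (fun S' => ∀ i, v i ∈ S') (Fintype.card ι * c) :=
  forall_fintype (fun _ _ _ hS hi => hS _ hi) h

theorem family_lt {N : ℕ} {v : ℕ → X → F} {c : ℝ}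
    (h : ∀ i < N, ∀ S', S ≤ S' → Attains μ S' (fun T => v i ∈ T) c) :
    Attains μ S (fun S' => ∀ i < N, v i ∈ S') (N * c) :=
  forall_lt (fun _ _ _ hS hi => hS _ hi) h

theorem sum {ι : Type*} (s : Finset ι) {v : ι → X → F} (h : ∀ i ∈ s, v i ∈ S) :
    Attains μ S (fun S' => (fun x => ∑ i ∈ s, v i x) ∈ S') s.card := by
  classical
  induction s using Finset.induction_on with
  | empty => exact pure (by simpa using S.const_mem 0) (by simp)
  | insert i s hi ih =>
    refine bind (ih fun j hj => h j (Finset.mem_insert_of_mem hj)) fun S' hS hs => ?_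
    refine (imp (add (hS _ (h i (Finset.mem_insert_self _ _))) hs) fun T _ hT => ?_).mono_cost
      (by rw [Finset.card_insert_of_notMem hi]; push_cast; linarith)
    simpa only [Finset.sum_insert hi] using hT

theorem sum_mul {ι : Type*} (s : Finset ι) {v w : ι → X → F} (hv : ∀ i ∈ s, v i ∈ S)
    (hw : ∀ i ∈ s, w i ∈ S) :
    Attains μ S (fun S' => (fun x => ∑ i ∈ s, v i x * w i x) ∈ S') (2 * s.card) := by
  refine bind (forall_finset (c := fun _ => 1) s (Φ := fun i T => (fun x => v i x * w i x) ∈ T)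
    (fun i _ _ _ hS h => hS _ h) fun i hi S' hS => mul (hS _ (hv i hi)) (hS _ (hw i hi)))
    fun S' hS h => (sum s h).mono_cost ?_
  simp; linarith

end Attains

end Calculus

/-! ### Matrix expressions, priced in multiples of one matrix product. -/

section MatrixCost

variable {F : Type u} [Field F] {X : Type v} {μ : ℕ → ℝ} {S : Know F X}
variable {m : Type*} [Fintype m] [DecidableEq m]

theorem Attains.matMul {A B : X → Matrix m m F} (hA : KnM S A) (hB : KnM S B) :
    Attains μ S (fun T => KnM T fun x => A x * B x) (μ (Fintype.card m)) := by
  have e := Fintype.equivFin m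
  refine ⟨0 + μ (Fintype.card m), _, Reach.matMul _ (fun x => (A x).submatrix e.symm e.symm)
    (fun x => (B x).submatrix e.symm e.symm) (fun i j => hA _ _) (fun i j => hB _ _)
    (Reach.refl _), by simp, fun i j => Know.mem_extend ⟨(e i, e j), ?_⟩⟩
  funext x
  simp [Matrix.submatrix_mul_equiv]

/-- The state-dependent matrix `A` is computed at cost `k * M` in every extension of `S`. -/
def MatCost {l n : Type*} (μ : ℕ → ℝ) (M : ℝ) (S : Know F X) (A : X → Matrix l n F) (k : ℕ) :
    Prop :=
  ∀ T, S ≤ T → Attains μ T (fun T' => KnM T' A) (k * M)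

namespace MatCost

variable {M : ℝ} {a b c d : ℕ}

theorem of_known {l n : Type*} {A : X → Matrix l n F} (h : KnM S A) : MatCost μ M S A 0 :=
  fun _ hT => Attains.pure (h.mono hT) (by simp)

theorem const {l n : Type*} (A : Matrix l n F) : MatCost μ M S (fun _ => A) 0 :=
  of_known fun _ _ => S.const_mem _

theorem mul (hM : μ (Fintype.card m) ≤ M) {A B : X → Matrix m m F} (hA : MatCost μ M S A a)
    (hB : MatCost μ M S B b) : MatCost μ M S (fun x => A x * B x) (a + b + 1) := by
  intro T hT
  refine Attains.bind (hA T hT) fun T₁ h₁ hA => Attains.bind (hB T₁ (hT.trans h₁))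
    fun T₂ h₂ hB => (Attains.matMul (hA.mono h₂) hB).mono_cost ?_
  push_cast
  linarith

theorem sub (hM : (Fintype.card m : ℝ) ^ 2 ≤ M) {A B : X → Matrix m m F}
    (hA : MatCost μ M S A a)
    (hB : MatCost μ M S B b) : MatCost μ M S (fun x => A x - B x) (a + b + 1) := by
  intro T hT
  refine Attains.bind (hA T hT) fun T₁ h₁ hA => Attains.bind (hB T₁ (hT.trans h₁))
    fun T₂ h₂ hB => ?_
  refine (Attains.imp (Attains.family (ι := m × m) (v := fun i x => A x i.1 i.2 - B x i.1 i.2)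
    fun i T' hT' => Attains.sub (hT' _ (h₂ _ (hA _ _))) (hT' _ (hB _ _)))
    fun T' _ h i j => h (i, j)).mono_cost ?_
  rw [Fintype.card_prod]
  push_cast
  linarith

theorem add (hM : (Fintype.card m : ℝ) ^ 2 ≤ M) {A B : X → Matrix m m F}
    (hA : MatCost μ M S A a)
    (hB : MatCost μ M S B b) : MatCost μ M S (fun x => A x + B x) (a + b + 1) := by
  intro T hT
  refine Attains.bind (hA T hT) fun T₁ h₁ hA => Attains.bind (hB T₁ (hT.trans h₁))
    fun T₂ h₂ hB => ?_
  refine (Attains.imp (Attains.family (ι := m × m) (v := fun i x => A x i.1 i.2 + B x i.1 i.2)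
    fun i T' hT' => Attains.add (hT' _ (h₂ _ (hA _ _))) (hT' _ (hB _ _)))
    fun T' _ h i j => h (i, j)).mono_cost ?_
  rw [Fintype.card_prod]
  push_cast
  linarith

theorem fromBlocks {k l n o : Type*} {A : X → Matrix k l F} {B : X → Matrix k o F}
    {C : X → Matrix n l F} {D : X → Matrix n o F} (hA : MatCost μ M S A a)
    (hB : MatCost μ M S B b) (hC : MatCost μ M S C c) (hD : MatCost μ M S D d) :
    MatCost μ M S (fun x => Matrix.fromBlocks (A x) (B x) (C x) (D x)) (a + b + c + d) := by
  intro T hT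
  refine Attains.bind (hA T hT) fun T₁ h₁ hA => Attains.bind (hB T₁ (hT.trans h₁))
    fun T₂ h₂ hB => Attains.bind (hC T₂ ((hT.trans h₁).trans h₂)) fun T₃ h₃ hC =>
    (Attains.imp (hD T₃ (((hT.trans h₁).trans h₂).trans h₃)) fun T₄ h₄ hD => ?_).mono_cost
      (by push_cast; linarith)
  rintro (i | i) (j | j)
  · exact h₄ _ (h₃ _ (h₂ _ (hA i j)))
  · exact h₄ _ (h₃ _ (hB i j))
  · exact h₄ _ (hC i j)
  · exact hD i j

theorem le {l n : Type*} {A : X → Matrix l n F} (hM : 0 ≤ M) (hA : MatCost μ M S A a)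
    (h : a ≤ b) : MatCost μ M S A b := fun T hT =>
  (hA T hT).mono_cost (mul_le_mul_of_nonneg_right (by exact_mod_cast h) hM)

end MatCost

end MatrixCost

/-! ### Invertible inner inverses of block matrices. -/

section UnitRegular

/-- In a ring, `e + g (1 - e)` is idempotent if `e` and `g` are and `e g = 0`. -/
theorem idempotent_add_mul_one_sub {R : Type*} [Ring R] {e g : R} (he : e * e = e)
    (hg : g * g = g) (heg : e * g = 0) :
    (e + (g - g * e)) * (e + (g - g * e)) = e + (g - g * e) := by
  have h1 : e * (g * e) = 0 := by rw [← mul_assoc, heg, zero_mul]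
  have h2 : g * e * g = 0 := by rw [mul_assoc, heg, mul_zero]
  have h3 : g * e * (g * e) = 0 := by rw [← mul_assoc, h2, zero_mul]
  have h4 : g * (g * e) = g * e := by rw [← mul_assoc, hg]
  have h5 : g * e * e = g * e := by rw [mul_assoc, he]
  simp only [add_mul, mul_add, sub_mul, mul_sub, he, hg, heg, h1, h2, h3, h4, h5]
  abel

variable {F : Type u} [Field F] {m : Type*} [Fintype m] [DecidableEq m]

open Matrix

/-- Column operations making the first block row of `[a b; c d]` equal to `[h 0]` with `h`
idempotent, if `u` and `v` are invertible inner inverses of `a` and `(1 - a u) b`. -/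
def topOps (a b u v : Matrix m m F) : Matrix (m ⊕ m) (m ⊕ m) F :=
  let e := a * u
  let g := (b - e * b) * v
  let f := g - g * e
  fromBlocks u 0 0 1 * fromBlocks 1 (0 - b) 0 1 * fromBlocks 1 0 0 v *
    fromBlocks 1 0 0 (1 - g * e) * fromBlocks 1 0 f 1 * fromBlocks 1 (0 - f) 0 1

/-- The idempotent produced by `topOps`. -/
def topIdem (a b u v : Matrix m m F) : Matrix m m F :=
  a * u + ((b - a * u * b) * v - (b - a * u * b) * v * (a * u))

/-- Put `e = a u`, `b' = b - e b`, `g = b' v` and `f = g - g e`. The six factors change the first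
block row `[a b]` successively into `[e b]`, `[e b']`, `[e g]`, `[e f]`, `[e + f, f]` and `[e + f,
0]`. This uses that `e`, `g`, `f` are idempotent and `e g = e f = 0`. -/
theorem topOps_spec {a b u v : Matrix m m F} (c d : Matrix m m F) (hu : a * u * a = a)
    (hv : (b - a * u * b) * v * (b - a * u * b) = b - a * u * b) :
    topIdem a b u v * topIdem a b u v = topIdem a b u v ∧
    ∃ c' d', fromBlocks a b c d * topOps a b u v = fromBlocks (topIdem a b u v) 0 c' d' := by
  set e := a * u with he
  have hee : e * e = e := by rw [he, ← mul_assoc, hu]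
  set b' := b - e * b with hb'
  set g := b' * v with hg
  have hgg : g * g = g := by rw [hg, ← mul_assoc, hv]
  have heb : e * b' = 0 := by rw [hb', mul_sub, ← mul_assoc, hee, sub_self]
  have heg : e * g = 0 := by rw [hg, ← mul_assoc, heb, zero_mul]
  refine ⟨idempotent_add_mul_one_sub hee hgg heg, ?_⟩
  have h1 : e * (g * e) = 0 := by rw [← mul_assoc, heg, zero_mul]
  have h4 : g * (g * e) = g * e := by rw [← mul_assoc, hgg]
  have hef : e * (g - g * e) = 0 := by rw [mul_sub, heg, h1, sub_zero]
  have hff : (g - g * e) * (g - g * e) = g - g * e := by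
    have h2 : g * e * g = 0 := by rw [mul_assoc, heg, mul_zero]
    have h3 : g * e * (g * e) = 0 := by rw [← mul_assoc, h2, zero_mul]
    simp only [sub_mul, mul_sub, hgg, h2, h3, h4]
    abel
  have hgw : g * (1 - g * e) = g - g * e := by rw [mul_sub, mul_one, h4]
  simp only [topOps, ← he, ← hb', ← hg, ← mul_assoc, topIdem]
  simp only [fromBlocks_multiply, mul_zero, add_zero, zero_add, mul_one, zero_sub, mul_neg,
    ← sub_eq_neg_add, ← he, ← hb']
  rw [← hg]
  simp only [hgw, hff, add_mul, hef, zero_add, sub_self]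
  exact ⟨_, _, rfl⟩

/-- Row operations and further column operations, making the matrix `[h 0; c d]` an
idempotent, if `z` and `t` are invertible inner inverses of the appropriate blocks. -/
def lowOps (h c d z t : Matrix m m F) : Matrix (m ⊕ m) (m ⊕ m) F :=
  let p := d * z
  let c₁ := c - p * c
  let c₂ := c₁ - c₁ * h
  fromBlocks 1 0 0 z * fromBlocks 1 0 (0 - c) 1 *
    fromBlocks 1 ((1 - h) * t * (1 - p)) 0 1 * fromBlocks 1 0 (0 - c₂) 1

/-- With `p = d z` idempotent, two column operations make the lower row `[c₁ p]` with `p c₁ = 0`.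
The only row operation replaces `c₁` by `c₂ = c₁ (1 - h)`, so that `c₂ h = p c₂ = 0`. Adding the
first column times `(1 - h) t (1 - p)` to the second keeps the upper right block zero, because `h (1
- h) = 0`. It makes the corner an idempotent `r` with `r c₂ = c₂`, and the last factor then clears
`c₂`. What remains is block diagonal with blocks `h` and `r`. -/
theorem lowOps_spec {h c d z t : Matrix m m F} (hh : h * h = h) (hz : d * z * d = d)
    (ht : (c - d * z * c - (c - d * z * c) * h) * t * (c - d * z * c - (c - d * z * c) * h) =
      c - d * z * c - (c - d * z * c) * h) :
    ∃ E, E * E = E ∧ fromBlocks 1 0 (0 - (c - d * z * c)) 1 *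
      (fromBlocks h 0 c d * lowOps h c d z t) = E := by
  set p := d * z with hp
  have hpp : p * p = p := by rw [hp, ← mul_assoc, hz]
  set c₁ := c - p * c with hc₁
  set c₂ := c₁ - c₁ * h with hc₂
  have hpc₁ : p * c₁ = 0 := by rw [hc₁, mul_sub, ← mul_assoc, hpp, sub_self]
  have hpc₂ : p * c₂ = 0 := by rw [hc₂, mul_sub, ← mul_assoc, hpc₁, zero_mul, sub_zero]
  have hc₂h : c₂ * h = 0 := by rw [hc₂, sub_mul, mul_assoc, hh, sub_self]
  set r := p + (c₂ * t - c₂ * t * p) with hr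
  have hrr : r * r = r :=
    idempotent_add_mul_one_sub hpp (by rw [← mul_assoc, ht]) (by rw [← mul_assoc, hpc₂, zero_mul])
  refine ⟨fromBlocks h 0 0 r, by simp [fromBlocks_multiply, hh, hrr], ?_⟩
  have h1 : h * ((1 - h) * t * (1 - p)) = 0 := by
    rw [← mul_assoc, ← mul_assoc, show h * (1 - h) = 0 by rw [mul_sub, mul_one, hh, sub_self],
      zero_mul, zero_mul]
  have h2 : c₂ * ((1 - h) * t * (1 - p)) = c₂ * t - c₂ * t * p := by
    rw [← mul_assoc, ← mul_assoc, show c₂ * (1 - h) = c₂ by rw [mul_sub, mul_one, hc₂h, sub_zero],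
      mul_sub, mul_one]
  have h3 : r * c₂ = c₂ := by
    rw [hr, add_mul, sub_mul, mul_assoc _ p, hpc₂, ht, mul_zero, sub_zero, zero_add]
  have h4 : c₁ * ((1 - h) * t * (1 - p)) - c₁ * (h * ((1 - h) * t * (1 - p))) =
      c₂ * t - c₂ * t * p := by
    rw [← mul_assoc c₁ h, ← sub_mul, ← hc₂, h2]
  have h5 : fromBlocks h 0 c d * (fromBlocks 1 0 0 z * fromBlocks 1 0 (0 - c) 1) =
      fromBlocks h 0 c₁ p := by
    simp only [fromBlocks_multiply]
    simp only [mul_zero, add_zero, zero_add, mul_one, zero_sub, mul_neg, zero_mul,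
      ← hp, ← mul_assoc]
    congr 1
    · simp
    · rw [hc₁, neg_zero, add_zero, mul_one]
      abel
  have h6 : fromBlocks 1 0 (0 - c₁) 1 * fromBlocks h 0 c₁ p = fromBlocks h 0 c₂ p := by
    simp only [fromBlocks_multiply]
    simp only [mul_zero, add_zero, zero_add, zero_sub, neg_mul, zero_mul, one_mul]
    congr 1
    rw [hc₂]
    abel
  simp only [lowOps, ← hp, ← hc₁, ← hc₂]
  rw [mul_assoc (fromBlocks 1 0 0 z * _), ← mul_assoc (fromBlocks h 0 c d), h5, ← mul_assoc, h6,
    ← mul_assoc]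
  simp only [fromBlocks_multiply]
  simp only [mul_zero, add_zero, zero_add, zero_sub, mul_neg, zero_mul, mul_one, h1, h2]
  rw [add_comm _ p, ← hr, h3]
  congr 1
  · simp
  · simp

/-- An invertible inner inverse of a block matrix from those of four blocks. -/
theorem isUnit_regular_blocks {a b c d u v z t c' d' : Matrix m m F} (hu : a * u * a = a)
    (hv : (b - a * u * b) * v * (b - a * u * b) = b - a * u * b)
    (hcd : fromBlocks a b c d * topOps a b u v = fromBlocks (topIdem a b u v) 0 c' d')
    (hz : d' * z * d' = d')
    (ht : (c' - d' * z * c' - (c' - d' * z * c') * topIdem a b u v) * t *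
      (c' - d' * z * c' - (c' - d' * z * c') * topIdem a b u v) =
      c' - d' * z * c' - (c' - d' * z * c') * topIdem a b u v)
    (hu' : u.det ≠ 0) (hv' : v.det ≠ 0) (hz' : z.det ≠ 0) :
    let U := topOps a b u v * lowOps (topIdem a b u v) c' d' z t *
      fromBlocks (1 : Matrix m m F) 0 (0 - (c' - d' * z * c')) (1 : Matrix m m F)
    U.det = u.det * v.det * z.det ∧
      fromBlocks a b c d * U * fromBlocks a b c d = fromBlocks a b c d := by
  intro U
  have hdt : (topOps a b u v).det = u.det * v.det := by
    -- By Sylvester's identity this equals the determinant of `1 - e g` with `e = a u` and `g = (b -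
    -- e b) v`, and `e g = 0`.
    have : (1 - (b - a * u * b) * v * (a * u)).det = 1 := by
      have heg : (a * u) * ((b - a * u * b) * v) = 0 := by
        rw [← mul_assoc, mul_sub, ← mul_assoc (a * u) (a * u), ← mul_assoc (a * u) a, hu, sub_self,
          zero_mul]
      rw [Matrix.det_one_sub_mul_comm, heg, sub_zero, det_one]
    simp [topOps, det_fromBlocks_zero₂₁, this]
  have hdl : (lowOps (topIdem a b u v) c' d' z t).det = z.det := by
    simp [lowOps, det_fromBlocks_zero₂₁]
  have hdL : (fromBlocks (1 : Matrix m m F) 0 (0 - (c' - d' * z * c')) (1 : Matrix m m F)).det = 1 := by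
    simp
  refine ⟨by simp only [U, det_mul, hdt, hdl, hdL, mul_one], ?_⟩
  obtain ⟨E, hE, hE'⟩ := lowOps_spec (topOps_spec c d hu hv).1 hz ht
  set L := fromBlocks (1 : Matrix m m F) 0 (0 - (c' - d' * z * c')) (1 : Matrix m m F)
  set A := fromBlocks a b c d
  set W := topOps a b u v * lowOps (topIdem a b u v) c' d' z t with hW
  have hLAW : L * (A * W) = E := by rw [← hE', hW, ← hcd, mul_assoc]
  have hL : IsUnit L := by rw [isUnit_iff_isUnit_det, hdL]; exact isUnit_one
  have hWu : IsUnit W := by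
    rw [isUnit_iff_isUnit_det, hW, det_mul, hdt, hdl]
    exact (mul_ne_zero (mul_ne_zero hu' hv') hz').isUnit
  -- Since `E = L A W` is idempotent, `L (A W L A) W = L A W`. Cancelling the units `L` and `W`
  -- shows that `W L` is an inner inverse of `A`.
  refine hWu.mul_right_cancel (hL.mul_left_cancel ?_)
  calc L * (A * (W * L) * A * W) = (L * (A * W)) * (L * (A * W)) := by simp only [mul_assoc]
    _ = L * (A * W) := by rw [hLAW, hE]

end UnitRegular

/-! ### The recursive computation of an invertible inner inverse. -/

section UnitRegularCost

variable {F : Type u} [Field F] {X : Type v} {μ : ℕ → ℝ} {S : Know F X}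
variable {m : Type*} [Fintype m] [DecidableEq m]

open Matrix

/-- The cost of matrix multiplication is monotone and at least the number of entries. -/
structure MulCost (μ : ℕ → ℝ) : Prop where
  sq_le : ∀ n : ℕ, (n : ℝ) ^ 2 ≤ μ n
  mono : Monotone μ

theorem MatCost.topOps (hμ : MulCost μ) {a b u v : X → Matrix m m F} (ha : KnM S a)
    (hb : KnM S b) (hu : KnM S u) (hv : KnM S v) :
    MatCost μ (μ (Fintype.card (m ⊕ m))) S
      (fun x => _root_.topOps (a x) (b x) (u x) (v x)) 60 := by
  have hle : Fintype.card m ≤ Fintype.card (m ⊕ m) := by simp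
  have h1 : μ (Fintype.card m) ≤ μ (Fintype.card (m ⊕ m)) := hμ.mono hle
  have h2 : (Fintype.card m : ℝ) ^ 2 ≤ μ (Fintype.card (m ⊕ m)) := (hμ.sq_le _).trans h1
  apply MatCost.le ((sq_nonneg _).trans h2)
  · simp only [_root_.topOps]
    repeat' first
      | exact MatCost.const _
      | exact MatCost.of_known ‹_›
      | apply MatCost.mul le_rfl
      | apply MatCost.mul h1
      | apply MatCost.sub h2
      | apply MatCost.fromBlocks
  · norm_num

theorem MatCost.topIdem (hμ : MulCost μ) {a b u v : X → Matrix m m F} (ha : KnM S a)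
    (hb : KnM S b) (hu : KnM S u) (hv : KnM S v) :
    MatCost μ (μ (Fintype.card (m ⊕ m))) S
      (fun x => _root_.topIdem (a x) (b x) (u x) (v x)) 20 := by
  have hle : Fintype.card m ≤ Fintype.card (m ⊕ m) := by simp
  have h1 : μ (Fintype.card m) ≤ μ (Fintype.card (m ⊕ m)) := hμ.mono hle
  have h2 : (Fintype.card m : ℝ) ^ 2 ≤ μ (Fintype.card (m ⊕ m)) := (hμ.sq_le _).trans h1
  apply MatCost.le ((sq_nonneg _).trans h2)
  · simp only [_root_.topIdem]
    repeat' first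
      | exact MatCost.const _
      | exact MatCost.of_known ‹_›
      | apply MatCost.mul h1
      | apply MatCost.sub h2
      | apply MatCost.add h2
  · norm_num

theorem MatCost.lowOps (hμ : MulCost μ) {h c d z t : X → Matrix m m F} (hh : KnM S h)
    (hc : KnM S c) (hd : KnM S d) (hz : KnM S z) (ht : KnM S t) :
    MatCost μ (μ (Fintype.card (m ⊕ m))) S
      (fun x => _root_.lowOps (h x) (c x) (d x) (z x) (t x)) 60 := by
  have hle : Fintype.card m ≤ Fintype.card (m ⊕ m) := by simp
  have h1 : μ (Fintype.card m) ≤ μ (Fintype.card (m ⊕ m)) := hμ.mono hle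
  have h2 : (Fintype.card m : ℝ) ^ 2 ≤ μ (Fintype.card (m ⊕ m)) := (hμ.sq_le _).trans h1
  apply MatCost.le ((sq_nonneg _).trans h2)
  · simp only [_root_.lowOps]
    repeat' first
      | exact MatCost.const _
      | exact MatCost.of_known ‹_›
      | apply MatCost.mul le_rfl
      | apply MatCost.mul h1
      | apply MatCost.sub h2
      | apply MatCost.fromBlocks
  · norm_num

/-- The cost of computing an invertible inner inverse of a `2 ^ k × 2 ^ k` matrix. -/
noncomputable def regCost (μ : ℕ → ℝ) : ℕ → ℝ
  | 0 => 2
  | k + 1 => 4 * regCost μ k + 500 * μ (2 ^ (k + 1))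

/-- The four recursive calls are sequential: on `a`, on `b - a u b`, then on the blocks `d'` and
`c₂` left by the earlier operations. Everything else is a bounded number of block products. The
determinant travels along because it is `det u * det v * det z`; `t` occurs only in a unitriangular
factor. -/
theorem exists_inner_inverse_step (hμ : MulCost μ) {r : ℝ}
    (ih : ∀ A : X → Matrix m m F, ∃ U : X → Matrix m m F,
      (∀ x, (U x).det ≠ 0 ∧ A x * U x * A x = A x) ∧ ∀ S, KnM S A →
        Attains μ S (fun T => KnM T U ∧ (fun x => (U x).det) ∈ T) r)
    (A : X → Matrix (m ⊕ m) (m ⊕ m) F) :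
    ∃ U : X → Matrix (m ⊕ m) (m ⊕ m) F,
      (∀ x, (U x).det ≠ 0 ∧ A x * U x * A x = A x) ∧ ∀ S, KnM S A →
        Attains μ S (fun T => KnM T U ∧ (fun x => (U x).det) ∈ T)
          (4 * r + 500 * μ (Fintype.card (m ⊕ m))) := by
  set a := fun x => (A x).toBlocks₁₁ with ha
  set b := fun x => (A x).toBlocks₁₂ with hb
  set c := fun x => (A x).toBlocks₂₁ with hc
  set d := fun x => (A x).toBlocks₂₂ with hd
  have hA : ∀ x, A x = Matrix.fromBlocks (a x) (b x) (c x) (d x) := fun x =>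
    (Matrix.fromBlocks_toBlocks _).symm
  obtain ⟨u, hu, hu'⟩ := ih a
  obtain ⟨v, hv, hv'⟩ := ih (fun x => b x - a x * u x * b x)
  set c' := fun x => (A x * topOps (a x) (b x) (u x) (v x)).submatrix Sum.inr Sum.inl with hc'
  set d' := fun x => (A x * topOps (a x) (b x) (u x) (v x)).submatrix Sum.inr Sum.inr with hd'
  have hcd : ∀ x, fromBlocks (a x) (b x) (c x) (d x) * topOps (a x) (b x) (u x) (v x) =
      fromBlocks (topIdem (a x) (b x) (u x) (v x)) 0 (c' x) (d' x) := by
    intro x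
    obtain ⟨c'', d'', h⟩ := (topOps_spec (c x) (d x) (hu x).2 (hv x).2).2
    rw [h]
    congr 1
    · simp only [hc', hA, h]; rfl
    · simp only [hd', hA, h]; rfl
  set h := fun x => topIdem (a x) (b x) (u x) (v x) with hh
  obtain ⟨z, hz, hz'⟩ := ih d'
  set c₂ := fun x => c' x - d' x * z x * c' x - (c' x - d' x * z x * c' x) * h x with hc₂
  obtain ⟨t, ht, ht'⟩ := ih c₂
  have key := fun x => isUnit_regular_blocks (hu x).2 (hv x).2 (hcd x) (hz x).2 (ht x).2
    (hu x).1 (hv x).1 (hz x).1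
  refine ⟨fun x => topOps (a x) (b x) (u x) (v x) * lowOps (h x) (c' x) (d' x) (z x) (t x) *
      fromBlocks (1 : Matrix m m F) 0 (0 - (c' x - d' x * z x * c' x)) (1 : Matrix m m F),
      fun x => ⟨?_, ?_⟩, fun S hS => ?_⟩
  · rw [(key x).1]
    exact mul_ne_zero (mul_ne_zero (hu x).1 (hv x).1) (hz x).1
  · rw [hA]
    exact (key x).2
  have hle : Fintype.card m ≤ Fintype.card (m ⊕ m) := by simp
  have h1 : μ (Fintype.card m) ≤ μ (Fintype.card (m ⊕ m)) := hμ.mono hle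
  have h2 : (Fintype.card m : ℝ) ^ 2 ≤ μ (Fintype.card (m ⊕ m)) := (hμ.sq_le _).trans h1
  -- This pays for the two multiplications of determinants. It may fail for an empty index type,
  -- where the determinant is the constant `1`.
  have h3 : 1 ≤ μ (Fintype.card (m ⊕ m)) ∨ IsEmpty m := by
    cases isEmpty_or_nonempty m
    · exact Or.inr ‹_›
    · refine Or.inl (le_trans ?_ h2)
      have : (1 : ℝ) ≤ Fintype.card m := by exact_mod_cast Fintype.card_pos
      nlinarith
  have kna : KnM S a := fun i j => hS _ _
  have knb : KnM S b := fun i j => hS _ _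
  refine Attains.bind (hu' S kna) fun S₁ l₁ ⟨knu, du⟩ => ?_
  refine Attains.bind ((MatCost.sub (μ := μ) h2 (MatCost.of_known (knb.mono l₁)) (MatCost.mul h1
    (MatCost.mul h1 (MatCost.of_known (kna.mono l₁)) (MatCost.of_known knu))
    (MatCost.of_known (knb.mono l₁)))) S₁ le_rfl) fun S₂ l₂ knb' => ?_
  refine Attains.bind (hv' S₂ knb') fun S₃ l₃ ⟨knv, dv⟩ => ?_
  replace knu := (knu.mono l₂).mono l₃
  replace kna := ((kna.mono l₁).mono l₂).mono l₃
  replace knb := ((knb.mono l₁).mono l₂).mono l₃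
  refine Attains.bind (MatCost.topOps hμ kna knb knu knv S₃ le_rfl) fun S₄ l₄ knW => ?_
  refine Attains.bind (MatCost.topIdem hμ (kna.mono l₄) (knb.mono l₄) (knu.mono l₄)
    (knv.mono l₄) S₄ le_rfl) fun S₅ l₅ knh => ?_
  replace knW := knW.mono l₅
  refine Attains.bind (Attains.matMul ((((hS.mono l₁).mono l₂).mono l₃).mono l₄ |>.mono l₅) knW)
    fun S₆ l₆ knAW => ?_
  have knc' : KnM S₆ c' := fun i j => knAW _ _
  have knd' : KnM S₆ d' := fun i j => knAW _ _
  replace knh := knh.mono l₆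
  replace knW := knW.mono l₆
  refine Attains.bind (hz' S₆ knd') fun S₇ l₇ ⟨knz, dz⟩ => ?_
  replace knh := knh.mono l₇
  replace knW := knW.mono l₇
  replace knc' := knc'.mono l₇
  replace knd' := knd'.mono l₇
  have c₁cost : MatCost μ (μ (Fintype.card (m ⊕ m))) S₇ (fun x => c' x - d' x * z x * c' x) 3 :=
    MatCost.sub h2 (MatCost.of_known knc') (MatCost.mul h1
      (MatCost.mul h1 (MatCost.of_known knd') (MatCost.of_known knz)) (MatCost.of_known knc'))
  refine Attains.bind (c₁cost S₇ le_rfl) fun S₈ l₈ knc₁ => ?_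
  replace knh := knh.mono l₈
  replace knW := knW.mono l₈
  replace knc' := knc'.mono l₈
  replace knd' := knd'.mono l₈
  replace knz := knz.mono l₈
  refine Attains.bind ((MatCost.sub (μ := μ) h2 (MatCost.of_known knc₁) (MatCost.mul h1
    (MatCost.of_known knc₁) (MatCost.of_known knh))) S₈ le_rfl) fun S₉ l₉ knc₂ => ?_
  refine Attains.bind (ht' S₉ knc₂) fun T l knt => ?_
  replace l := l₉.trans l
  refine Attains.bind (MatCost.lowOps hμ (knh.mono l) (knc'.mono l) (knd'.mono l) (knz.mono l)
    knt.1 T le_rfl) fun T₁ l' knL => ?_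
  replace knW := (knW.mono l).mono l'
  replace knc₁ := (knc₁.mono l).mono l'
  refine Attains.bind (MatCost.mul (μ := μ) le_rfl (MatCost.mul le_rfl (MatCost.of_known knW)
    (MatCost.of_known knL)) (MatCost.fromBlocks (MatCost.const 1) (MatCost.const 0)
    (MatCost.sub h2 (MatCost.const 0) (MatCost.of_known knc₁)) (MatCost.const 1)) T₁ le_rfl)
    fun T₂ l'' knU => ?_
  have lT : S₇ ≤ T₂ := ((l₈.trans l).trans l').trans l''
  have lT' : S₃ ≤ T₂ := ((l₄.trans l₅).trans (l₆.trans l₇)).trans lT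
  rcases h3 with h3 | h3
  · refine Attains.bind (Attains.mul (lT' _ (l₃ _ (l₂ _ du))) (lT' _ dv)) fun T₃ m₁ k₁ => ?_
    refine (Attains.imp (Attains.mul k₁ (m₁ _ (lT _ dz))) fun T₄ m₂ k₂ =>
      ⟨(knU.mono m₁).mono m₂, ?_⟩).mono_cost ?_
    · push_cast
      linarith
    · exact Eq.mpr (congrArg (· ∈ T₄) (funext fun x => (key x).1)) k₂
  · refine Attains.pure ⟨knU, ?_⟩ ?_
    · simpa using T₂.const_mem 1
    · push_cast
      have := (sq_nonneg _).trans h2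
      linarith

theorem exists_inner_inverse (hμ : MulCost μ) (k : ℕ) :
    ∀ (m : Type) [Fintype m] [DecidableEq m], Fintype.card m = 2 ^ k → ∀ A : X → Matrix m m F,
      ∃ U : X → Matrix m m F, (∀ x, (U x).det ≠ 0 ∧ A x * U x * A x = A x) ∧ ∀ S, KnM S A →
        Attains μ S (fun T => KnM T U ∧ (fun x => (U x).det) ∈ T) (regCost μ k) := by
  induction k with
  | zero =>
    intro m _ _ hm A
    have : Unique m := (Fintype.card_eq_one_iff_nonempty_unique.1 (by simpa using hm)).some
    classical
    -- For the `1 × 1` matrix `(a)` take `1` if `a = 0` and `1 / a` otherwise. This is the only zero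
    -- test in the recursion.
    refine ⟨fun x => Matrix.of fun i j => selectZero (fun x => A x i j) (fun _ => 1)
      (fun x => 1 / A x i j) x, fun x => ⟨?_, ?_⟩, fun S hS => ?_⟩
    · simp only [Matrix.det_unique, Matrix.of_apply, selectZero]
      split_ifs <;> simp_all
    · ext i j
      obtain rfl := Subsingleton.elim i default
      obtain rfl := Subsingleton.elim j default
      simp only [Matrix.mul_apply, Fintype.sum_unique, Matrix.of_apply, selectZero]
      split_ifs with h
      · simp [h]
      · field_simp
    · refine Attains.bind (Attains.div (S.const_mem 1) (hS default default)) fun S₁ h₁ k₁ => ?_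
      refine (Attains.imp (Attains.sel (h₁ _ (hS default default)) (S₁.const_mem 1) k₁)
        fun S₂ h₂ k₂ => ⟨fun i j => ?_, ?_⟩).mono_cost (by simp only [regCost]; norm_num)
      · obtain rfl := Subsingleton.elim i default
        obtain rfl := Subsingleton.elim j default
        exact k₂
      · simpa only [Matrix.det_unique, Matrix.of_apply] using k₂
  | succ k ih =>
    intro m _ _ hm A
    have e : m ≃ Fin (2 ^ k) ⊕ Fin (2 ^ k) := Fintype.equivOfCardEq (by simp [hm, pow_succ, mul_two])
    obtain ⟨U, hU, hU'⟩ := exists_inner_inverse_step hμ (ih (Fin (2 ^ k)) (by simp))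
      (fun x => (A x).submatrix e.symm e.symm)
    refine ⟨fun x => (U x).submatrix e e, fun x => ⟨?_, ?_⟩, fun S hS => ?_⟩
    · rw [Matrix.det_submatrix_equiv_self]
      exact (hU x).1
    · have := congrArg (fun M => M.submatrix e e) (hU x).2
      simpa [← Matrix.submatrix_mul_equiv _ _ _ e _] using this
    · refine (Attains.imp (hU' S fun i j => hS _ _) fun T _ hT => ⟨fun i j => hT.1 _ _, ?_⟩).mono_cost
        ?_
      · simp [regCost, pow_succ, mul_two]
      · simpa only [Matrix.det_submatrix_equiv_self] using hT.2
end UnitRegularCost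

/-! ### Determinant, inverse and low-rank updates over a field. -/

section ScalarRoutines

variable {F : Type u} [Field F] {X : Type v} {μ : ℕ → ℝ} {S : Know F X}

open Matrix

open Classical in
theorem Attains.ite_forall_zero {ι : Type*} (s : Finset ι) {v : ι → X → F} {a b : X → F}
    (hv : ∀ i ∈ s, v i ∈ S) (ha : a ∈ S) (hb : b ∈ S) :
    Attains μ S (fun T => (fun x => if ∀ i ∈ s, v i x = 0 then a x else b x) ∈ T) s.card := by
  induction s using Finset.induction_on with
  | empty => exact Attains.pure (by simpa using ha) (by simp)
  | insert i s hi ih =>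
    refine Attains.bind (ih fun j hj => hv j (Finset.mem_insert_of_mem hj)) fun T hT k => ?_
    refine (Attains.imp (Attains.sel (hT _ (hv i (Finset.mem_insert_self _ _))) k (hT _ hb))
      fun T' _ k' => ?_).mono_cost (by rw [Finset.card_insert_of_notMem hi]; push_cast; linarith)
    convert k' using 2 with x
    simp only [selectZero, Finset.forall_mem_insert]
    split_ifs <;> simp_all

/-- The cost of determinant and inverse of an `n × n` matrix. -/
noncomputable def invCost (μ : ℕ → ℝ) (n : ℕ) : ℝ :=
  regCost μ (Nat.clog 2 n) + 5 * μ (2 ^ Nat.clog 2 n)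

variable {m : Type} [Fintype m] [DecidableEq m]

/-- If `A U A = A` with `U` invertible, then `A` is invertible exactly when `A U = 1`. Testing all
entries of `A U - 1` for zero therefore selects between `1 / det U` and `0`. The inverse is then a
block of `U`, or `0` for singular `A` in agreement with the convention for `⁻¹`. -/
theorem Attains.det_inv (hμ : MulCost μ) {A : X → Matrix m m F} (hA : KnM S A) :
    Attains μ S (fun T => (fun x => (A x).det) ∈ T ∧ KnM T fun x => (A x)⁻¹)
      (invCost μ (Fintype.card m)) := by
  classical
  set k := Nat.clog 2 (Fintype.card m) with hk
  have hk' : Fintype.card m ≤ 2 ^ k := Nat.le_pow_clog one_lt_two _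
  set l := Fin (2 ^ k - Fintype.card m)
  have hcard : Fintype.card (m ⊕ l) = 2 ^ k := by simp [l]; omega
  -- Padding by an identity block brings the size to a power of two without changing the
  -- determinant.
  set A' : X → Matrix (m ⊕ l) (m ⊕ l) F := fun x => fromBlocks (A x) 0 0 1 with hA'
  have hdet : ∀ x, (A' x).det = (A x).det := fun x => by simp [hA']
  obtain ⟨U, hU, hU'⟩ := exists_inner_inverse hμ k (m ⊕ l) hcard A'
  have hAU : ∀ x, (A x).det ≠ 0 → A' x * U x = 1 := by
    intro x hx
    have hu : IsUnit (A' x) := by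
      rw [isUnit_iff_isUnit_det, hdet]
      exact hx.isUnit
    exact hu.mul_right_cancel (by rw [(hU x).2, one_mul])
  have hdet' : ∀ x, (A x).det = if ∀ i ∈ (Finset.univ : Finset ((m ⊕ l) × (m ⊕ l))),
      (A' x * U x - 1) i.1 i.2 = 0 then 1 / (U x).det else 0 := by
    intro x
    split_ifs with h
    · have h1 : A' x * U x = 1 := by
        rw [← sub_eq_zero]
        ext i j
        exact h (i, j) (Finset.mem_univ _)
      have h2 := congrArg Matrix.det h1
      rw [det_mul, det_one, hdet] at h2
      rw [eq_div_iff (hU x).1, h2]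
    · by_contra hx
      exact h fun i _ => by rw [hAU x hx, sub_self]; rfl
  have hinv : ∀ i j, (fun x => (A x)⁻¹ i j) =
      selectZero (fun x => (A x).det) (fun _ => 0) (fun x => U x (Sum.inl i) (Sum.inl j)) := by
    intro i j
    funext x
    simp only [selectZero]
    split_ifs with hx
    · rw [nonsing_inv_apply_not_isUnit _ (by simp [hx])]
      rfl
    · have h1 := hAU x hx
      have h2 : A x * (U x).toBlocks₁₁ = 1 := by
        have := congrArg Matrix.toBlocks₁₁ h1
        rw [hA', ← fromBlocks_toBlocks (U x), fromBlocks_multiply] at this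
        simpa [← fromBlocks_one] using this
      rw [inv_eq_right_inv h2]
      rfl
  have hA'S : KnM S A' := by
    rintro (i | i) (j | j)
    · exact hA i j
    · exact S.const_mem 0
    · exact S.const_mem 0
    · exact S.const_mem ((1 : Matrix l l F) i j)
  refine Attains.bind (hU' S hA'S) fun T₁ h₁ ⟨k₁, k₂⟩ => ?_
  have hM : (Fintype.card (m ⊕ l) : ℝ) ^ 2 ≤ μ (2 ^ k) := by
    rw [hcard]
    exact hμ.sq_le _
  refine Attains.bind (MatCost.sub (μ := μ) hM (MatCost.mul (by rw [hcard])
    (MatCost.of_known (hA'S.mono h₁)) (MatCost.of_known k₁)) (MatCost.const 1) T₁ le_rfl)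
    fun T₂ h₂ k₃ => ?_
  refine Attains.bind (Attains.div (T₂.const_mem 1) (h₂ _ k₂)) fun T₃ h₃ k₄ => ?_
  refine Attains.bind (Attains.ite_forall_zero (Finset.univ : Finset ((m ⊕ l) × (m ⊕ l)))
    (v := fun i x => (A' x * U x - 1) i.1 i.2) (fun i _ => h₃ _ (k₃ i.1 i.2)) k₄
    (T₃.const_mem 0)) fun T₄ h₄ k₅ => ?_
  replace k₅ : (fun x => (A x).det) ∈ T₄ := by
    convert k₅ using 2 with x
    convert hdet' x
  refine (Attains.imp (Attains.family (ι := m × m) (v := fun (i : m × m) x => (A x)⁻¹ i.1 i.2) (c := 1)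
    fun i T hT => ?inv) fun T₅ h₅ k₆ => ⟨h₅ _ k₅, fun i j => k₆ (i, j)⟩).mono_cost ?cost
  case cost =>
    simp only [invCost, ← hk, Finset.card_univ, Fintype.card_prod, hcard]
    have h2 : ((2 ^ k : ℕ) : ℝ) ^ 2 ≤ μ (2 ^ k) := hμ.sq_le _
    have h3 : (Fintype.card m : ℝ) ≤ (2 ^ k : ℕ) := by exact_mod_cast hk'
    have h4 : (1 : ℝ) ≤ (2 ^ k : ℕ) := by exact_mod_cast Nat.one_le_two_pow
    push_cast at *
    nlinarith [(Nat.cast_nonneg (Fintype.card m) : (0 : ℝ) ≤ _)]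
  case inv =>
    rw [hinv]
    exact Attains.sel (hT _ k₅) (T.const_mem 0)
      (hT _ (h₄ _ (h₃ _ (h₂ _ (k₁ _ _)))))

/-- The determinant and its product with the adjugate, at every state. -/
theorem Attains.det_adjugate (hμ : MulCost μ) {A : X → Matrix m m F} (hA : KnM S A) :
    Attains μ S (fun T => (fun x => (A x).det) ∈ T ∧ (KnM T fun x => (A x)⁻¹) ∧
      KnM T fun x => (A x).det • (A x).adjugate)
      (invCost μ (Fintype.card m) + 2 * (Fintype.card m : ℝ) ^ 2) := by
  refine Attains.bind (Attains.det_inv hμ hA) fun T hT ⟨k₁, k₂⟩ => ?_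
  refine (Attains.imp (Attains.family (ι := m × m)
    (v := fun i x => (A x).det * ((A x).det * (A x)⁻¹ i.1 i.2)) (c := 2)
    fun i T' hT' => ?val) fun T₅ h₅ k₆ => ⟨h₅ _ k₁, k₂.mono h₅, fun i j => ?adj⟩).mono_cost ?cost
  case cost =>
    rw [Fintype.card_prod]
    push_cast
    linarith
  case val =>
    refine Attains.bind (Attains.mul (hT' _ k₁) (hT' _ (k₂ i.1 i.2))) fun T₁ h₁ k => ?_
    exact (Attains.mul (h₁ _ (hT' _ k₁)) k).mono_cost (by norm_num)
  case adj =>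
    convert k₆ (i, j) using 2 with x
    -- For singular `A` the adjugate may be nonzero, but its product with the determinant is `0`, as
    -- is the computed value.
    by_cases hx : (A x).det = 0
    · simp [hx]
    · rw [inv_def]
      simp [hx]

/-- The matrix of the low-rank correction for an update `C` supported on `P`. -/
noncomputable def updateMatrix {F : Type u} [Field F] (A C : Matrix m m F) (P : Finset (m × m)) :
    Matrix {p // p ∈ P} {p // p ∈ P} F :=
  1 + Matrix.of fun s t => A⁻¹ s.1.2 t.1.1 * C t.1.1 t.1.2

/-- The support of `C` gives a factorization of inner dimension `P.card`: each position contributes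
a multiple of a unit column to `U` and a unit row to `V`. The last clause expands an entry of the
correction in Woodbury's formula, so that one entry costs only `O(P.card ^ 2)` operations once the
small inverse is known. -/
theorem eq_mul_of_support {A C : Matrix m m F} {P : Finset (m × m)}
    (hC : ∀ p q, (p, q) ∉ P → C p q = 0) :
    ∃ (U : Matrix m {p // p ∈ P} F) (V : Matrix {p // p ∈ P} m F), C = U * V ∧
      updateMatrix A C P = 1 + V * (A⁻¹ * U) ∧
      ∀ (N : Matrix {p // p ∈ P} {p // p ∈ P} F) i j, (A⁻¹ * U * N * V * A⁻¹) i j =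
        ∑ s : {p // p ∈ P} × {p // p ∈ P},
          (A⁻¹ i s.1.1.1 * C s.1.1.1 s.1.1.2 * N s.1 s.2) * A⁻¹ s.2.1.2 j := by
  refine ⟨Matrix.of fun p s => if p = s.1.1 then C s.1.1 s.1.2 else 0,
    Matrix.of fun s q => if s.1.2 = q then 1 else 0, ?_, ?_, ?_⟩
  · ext p q
    simp only [mul_apply, of_apply, mul_ite, mul_one, mul_zero]
    rw [Finset.sum_coe_sort P (fun s : m × m => if s.2 = q then
      (if p = s.1 then C s.1 s.2 else 0) else 0)]
    by_cases h : (p, q) ∈ P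
    · rw [Finset.sum_eq_single_of_mem (p, q) h]
      · simp
      · rintro ⟨a, b⟩ _ hne
        by_cases h1 : b = q <;> by_cases h2 : p = a <;> simp_all
    · rw [hC p q h, Finset.sum_eq_zero]
      rintro ⟨a, b⟩ hab
      by_cases h1 : b = q <;> by_cases h2 : p = a <;> simp_all
  · rw [updateMatrix]
    congr 1
    ext s t
    simp [mul_apply]
  · intro N i j
    rw [Fintype.sum_prod_type_right, Matrix.mul_assoc (A⁻¹ * _ * N), mul_apply]
    refine Finset.sum_congr rfl fun t _ => ?_
    rw [mul_apply, Finset.sum_mul]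
    refine Finset.sum_congr rfl fun s _ => ?_
    simp [mul_apply]

/-- The low-rank update formulas for determinant and inverse. -/
theorem det_inv_update {A C : Matrix m m F} {P : Finset (m × m)}
    (hC : ∀ p q, (p, q) ∉ P → C p q = 0) (hA : A.det ≠ 0) :
    (A + C).det = A.det * (updateMatrix A C P).det ∧ ((updateMatrix A C P).det ≠ 0 → ∀ i j,
      (A + C)⁻¹ i j = A⁻¹ i j - ∑ s : {p // p ∈ P} × {p // p ∈ P},
        (A⁻¹ i s.1.1.1 * C s.1.1.1 s.1.1.2 * (updateMatrix A C P)⁻¹ s.1 s.2) * A⁻¹ s.2.1.2 j) := by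
  obtain ⟨U, V, hUV, hM, hN⟩ := eq_mul_of_support (A := A) hC
  have hAu : IsUnit A := by rw [isUnit_iff_isUnit_det]; exact hA.isUnit
  have h1 : A * A⁻¹ = 1 := mul_nonsing_inv _ hA.isUnit
  constructor
  · have : A + C = A * (1 + (A⁻¹ * U) * V) := by
      rw [Matrix.mul_add, Matrix.mul_one, ← Matrix.mul_assoc, ← Matrix.mul_assoc, h1,
        Matrix.one_mul, hUV]
    rw [this, det_mul, det_one_add_mul_comm, ← hM]
  · intro hd i j
    have h2 := add_mul_mul_inv_eq_sub A U 1 V hAu isUnit_one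
      (by rw [inv_one, Matrix.mul_assoc, ← hM, isUnit_iff_isUnit_det]; exact hd.isUnit)
    rw [Matrix.mul_one, inv_one, ← hUV, Matrix.mul_assoc V, ← hM] at h2
    rw [h2, Matrix.sub_apply, hN]

/-- The stored inverse is meaningless where `det A = 0`, and the small inverse where `det (A + C) =
0`. The factors `det A` and `det (A + C)` make the outputs vanish there, so they are correct at
every state. -/
theorem Attains.update (hμ : MulCost μ) {A C : X → Matrix m m F} {P : Finset (m × m)}
    (hP : P.Nonempty) (hC : ∀ x p q, (p, q) ∉ P → C x p q = 0)
    (kd : (fun x => (A x).det) ∈ S) (ki : KnM S fun x => (A x)⁻¹)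
    (kC : ∀ p ∈ P, (fun x => C x p.1 p.2) ∈ S) (i j : m) :
    Attains μ S (fun T => (fun x => (A x).det * (A x + C x).det) ∈ T ∧
      (fun x => (A x).det * (A x + C x).det * (A x + C x).adjugate i j) ∈ T)
      (invCost μ P.card + 12 * (P.card : ℝ) ^ 2) := by
  set M := fun x => updateMatrix (A x) (C x) P with hM
  set f := P.card with hf
  have hcard : Fintype.card {p // p ∈ P} = f := by simp [hf]
  have hf1 : (1 : ℝ) ≤ f := by exact_mod_cast hP.card_pos
  refine Attains.bind (Attains.family (ι := {p // p ∈ P} × {p // p ∈ P})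
    (v := fun s x => (A x)⁻¹ s.1.1.2 s.2.1.1 * C x s.2.1.1 s.2.1.2)
    fun s T hT => Attains.mul (hT _ (ki _ _)) (hT _ (kC _ s.2.2))) fun T₁ h₁ k₁ => ?_
  refine Attains.bind ((MatCost.add (μ := μ) (M := (f : ℝ) ^ 2) (by rw [hcard]) (MatCost.const 1)
    (MatCost.of_known (A := fun x => Matrix.of fun (s t : {p // p ∈ P}) =>
      (A x)⁻¹ s.1.2 t.1.1 * C x t.1.1 t.1.2) (fun s t => k₁ (s, t)))) T₁ le_rfl)
    fun T₂ h₂ (k₂ : KnM T₂ M) => ?_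
  refine Attains.bind (Attains.det_inv hμ k₂) fun T₃ h₃ ⟨k₃, k₄⟩ => ?_
  have l₃ := (h₁.trans h₂).trans h₃
  refine Attains.bind (Attains.family (ι := {p // p ∈ P})
    (v := fun s x => (A x)⁻¹ i s.1.1 * C x s.1.1 s.1.2)
    fun s T hT => Attains.mul (hT _ (l₃ _ (ki _ _))) (hT _ (l₃ _ (kC _ s.2)))) fun T₄ h₄ k₅ => ?_
  refine Attains.bind (Attains.family (ι := {p // p ∈ P} × {p // p ∈ P})
    (v := fun s x => (A x)⁻¹ i s.1.1.1 * C x s.1.1.1 s.1.1.2 * (M x)⁻¹ s.1 s.2)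
    fun s T hT => Attains.mul (hT _ (k₅ _)) (hT _ (h₄ _ (k₄ _ _)))) fun T₅ h₅ k₆ => ?_
  have l₅ := (l₃.trans h₄).trans h₅
  refine Attains.bind (Attains.sum_mul Finset.univ (fun s _ => k₆ s)
    (w := fun s x => (A x)⁻¹ s.2.1.2 j) fun s _ => l₅ _ (ki _ _)) fun T₆ h₆ k₇ => ?_
  refine Attains.bind (Attains.sub ((l₅.trans h₆) _ (ki i j)) k₇) fun T₇ h₇ k₈ => ?_
  have l₇ := (l₅.trans h₆).trans h₇
  have k₃' := ((h₄.trans h₅).trans (h₆.trans h₇)) _ k₃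
  -- Where `A` is invertible, `det A * det M` is `det (A + C)`. Multiplied by the entry of the
  -- updated inverse it gives the adjugate entry if `A + C` is invertible too.
  refine Attains.bind (Attains.mul (l₇ _ kd) k₃') fun T₈ h₈ k₉ => ?_
  refine Attains.bind (Attains.mul ((l₇.trans h₈) _ kd) k₉) fun T₉ h₉ k₁₀ => ?_
  refine Attains.bind (Attains.mul (h₉ _ k₉) (h₉ _ (h₈ _ k₈))) fun U h k₁₁ => ?_
  refine (Attains.imp (Attains.mul (h _ k₁₀) k₁₁) fun U' h' k₁₂ => ⟨?det, ?adj⟩).mono_cost ?cost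
  case cost =>
    simp only [Fintype.card_prod, hcard, Finset.card_univ]
    push_cast
    nlinarith
  case det =>
    convert h' _ (h _ k₁₀) using 2 with x
    by_cases hx : (A x).det = 0
    · simp [hx]
    · rw [(det_inv_update (hC x) hx).1]
  case adj =>
    convert k₁₂ using 2 with x
    by_cases hx : (A x).det = 0
    · simp [hx]
    · obtain ⟨h1, h2⟩ := det_inv_update (hC x) hx
      by_cases hy : (updateMatrix (A x) (C x) P).det = 0
      · simp [hM, h1, hy]
      · have h3 : (A x + C x).adjugate i j = (A x + C x).det * (A x + C x)⁻¹ i j := by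
          rw [inv_def]
          have : (A x + C x).det ≠ 0 := by rw [h1]; exact mul_ne_zero hx hy
          simp [this]
        rw [h3, h2 hy, h1]

end ScalarRoutines

/-! ### Solving the recurrence for `c * n ^ ω`. -/

section RegCostBound

theorem MulCost.rpow {ω c : ℝ} (hω : 2 ≤ ω) (hc : 1 ≤ c) :
    MulCost fun n : ℕ => c * (n : ℝ) ^ ω where
  sq_le n := by
    rcases Nat.eq_zero_or_pos n with rfl | hn
    · simp [Real.zero_rpow (by linarith : ω ≠ 0)]
    · have hn : (1 : ℝ) ≤ n := by exact_mod_cast hn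
      have h1 : (n : ℝ) ^ (2 : ℝ) ≤ (n : ℝ) ^ ω := Real.rpow_le_rpow_of_exponent_le hn hω
      rw [Real.rpow_two] at h1
      have : (0 : ℝ) ≤ (n : ℝ) ^ 2 := sq_nonneg _
      nlinarith
  mono := by
    intro a b hab
    have : (a : ℝ) ^ ω ≤ (b : ℝ) ^ ω :=
      Real.rpow_le_rpow (Nat.cast_nonneg _) (by exact_mod_cast hab) (by linarith)
    exact mul_le_mul_of_nonneg_left this (by linarith)

theorem four_pow_mul_rpow (ω : ℝ) (k : ℕ) :
    (4 : ℝ) ^ k * ((2 : ℝ) ^ (ω - 2)) ^ k = ((2 ^ k : ℕ) : ℝ) ^ ω := by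
  symm
  rw [← mul_pow, Real.rpow_sub two_pos, Real.rpow_two]
  push_cast
  rw [← Real.rpow_natCast, ← Real.rpow_mul two_pos.le, mul_comm, Real.rpow_mul two_pos.le,
    Real.rpow_natCast]
  congr 1
  field_simp
  norm_num

/-- Divided by `4 ^ k`, the recurrence becomes a sum of powers of the ratio `2 ^ (ω - 2)`. -/
theorem regCost_rpow (ω c : ℝ) (k : ℕ) :
    regCost (fun n : ℕ => c * (n : ℝ) ^ ω) k =
      4 ^ k * (2 + 500 * c * ∑ i ∈ Finset.range k, ((2 : ℝ) ^ (ω - 2)) ^ (i + 1)) := by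
  induction k with
  | zero => simp [regCost]
  | succ k ih =>
    rw [regCost, ih, Finset.sum_range_succ, ← four_pow_mul_rpow]
    ring

theorem two_pow_clog_rpow_le {ω : ℝ} (hω : 0 ≤ ω) {n : ℕ} (hn : 1 ≤ n) :
    ((2 ^ Nat.clog 2 n : ℕ) : ℝ) ^ ω ≤ 2 ^ ω * (n : ℝ) ^ ω := by
  rw [← Real.mul_rpow two_pos.le (Nat.cast_nonneg _)]
  refine Real.rpow_le_rpow (Nat.cast_nonneg _) ?_ hω
  rcases hn.eq_or_lt with rfl | hn
  · simp
  · have h := Nat.pow_pred_clog_lt_self one_lt_two hn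
    have h1 : 0 < Nat.clog 2 n := Nat.clog_pos one_lt_two hn
    obtain ⟨k, hk⟩ := Nat.exists_eq_succ_of_ne_zero h1.ne'
    rw [hk] at h ⊢
    have : 2 ^ k.succ ≤ 2 * n := by
      rw [pow_succ]
      simp only [Nat.pred_succ] at h
      omega
    exact_mod_cast this

/-- Each of the `clog 2 n` terms of the sum is bounded by the last one. The resulting logarithm
covers the case `ω = 2`, where the ratio is `1`. -/
theorem invCost_le_log {ω c : ℝ} (hω : 2 ≤ ω) (hc : 1 ≤ c) {n : ℕ} (hn : 1 ≤ n) :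
    invCost (fun n : ℕ => c * (n : ℝ) ^ ω) n ≤
      600 * c * 2 ^ ω * (Nat.clog 2 n + 1) * (n : ℝ) ^ ω := by
  set k := Nat.clog 2 n
  set r := (2 : ℝ) ^ (ω - 2) with hr
  have hr1 : 1 ≤ r := Real.one_le_rpow one_le_two (by linarith)
  have hsum : ∑ i ∈ Finset.range k, r ^ (i + 1) ≤ k * r ^ k := by
    refine (Finset.sum_le_card_nsmul _ _ (r ^ k) fun i hi => ?_).trans (by simp)
    exact pow_le_pow_right₀ hr1 (Finset.mem_range.1 hi)
  have h2 := two_pow_clog_rpow_le (by linarith : 0 ≤ ω) hn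
  set N := ((2 ^ k : ℕ) : ℝ) ^ ω with hN
  have h4 : (4 : ℝ) ^ k * r ^ k = N := four_pow_mul_rpow ω k
  have hrk : 1 ≤ r ^ k := one_le_pow₀ hr1
  have h4k : (0 : ℝ) < 4 ^ k := by positivity
  have hN0 : 0 ≤ N := by positivity
  have h1 : regCost (fun n : ℕ => c * (n : ℝ) ^ ω) k ≤ 2 * N + 500 * c * k * N := by
    rw [regCost_rpow, ← h4, mul_add]
    have : (4 : ℝ) ^ k * (500 * c * ∑ i ∈ Finset.range k, r ^ (i + 1)) ≤
        4 ^ k * (500 * c * (k * r ^ k)) := by gcongr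
    nlinarith
  calc _ = regCost (fun n : ℕ => c * (n : ℝ) ^ ω) k + 5 * (c * N) := rfl
    _ ≤ 600 * c * (k + 1) * N := by
      have : 0 ≤ c * k * N := by positivity
      nlinarith [mul_le_mul_of_nonneg_right hc hN0]
    _ ≤ 600 * c * (k + 1) * (2 ^ ω * (n : ℝ) ^ ω) := by gcongr
    _ = _ := by ring

/-- For `ω > 2` the ratio exceeds `1`, and the geometric sum is a constant times its last term. This
removes the logarithm, as the case `d = 0` requires. -/
theorem invCost_le {ω c : ℝ} (hω : 2 < ω) (hc : 1 ≤ c) :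
    ∃ K : ℝ, 0 ≤ K ∧ ∀ n : ℕ, 1 ≤ n →
      invCost (fun n : ℕ => c * (n : ℝ) ^ ω) n ≤ K * (n : ℝ) ^ ω := by
  set r := (2 : ℝ) ^ (ω - 2) with hr
  have hr1 : 1 < r := Real.one_lt_rpow one_lt_two (by linarith)
  have hr0 : 0 < r - 1 := by linarith
  refine ⟨(2 + 500 * c * (r / (r - 1)) + 5 * c) * 2 ^ ω, by positivity, fun n hn => ?_⟩
  set k := Nat.clog 2 n
  have hsum : ∑ i ∈ Finset.range k, r ^ (i + 1) ≤ r / (r - 1) * r ^ k := by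
    simp only [pow_succ, ← Finset.sum_mul]
    rw [geom_sum_eq hr1.ne', div_mul_eq_mul_div, div_mul_eq_mul_div, mul_comm r]
    gcongr
    linarith
  have h2 := two_pow_clog_rpow_le (by linarith : 0 ≤ ω) hn
  set N := ((2 ^ k : ℕ) : ℝ) ^ ω with hN
  have h4 : (4 : ℝ) ^ k * r ^ k = N := four_pow_mul_rpow ω k
  have hrk : 1 ≤ r ^ k := one_le_pow₀ hr1.le
  have h4k : (0 : ℝ) < 4 ^ k := by positivity
  have h1 : regCost (fun n : ℕ => c * (n : ℝ) ^ ω) k ≤ 2 * N + 500 * c * (r / (r - 1)) * N := by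
    rw [regCost_rpow, ← h4, mul_add]
    have : (4 : ℝ) ^ k * (500 * c * ∑ i ∈ Finset.range k, r ^ (i + 1)) ≤
        4 ^ k * (500 * c * (r / (r - 1) * r ^ k)) := by gcongr
    nlinarith
  calc _ = regCost (fun n : ℕ => c * (n : ℝ) ^ ω) k + 5 * (c * N) := rfl
    _ ≤ (2 + 500 * c * (r / (r - 1)) + 5 * c) * N := by linarith
    _ ≤ (2 + 500 * c * (r / (r - 1)) + 5 * c) * (2 ^ ω * (n : ℝ) ^ ω) := by gcongr
    _ = _ := by ring

end RegCostBound

/-! ### Fourier inversion in `F[y] / (y ^ q - 1)`. -/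

section CyclicAlgebra

variable {F : Type u} [Field F] {q : ℕ}

/-- The power `y ^ a` of the generator of `F[y] / (y ^ q - 1)`. -/
noncomputable def cyc (F : Type u) [Field F] (q : ℕ) (a : ZMod q) : AddMonoidAlgebra F (ZMod q) :=
  AddMonoidAlgebra.single a 1

theorem cyc_add (a b : ZMod q) : cyc F q (a + b) = cyc F q a * cyc F q b := by
  simp [cyc, AddMonoidAlgebra.single_mul_single]

theorem cyc_zero : cyc F q 0 = 1 := rfl

theorem coeff_cyc_mul (a b : ZMod q) (f : AddMonoidAlgebra F (ZMod q)) :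
    (cyc F q a * f).coeff b = f.coeff (b - a) := by
  rw [cyc, AddMonoidAlgebra.coeff_single_mul_apply, one_mul, sub_eq_neg_add]

theorem sum_range_mul {M : Type*} [AddCommMonoid M] (p n : ℕ) (g : ℕ → M) :
    ∑ i ∈ Finset.range (p * n), g i = ∑ r ∈ Finset.range p, ∑ i ∈ Finset.range n, g (r + p * i) := by
  rw [Finset.sum_comm]
  induction n with
  | zero => simp
  | succ n ih =>
    rw [Nat.mul_succ, Finset.sum_range_add, ih, Finset.sum_range_succ]
    simp only [add_comm]

/-- The residue of a polynomial modulo `y ^ q - 1`. -/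
noncomputable def toCyc (F : Type u) [Field F] (q : ℕ) : F[X] →ₐ[F] AddMonoidAlgebra F (ZMod q) :=
  aeval (cyc F q 1)

theorem cyc_pow (n : ℕ) : cyc F q 1 ^ n = cyc F q n := by
  induction n with
  | zero => simp [cyc_zero]
  | succ n ih => rw [pow_succ, ih, ← cyc_add]; push_cast; rfl

theorem toCyc_coeff_of_lt [NeZero q] {P : F[X]} (hP : P.natDegree < q) (a : ZMod q) :
    (toCyc F q P).coeff a = P.coeff a.val := by
  rw [toCyc, aeval_eq_sum_range' hP]
  simp only [cyc_pow, AddMonoidAlgebra.coeff_sum, Finset.sum_apply', AddMonoidAlgebra.coeff_smul,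
    Finsupp.smul_apply]
  simp only [cyc, AddMonoidAlgebra.coeff_single]
  rw [Finset.sum_eq_single_of_mem a.val (Finset.mem_range.2 (ZMod.val_lt a))]
  · simp
  · intro b hb hne
    rw [Finsupp.single_apply, if_neg, smul_zero]
    rintro rfl
    exact hne (ZMod.val_cast_of_lt (Finset.mem_range.1 hb)).symm

theorem toCyc_coeff_of_lt_two_mul [NeZero q] {P : F[X]} (hP : P.natDegree < 2 * q) (a : ZMod q) :
    (toCyc F q P).coeff a = P.coeff a.val + P.coeff (a.val + q) := by
  rw [toCyc, aeval_eq_sum_range' hP]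
  simp only [cyc_pow, AddMonoidAlgebra.coeff_sum, Finset.sum_apply', AddMonoidAlgebra.coeff_smul,
    Finsupp.smul_apply]
  simp only [cyc, AddMonoidAlgebra.coeff_single]
  rw [two_mul, Finset.sum_range_add]
  congr 1
  · rw [Finset.sum_eq_single_of_mem a.val (Finset.mem_range.2 (ZMod.val_lt a))]
    · simp
    · intro b hb hne
      rw [Finsupp.single_apply, if_neg, smul_zero]
      rintro rfl
      exact hne (ZMod.val_cast_of_lt (Finset.mem_range.1 hb)).symm
  · rw [Finset.sum_eq_single_of_mem a.val (Finset.mem_range.2 (ZMod.val_lt a))]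
    · simp [add_comm]
    · intro b hb hne
      rw [Finsupp.single_apply, if_neg, smul_zero]
      rintro rfl
      apply hne
      push_cast
      rw [ZMod.natCast_self, zero_add]
      exact (ZMod.val_cast_of_lt (Finset.mem_range.1 hb)).symm

variable {p j : ℕ}

/-- A nonzero subgroup of a cyclic group of order `p ^ (j + 1)` contains the subgroup of order `p`,
which `p ^ j` generates. -/
theorem exists_mul_eq_pow (hp : p.Prime) (c : ZMod (p ^ (j + 1))) (hc : c ≠ 0) :
    ∃ t : ZMod (p ^ (j + 1)), t * c = (p ^ j : ℕ) := by
  have : NeZero (p ^ (j + 1)) := ⟨pow_ne_zero _ hp.ne_zero⟩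
  have hc0 : c.val ≠ 0 := by rwa [Ne, ZMod.val_eq_zero]
  obtain ⟨a, u, hu, hcu⟩ := Nat.exists_eq_pow_mul_and_not_dvd hc0 p hp.ne_one
  have haj : a ≤ j := by
    by_contra h
    have h1 : p ^ (j + 1) ∣ c.val := by
      rw [hcu]
      exact Dvd.dvd.mul_right (pow_dvd_pow p (by omega)) u
    exact hc0 (Nat.eq_zero_of_dvd_of_lt h1 (ZMod.val_lt c))
  have hcop : Nat.Coprime u (p ^ (j + 1)) :=
    ((Nat.Prime.coprime_iff_not_dvd hp).2 hu).symm.pow_right _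
  refine ⟨(p ^ (j - a) : ℕ) * (u : ZMod (p ^ (j + 1)))⁻¹, ?_⟩
  have h2 : c = ((p ^ a : ℕ) : ZMod (p ^ (j + 1))) * u := by
    rw [← Nat.cast_mul, ← hcu, ZMod.natCast_zmod_val]
  rw [h2, mul_mul_mul_comm, mul_comm (u : ZMod (p ^ (j + 1)))⁻¹, ZMod.coe_mul_inv_eq_one _ hcop, mul_one,
    ← Nat.cast_mul, ← pow_add, Nat.sub_add_cancel haj]

/-- In `F[y] / (y ^ q - 1)` the sum of the powers `y ^ (k c)` need not vanish for `c ≠ 0`. It is,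
however, invariant under multiplication by every `y ^ (t c)`. Some `t c` equals `p ^ j`, so `1 - y ^
(p ^ j)` annihilates the sum. Orthogonality thus holds up to this factor. -/
theorem one_sub_mul_sum_cyc (hp : p.Prime) (c : ZMod (p ^ (j + 1))) :
    (1 - cyc F (p ^ (j + 1)) (p ^ j : ℕ)) *
      ∑ k ∈ Finset.range (p ^ (j + 1)), cyc F (p ^ (j + 1)) (k * c) =
    (1 - cyc F (p ^ (j + 1)) (p ^ j : ℕ)) *
      if c = 0 then ((p ^ (j + 1) : ℕ) : AddMonoidAlgebra F (ZMod (p ^ (j + 1)))) else 0 := by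
  have : NeZero (p ^ (j + 1)) := ⟨pow_ne_zero _ hp.ne_zero⟩
  split_ifs with hc
  · subst hc
    simp [cyc_zero]
  · obtain ⟨t, ht⟩ := exists_mul_eq_pow hp c hc
    have h1 : ∑ k ∈ Finset.range (p ^ (j + 1)), cyc F (p ^ (j + 1)) (k * c) =
        ∑ k : ZMod (p ^ (j + 1)), cyc F (p ^ (j + 1)) (k * c) := by
      refine Finset.sum_bij' (fun k _ => (k : ZMod _)) (fun k _ => k.val) (by simp)
        (fun k _ => Finset.mem_range.2 (ZMod.val_lt k))
        (fun k hk => ZMod.val_cast_of_lt (Finset.mem_range.1 hk)) (by simp) (by simp)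
    rw [h1, mul_zero, sub_mul, one_mul, ← ht, Finset.mul_sum, sub_eq_zero]
    simp only [← cyc_add, ← add_mul]
    exact (Fintype.sum_equiv (Equiv.addLeft t) _ _ fun k => rfl).symm

/-- The inverse transform recovers cyclic convolutions up to the factor `1 - y ^ (q / p)`. -/
theorem one_sub_mul_inverse_dft (hp : p.Prime) (f g : ℕ → AddMonoidAlgebra F (ZMod (p ^ (j + 1))))
    (s : ℕ) (hs : 2 * s ≤ p ^ (j + 1)) (hf : ∀ i, s ≤ i → f i = 0) (hg : ∀ i, s ≤ i → g i = 0)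
    (l : ℕ) (hl : l < p ^ (j + 1)) :
    let q := p ^ (j + 1)
    (1 - cyc F q (p ^ j : ℕ)) * ∑ k ∈ Finset.range q, cyc F q ((k * l : ℕ) * (-1)) *
      ((∑ i ∈ Finset.range q, cyc F q ((i * k : ℕ) * 1) * f i) *
        ∑ i ∈ Finset.range q, cyc F q ((i * k : ℕ) * 1) * g i) =
    (1 - cyc F q (p ^ j : ℕ)) * ((q : ℕ) * ∑ i ∈ Finset.range q, ∑ i' ∈ Finset.range q,
      if i + i' = l then f i * g i' else 0) := by
  intro q
  have h1 : ∑ k ∈ Finset.range q, cyc F q ((k * l : ℕ) * (-1)) *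
      ((∑ i ∈ Finset.range q, cyc F q ((i * k : ℕ) * 1) * f i) *
        ∑ i ∈ Finset.range q, cyc F q ((i * k : ℕ) * 1) * g i) =
      ∑ i ∈ Finset.range q, ∑ i' ∈ Finset.range q,
        (∑ k ∈ Finset.range q, cyc F q (k * (i + i' - l))) * (f i * g i') := by
    simp only [Finset.sum_mul_sum]
    simp only [Finset.mul_sum, Finset.sum_mul]
    rw [Finset.sum_comm]
    refine Finset.sum_congr rfl fun i _ => ?_
    rw [Finset.sum_comm]
    refine Finset.sum_congr rfl fun i' _ => Finset.sum_congr rfl fun k _ => ?_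
    have : cyc F q (k * (i + i' - l)) =
        cyc F q ((k * l : ℕ) * (-1)) * cyc F q ((i * k : ℕ) * 1) * cyc F q ((i' * k : ℕ) * 1) := by
      rw [← cyc_add, ← cyc_add]
      congr 1
      push_cast
      ring
    rw [this]
    ring
  rw [h1]
  simp only [Finset.mul_sum]
  refine Finset.sum_congr rfl fun i hi => Finset.sum_congr rfl fun i' hi' => ?_
  rw [← mul_assoc, one_sub_mul_sum_cyc hp, mul_assoc]
  congr 1
  rw [Finset.mem_range] at hi hi'
  by_cases h : i + i' = l
  · rw [if_pos h, if_pos]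
    rw [← h]
    push_cast
    ring
  · rw [if_neg h, mul_zero]
    by_cases h2 : i < s ∧ i' < s
    · rw [if_neg, zero_mul]
      rw [sub_eq_zero]
      intro h3
      -- Both `i + i' < 2 s ≤ q` and `l < q`, so congruence modulo `q` is equality and the
      -- convolution does not wrap around.
      rw [← Nat.cast_add, ZMod.natCast_eq_natCast_iff', Nat.mod_eq_of_lt (by omega),
        Nat.mod_eq_of_lt hl] at h3
      exact h h3
    · rcases not_and_or.1 h2 with h2 | h2
      · rw [hf i (by omega), zero_mul, mul_zero]
      · rw [hg i' (by omega), mul_zero, mul_zero]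

end CyclicAlgebra

/-! ### The fast Fourier transform and its cost. -/

section PolyMulCost

variable {F : Type u} [Field F] {X : Type v} {μ : ℕ → ℝ} {S S' : Know F X} {q : ℕ}

/-- All coefficients of a state-dependent element of `F[y] / (y ^ q - 1)` are known. -/
def KnB (S : Know F X) (f : X → AddMonoidAlgebra F (ZMod q)) : Prop :=
  ∀ a, (fun x => (f x).coeff a) ∈ S

theorem KnB.mono {f : X → AddMonoidAlgebra F (ZMod q)} (h : KnB S f) (hS : S ≤ S') : KnB S' f :=
  fun a => hS _ (h a)

/-- Multiplication by a power of `y` is a cyclic shift of coefficients. The twiddle factors of the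
transform are therefore free, and the field itself need not contain roots of unity. -/
theorem KnB.cyc_mul {f : X → AddMonoidAlgebra F (ZMod q)} (h : KnB S f) (a : ZMod q) :
    KnB S fun x => cyc F q a * f x := by
  intro b
  simp only [coeff_cyc_mul]
  exact h (b - a)

theorem Attains.sumB [NeZero q] {ι : Type*} (s : Finset ι)
    {f : ι → X → AddMonoidAlgebra F (ZMod q)} (h : ∀ i ∈ s, KnB S (f i)) :
    Attains μ S (fun T => KnB T fun x => ∑ i ∈ s, f i x) (s.card * q) := by
  refine (Attains.family (c := s.card) fun a T hT => ?_).mono_cost (by rw [ZMod.card]; linarith)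
  simp only [AddMonoidAlgebra.coeff_sum, Finset.sum_apply']
  exact Attains.sum s fun i hi => hT _ (h i hi a)

/-- The fast Fourier transform of length `p ^ r` over `F[y] / (y ^ q - 1)`. -/
theorem Attains.dft [NeZero q] {p : ℕ} (hp : 1 ≤ p) (r : ℕ) :
    ∀ (c : ZMod q), ((p ^ r : ℕ) : ZMod q) * c = 0 → ∀ (S : Know F X)
      (f : ℕ → X → AddMonoidAlgebra F (ZMod q)), (∀ i, KnB S (f i)) →
      Attains μ S (fun T => ∀ k : ℕ, KnB T fun x => ∑ i ∈ Finset.range (p ^ r),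
        cyc F q ((i * k : ℕ) * c) * f i x) (r * p ^ (r + 1) * q) := by
  induction r with
  | zero =>
    intro c _ S f hf
    refine Attains.pure (fun k => ?_) (by simp)
    simpa [cyc_zero] using hf 0
  | succ r ih =>
    intro c hc S f hf
    have hc' : ((p ^ r : ℕ) : ZMod q) * (p * c) = 0 := by
      rw [← hc]
      push_cast
      ring
    refine Attains.bind (Attains.forall_lt (N := p) (Φ := fun a T => ∀ k : ℕ, KnB T fun x =>
      ∑ i ∈ Finset.range (p ^ r), cyc F q ((i * k : ℕ) * (p * c)) * f (a + p * i) x)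
      (fun a S₁ S₂ h h' k => (h' k).mono h)
      fun a _ T hT => ih (p * c) hc' T (fun i => f (a + p * i)) fun i => (hf _).mono hT)
      fun T₁ h₁ k₁ => ?_
    -- Splitting the indices by residue modulo `p` gives `p` transforms of length `p ^ r`, whose
    -- root is the `p`-th power of the original one.
    have hsplit : ∀ (k : ℕ) (x : X), ∑ i ∈ Finset.range (p ^ (r + 1)),
        cyc F q ((i * k : ℕ) * c) * f i x = ∑ a ∈ Finset.range p, cyc F q ((a * k : ℕ) * c) *
          ∑ i ∈ Finset.range (p ^ r), cyc F q ((i * k : ℕ) * (p * c)) * f (a + p * i) x := by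
      intro k x
      rw [pow_succ', sum_range_mul]
      refine Finset.sum_congr rfl fun a _ => ?_
      rw [Finset.mul_sum]
      refine Finset.sum_congr rfl fun i _ => ?_
      rw [← mul_assoc, ← cyc_add]
      congr 2
      push_cast
      ring
    refine (Attains.imp (Attains.forall_lt (N := p ^ (r + 1)) (Φ := fun k T => KnB T fun x =>
      ∑ i ∈ Finset.range (p ^ (r + 1)), cyc F q ((i * k : ℕ) * c) * f i x)
      (c := p * q) (fun a S₁ S₂ h h' => h'.mono h) fun k _ T hT => ?_)
      fun T hT hk k => ?_).mono_cost ?_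
    · simp only [hsplit]
      refine (Attains.sumB (Finset.range p) fun a ha =>
        ((k₁ a (Finset.mem_range.1 ha) k).mono hT).cyc_mul _).mono_cost (by simp)
    -- The transform has period `p ^ (r + 1)` in `k` by `hc`, so one period provides all values.
    · have h := hk (k % p ^ (r + 1)) (Nat.mod_lt _ (by positivity))
      have e : ∀ i : ℕ, ((i * k : ℕ) : ZMod q) * c = (i * (k % p ^ (r + 1)) : ℕ) * c := by
        intro i
        conv_lhs => rw [← Nat.mod_add_div k (p ^ (r + 1))]
        push_cast at hc ⊢
        linear_combination ((i : ZMod q) * ((k / p ^ (r + 1) : ℕ) : ZMod q)) * hc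
      simpa only [e] using h
    · push_cast
      apply le_of_eq
      ring

/-- Polynomials of degree less than `N` can be multiplied at cost `c`. -/
def PolyMul (μ : ℕ → ℝ) (F : Type u) [Field F] (X : Type v) (N : ℕ) (c : ℝ) : Prop :=
  ∀ (S : Know F X) (f g : X → F[X]), (∀ x, (f x).natDegree < N) → (∀ x, (g x).natDegree < N) →
    KnP S f → KnP S g → Attains μ S (fun T => KnP T fun x => f x * g x) c

theorem Attains.knP_of_lt {N : ℕ} {f : X → F[X]} (hf : ∀ x, (f x).natDegree < N) {c : ℝ}
    (h : ∀ i < N, ∀ T, S ≤ T → Attains μ T (fun T' => (fun x => (f x).coeff i) ∈ T') c) :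
    Attains μ S (fun T => KnP T f) (N * c) := by
  refine Attains.imp (Attains.family_lt h) fun T _ hT i => ?_
  by_cases hi : i < N
  · exact hT i hi
  · convert T.const_mem 0 using 2 with x
    exact coeff_eq_zero_of_natDegree_lt (by have := hf x; omega)

theorem natDegree_mul_lt {f g : F[X]} {N : ℕ} (hf : f.natDegree < N) (hg : g.natDegree < N) :
    (f * g).natDegree < 2 * N := by
  have := natDegree_mul_le (p := f) (q := g)
  omega

theorem PolyMul.naive (N : ℕ) : PolyMul μ F X N (4 * N * (N + N)) := by
  intro S f g hf hg kf kg
  refine (Attains.knP_of_lt (N := 2 * N) (c := 2 * (2 * N)) (fun x =>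
    natDegree_mul_lt (hf x) (hg x)) fun i hi T hT => ?_).mono_cost
    (by push_cast; linarith)
  simp only [coeff_mul]
  refine (Attains.sum_mul (Finset.HasAntidiagonal.antidiagonal i) (fun s _ => hT _ (kf s.1))
    fun s _ => hT _ (kg s.2)).mono_cost ?_
  rw [Finset.Nat.card_antidiagonal]
  have : (i : ℝ) + 1 ≤ 2 * N := by exact_mod_cast hi
  push_cast
  linarith

theorem PolyMul.mono {N M : ℕ} {c : ℝ} (h : PolyMul μ F X M c) (hNM : N ≤ M) :
    PolyMul μ F X N c :=
  fun S f g hf hg => h S f g (fun x => (hf x).trans_le hNM) fun x => (hg x).trans_le hNM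

/-- The polynomial of degree less than `q` representing an element of `F[y] / (y ^ q - 1)`. -/
noncomputable def ofCyc (q : ℕ) (f : AddMonoidAlgebra F (ZMod q)) : F[X] :=
  ∑ a ∈ Finset.range q, monomial a (f.coeff a)

theorem coeff_ofCyc (f : AddMonoidAlgebra F (ZMod q)) (i : ℕ) :
    (ofCyc q f).coeff i = if i < q then f.coeff i else 0 := by
  simp [ofCyc, coeff_monomial]

theorem natDegree_ofCyc_lt [NeZero q] (f : AddMonoidAlgebra F (ZMod q)) :
    (ofCyc q f).natDegree < q := by
  refine lt_of_le_of_lt (natDegree_le_iff_coeff_eq_zero.2 fun i hi => ?_)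
    (Nat.sub_lt (NeZero.pos q) one_pos)
  rw [coeff_ofCyc, if_neg (by omega)]

theorem toCyc_ofCyc [NeZero q] (f : AddMonoidAlgebra F (ZMod q)) : toCyc F q (ofCyc q f) = f := by
  ext a
  rw [toCyc_coeff_of_lt (natDegree_ofCyc_lt f), coeff_ofCyc, if_pos (ZMod.val_lt a),
    ZMod.natCast_zmod_val]

/-- Representatives of degree less than `q` are multiplied as polynomials. Reduction modulo `y ^ q -
1` folds the product once, at one addition per coefficient. -/
theorem Attains.mulB [NeZero q] {c : ℝ} (hq : PolyMul μ F X q c)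
    {f g : X → AddMonoidAlgebra F (ZMod q)} (hf : KnB S f) (hg : KnB S g) :
    Attains μ S (fun T => KnB T fun x => f x * g x) (c + q) := by
  have hk : ∀ {f : X → AddMonoidAlgebra F (ZMod q)}, KnB S f → KnP S fun x => ofCyc q (f x) := by
    intro f hf i
    simp only [coeff_ofCyc]
    split_ifs
    · exact hf _
    · exact S.const_mem 0
  refine Attains.bind (hq S _ _ (fun x => natDegree_ofCyc_lt (f x))
    (fun x => natDegree_ofCyc_lt (g x)) (hk hf) (hk hg)) fun T hT k => ?_
  refine (Attains.family (c := 1) fun a T' hT' => ?_).mono_cost (by rw [ZMod.card]; linarith)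
  have : ∀ x, (f x * g x).coeff a = (ofCyc q (f x) * ofCyc q (g x)).coeff a.val +
      (ofCyc q (f x) * ofCyc q (g x)).coeff (a.val + q) := by
    intro x
    rw [← toCyc_coeff_of_lt_two_mul (natDegree_mul_lt (natDegree_ofCyc_lt _)
      (natDegree_ofCyc_lt _)), map_mul, toCyc_ofCyc, toCyc_ofCyc]
  simp only [this]
  exact Attains.add (hT' _ (k _)) (hT' _ (k _))

end PolyMulCost

/-! ### One step of Schönhage's recursion for polynomial multiplication. -/

section PolyMulStep

variable {F : Type u} [Field F]

/-- The `i`-th block of `m` coefficients of a polynomial. -/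
noncomputable def polyBlock (m i : ℕ) (f : F[X]) : F[X] :=
  ∑ a ∈ Finset.range m, monomial a (f.coeff (m * i + a))

theorem coeff_polyBlock (m i : ℕ) (f : F[X]) (a : ℕ) :
    (polyBlock m i f).coeff a = if a < m then f.coeff (m * i + a) else 0 := by
  simp [polyBlock, coeff_monomial]

theorem natDegree_polyBlock_lt {m : ℕ} (hm : 1 ≤ m) (i : ℕ) (f : F[X]) :
    (polyBlock m i f).natDegree < m := by
  refine lt_of_le_of_lt (natDegree_le_iff_coeff_eq_zero.2 fun a ha => ?_) (Nat.sub_lt hm one_pos)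
  rw [coeff_polyBlock, if_neg (by omega)]

theorem polyBlock_eq_zero {m s i : ℕ} {f : F[X]} (hf : f.natDegree < m * s) (hi : s ≤ i) :
    polyBlock m i f = 0 := by
  ext a
  rw [coeff_polyBlock, coeff_zero]
  split_ifs
  · refine coeff_eq_zero_of_natDegree_lt ?_
    have := Nat.mul_le_mul_left m hi
    omega
  · rfl

theorem sum_polyBlock {m s q : ℕ} {f : F[X]} (hf : f.natDegree < m * s) (hq : s ≤ q) :
    ∑ i ∈ Finset.range q, X ^ (m * i) * polyBlock m i f = f := by
  have hm : 0 < m := Nat.pos_of_ne_zero (by rintro rfl; simp at hf)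
  ext t
  simp only [finsetSum_coeff, coeff_X_pow_mul', coeff_polyBlock]
  rw [Finset.sum_eq_single (t / m)]
  · have h1 := Nat.div_add_mod t m
    have h2 := Nat.mod_lt t hm
    rw [if_pos (by omega), if_pos (by omega)]
    congr 1
    omega
  · intro b _ hb
    split_ifs with h1 h2
    · exfalso
      apply hb
      rw [show t = m * b + (t - m * b) by omega, Nat.mul_add_div hm, Nat.div_eq_of_lt h2, add_zero]
    · rfl
    · rfl
  · intro h
    rw [Finset.mem_range, not_lt] at h
    split_ifs
    · refine coeff_eq_zero_of_natDegree_lt ?_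
      have := Nat.mul_le_mul_left m (hq.trans h)
      omega
    · rfl
    · rfl

/-- The block convolution of two polynomials. -/
noncomputable def blockConv (m q l : ℕ) (f g : F[X]) : F[X] :=
  ∑ i ∈ Finset.range q, ∑ i' ∈ Finset.range q,
    if i + i' = l then polyBlock m i f * polyBlock m i' g else 0

theorem natDegree_blockConv_lt {m : ℕ} (hm : 1 ≤ m) (q l : ℕ) (f g : F[X]) :
    (blockConv m q l f g).natDegree < 2 * m := by
  have : (blockConv m q l f g).natDegree ≤ 2 * m - 1 := by
    refine natDegree_sum_le_of_forall_le _ _ fun i _ => natDegree_sum_le_of_forall_le _ _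
      fun i' _ => ?_
    split_ifs
    · have := natDegree_mul_lt (natDegree_polyBlock_lt hm i f) (natDegree_polyBlock_lt hm i' g)
      omega
    · simp
  omega

theorem sum_blockConv {m s q : ℕ} {f g : F[X]} (hf : f.natDegree < m * s)
    (hg : g.natDegree < m * s) (hq : 2 * s ≤ q) :
    ∑ l ∈ Finset.range q, X ^ (m * l) * blockConv m q l f g = f * g := by
  conv_rhs => rw [← sum_polyBlock hf (by omega : s ≤ q), ← sum_polyBlock hg (by omega : s ≤ q)]
  rw [Finset.sum_mul_sum]
  simp only [blockConv, Finset.mul_sum]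
  rw [Finset.sum_comm]
  refine Finset.sum_congr rfl fun i _ => ?_
  rw [Finset.sum_comm]
  refine Finset.sum_congr rfl fun i' _ => ?_
  by_cases h : i < s ∧ i' < s
  · rw [Finset.sum_eq_single_of_mem (i + i') (Finset.mem_range.2 (by omega))]
    · rw [if_pos rfl]
      ring
    · intro b _ hb
      rw [if_neg hb.symm, mul_zero]
  · have h0 : polyBlock m i f * polyBlock m i' g = 0 := by
      rcases not_and_or.1 h with h | h
      · rw [polyBlock_eq_zero hf (by omega), zero_mul]
      · rw [polyBlock_eq_zero hg (by omega), mul_zero]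
    rw [mul_mul_mul_comm, h0, mul_zero]
    simp

variable {X : Type v} {μ : ℕ → ℝ}

/-- Cut the factors into `s = p ^ (j + 1)` blocks of length `m = p ^ j`, and view each block as an
element of `F[y] / (y ^ q - 1)` with `q = p ^ (j + 2)`. Three transforms of length `q` and `q`
products in this ring give the block convolutions, up to the factors `q` and `1 - y ^ s`. The first
is invertible because `p ≠ 0` in `F`. The second is harmless because a block convolution has degree
less than `2 m ≤ s`. Since `2 s ≤ q`, block indices do not wrap around. -/
theorem PolyMul.step {p : ℕ} (hp : p.Prime) (hpF : (p : F) ≠ 0) (j : ℕ) {c : ℝ}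
    (hc : PolyMul μ F X (p ^ (j + 2)) c) :
    PolyMul μ F X (p ^ (2 * j + 1)) (p ^ (j + 2) * c + 7 * (j + 2) * p ^ (2 * j + 5)) := by
  intro S f g hf hg kf kg
  set q := p ^ (j + 2) with hq
  have hq0 : NeZero q := ⟨pow_ne_zero _ hp.ne_zero⟩
  have hp2 := hp.two_le
  set m := p ^ j with hm
  set s := p ^ (j + 1) with hs
  have hm1 : 1 ≤ m := Nat.one_le_pow _ _ hp.pos
  have hms : m * s = p ^ (2 * j + 1) := by rw [hm, hs, ← pow_add]; congr 1; omega
  have hsm : 2 * m ≤ s := by rw [hs, pow_succ, mul_comm]; exact Nat.mul_le_mul_left _ hp2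
  have hqs : 2 * s ≤ q := by
    rw [hq, pow_succ, mul_comm]
    exact Nat.mul_le_mul_left _ hp2
  rw [← hms] at hf hg
  have hblk : ∀ {f : X → F[X]}, KnP S f → ∀ i, KnB S fun x => toCyc F q (polyBlock m i (f x)) := by
    intro f kf i a
    have h1 : ∀ x, (toCyc F q (polyBlock m i (f x))).coeff a =
        if a.val < m then (f x).coeff (m * i + a.val) else 0 := by
      intro x
      rw [toCyc_coeff_of_lt ((natDegree_polyBlock_lt hm1 i _).trans_le (by omega)),
        coeff_polyBlock]
    simp only [h1]
    split_ifs
    · exact kf _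
    · exact S.const_mem 0
  have hzero : ((p ^ (j + 2) : ℕ) : ZMod q) = 0 := by rw [← hq, ZMod.natCast_self]
  refine Attains.bind (Attains.dft hp.one_le (j + 2) (1 : ZMod q) (by rw [hzero, zero_mul]) S _
    (hblk kf)) fun T₁ h₁ k₁ => ?_
  refine Attains.bind (Attains.dft hp.one_le (j + 2) (1 : ZMod q) (by rw [hzero, zero_mul]) T₁ _
    (fun i => (hblk kg i).mono h₁)) fun T₂ h₂ k₂ => ?_
  refine Attains.bind (Attains.forall_lt (N := q) (Φ := fun k T => KnB T fun x =>
      (∑ i ∈ Finset.range (p ^ (j + 2)), cyc F q ((i * k : ℕ) * 1) *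
        toCyc F q (polyBlock m i (f x))) *
      ∑ i ∈ Finset.range (p ^ (j + 2)), cyc F q ((i * k : ℕ) * 1) *
        toCyc F q (polyBlock m i (g x)))
      (fun a S₁ S₂ h h' => h'.mono h) fun k _ T hT => Attains.mulB hc
        (((k₁ k).mono h₂).mono hT) ((k₂ k).mono hT)) fun T₃ h₃ k₃ => ?_
  set H : ℕ → X → AddMonoidAlgebra F (ZMod q) := fun k x => if k < q then
      (∑ i ∈ Finset.range (p ^ (j + 2)), cyc F q ((i * k : ℕ) * 1) *
        toCyc F q (polyBlock m i (f x))) *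
      ∑ i ∈ Finset.range (p ^ (j + 2)), cyc F q ((i * k : ℕ) * 1) *
        toCyc F q (polyBlock m i (g x)) else 0 with hH
  have kH : ∀ k, KnB T₃ (H k) := by
    intro k
    by_cases hk : k < q
    · simpa only [hH, if_pos hk] using k₃ k hk
    · intro a
      simpa only [hH, if_neg hk, AddMonoidAlgebra.coeff_zero, Finsupp.coe_zero, Pi.zero_apply] using
        T₃.const_mem 0
  refine Attains.bind (Attains.dft hp.one_le (j + 2) (-1 : ZMod q) (by rw [hzero, zero_mul]) T₃ _
    kH) fun T₄ h₄ k₄ => ?_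
  set G : ℕ → X → AddMonoidAlgebra F (ZMod q) := fun l x =>
    ∑ k ∈ Finset.range (p ^ (j + 2)), cyc F q ((k * l : ℕ) * (-1)) * H k x with hG
  have hqF : (q : F) ≠ 0 := by rw [hq]; push_cast; exact pow_ne_zero _ hpF
  have key : ∀ l < q, ∀ x a, a < s → (blockConv m q l (f x) (g x)).coeff a =
      ((G l x).coeff a - (G l x).coeff (a - s : ZMod q)) * (q : F)⁻¹ := by
    intro l hl x a ha
    have h1 := one_sub_mul_inverse_dft (j := j + 1) hp
      (fun i => toCyc F q (polyBlock m i (f x))) (fun i => toCyc F q (polyBlock m i (g x))) s hqs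
      (fun i hi => by rw [polyBlock_eq_zero (hf x) hi, map_zero])
      (fun i hi => by rw [polyBlock_eq_zero (hg x) hi, map_zero]) l hl
    have h2 : (∑ k ∈ Finset.range q, cyc F q ((k * l : ℕ) * (-1)) *
      ((∑ i ∈ Finset.range q, cyc F q ((i * k : ℕ) * 1) * toCyc F q (polyBlock m i (f x))) *
        ∑ i ∈ Finset.range q, cyc F q ((i * k : ℕ) * 1) * toCyc F q (polyBlock m i (g x)))) =
        G l x := by
      refine Finset.sum_congr rfl fun k hk => ?_
      simp only [hH]
      rw [if_pos (show k < q from Finset.mem_range.1 hk)]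
    have h3 : (∑ i ∈ Finset.range q, ∑ i' ∈ Finset.range q, if i + i' = l then
        toCyc F q (polyBlock m i (f x)) * toCyc F q (polyBlock m i' (g x)) else 0) =
        toCyc F q (blockConv m q l (f x) (g x)) := by
      simp only [blockConv, map_sum, apply_ite (toCyc F q), map_mul, map_zero]
    have h4 : (1 - cyc F q s) * G l x =
        (1 - cyc F q s) * ((q : ℕ) * toCyc F q (blockConv m q l (f x) (g x))) := by
      rw [← h2, ← h3]
      exact h1
    have h5 := congrArg (fun z => z.coeff (a : ZMod q)) h4
    have hdeg := natDegree_blockConv_lt hm1 q l (f x) (g x)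
    simp only [sub_mul, one_mul, AddMonoidAlgebra.coeff_sub, Finsupp.sub_apply, coeff_cyc_mul,
      ← nsmul_eq_mul, AddMonoidAlgebra.coeff_smul, Finsupp.smul_apply] at h5
    rw [toCyc_coeff_of_lt (by omega), toCyc_coeff_of_lt (by omega),
      ZMod.val_cast_of_lt (by omega)] at h5
    -- The index `a - s` wraps around to `a + (q - s)`. This exceeds the degree of the block
    -- convolution, since `2 m ≤ s ≤ q - s`, so the factor `1 - y ^ s` leaves coefficient `a < s`
    -- unchanged.
    have h6 : ((a : ZMod q) - s).val = a + (q - s) := by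
      have : (a : ZMod q) - s = ((a + (q - s) : ℕ) : ZMod q) := by
        rw [Nat.cast_add, Nat.cast_sub (by omega), ZMod.natCast_self]
        ring
      rw [this, ZMod.val_cast_of_lt (by omega)]
    rw [h6, coeff_eq_zero_of_natDegree_lt (by omega : _ < a + (q - s)), smul_zero, sub_zero,
      nsmul_eq_mul] at h5
    rw [h5]
    field_simp
  refine Attains.bind (Attains.forall_lt (N := q) (Φ := fun l T => KnP T fun x =>
    blockConv m q l (f x) (g x)) (c := s * 2) (fun a S₁ S₂ h h' => h'.mono h) fun l hl T hT =>
    Attains.knP_of_lt (fun x => (natDegree_blockConv_lt hm1 q l (f x) (g x)).trans_le hsm)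
      fun a ha T' hT' => ?_) fun T₅ h₅ k₅ => ?_
  · simp only [key l hl _ a ha]
    refine Attains.bind (Attains.sub (hT' _ (hT _ (k₄ l (a : ZMod q))))
      (hT' _ (hT _ (k₄ l ((a : ZMod q) - s)))))
      fun T₆ h₆ k₆ => ?_
    exact (Attains.mul k₆ (T₆.const_mem _)).mono_cost (by norm_num)
  refine (Attains.knP_of_lt (N := 2 * (m * s)) (c := 2) (fun x =>
    natDegree_mul_lt (hf x) (hg x)) fun t ht T hT => ?_).mono_cost ?_
  · have h1 : ∀ x, (f x * g x).coeff t = ∑ l ∈ (Finset.range q).filter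
        (fun l => m * l ≤ t ∧ t < m * l + 2 * m),
        (blockConv m q l (f x) (g x)).coeff (t - m * l) := by
      intro x
      rw [← sum_blockConv (hf x) (hg x) hqs, finsetSum_coeff, Finset.sum_filter]
      refine Finset.sum_congr rfl fun l _ => ?_
      rw [coeff_X_pow_mul']
      split_ifs with h1 h2 h2
      · rfl
      · refine coeff_eq_zero_of_natDegree_lt ?_
        have := natDegree_blockConv_lt hm1 q l (f x) (g x)
        omega
      · omega
      · rfl
    simp only [h1]
    refine (Attains.sum _ fun l hl => hT _ (k₅ l
      (Finset.mem_range.1 (Finset.mem_filter.1 hl).1) _)).mono_cost ?_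
    -- Block convolutions have degree less than `2 m` and are placed at multiples of `m`, so at most
    -- two overlap at any coefficient.
    have : ((Finset.range q).filter (fun l => m * l ≤ t ∧ t < m * l + 2 * m)).card ≤ 2 := by
      refine (Finset.card_le_card (t := {t / m, t / m - 1}) fun l hl => ?_).trans
        Finset.card_le_two
      obtain ⟨-, h1, h2⟩ := Finset.mem_filter.1 hl
      have h3 : l ≤ t / m := (Nat.le_div_iff_mul_le hm1).2 (by linarith [mul_comm l m])
      have h4 : t / m < l + 2 := (Nat.div_lt_iff_lt_mul hm1).2 (by nlinarith)
      simp only [Finset.mem_insert, Finset.mem_singleton]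
      omega
    exact_mod_cast this
  · have e1 : (q : ℝ) = p ^ (j + 2) := by rw [hq]; push_cast; rfl
    have e2 : (s : ℝ) = p ^ (j + 1) := by rw [hs]; push_cast; rfl
    have e3 : (m : ℝ) = p ^ j := by rw [hm]; push_cast; rfl
    push_cast
    rw [e1, e2, e3]
    have hp1 : (2 : ℝ) ≤ p := by exact_mod_cast hp2
    have hx : (0 : ℝ) ≤ (p : ℝ) ^ (2 * j) := by positivity
    have hb : (1 : ℝ) ≤ (p : ℝ) ^ (2 * j) := one_le_pow₀ (by linarith)
    have hj0 : (0 : ℝ) ≤ j := Nat.cast_nonneg _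
    have f1 : (p : ℝ) ^ (2 * j + 5) = (p : ℝ) ^ (2 * j) * p ^ 5 := pow_add _ _ _
    have f2 : (p : ℝ) ^ (j + 2 + 1) * p ^ (j + 2) = (p : ℝ) ^ (2 * j) * p ^ 5 := by ring
    have f3 : (p : ℝ) ^ (j + 2) * (c + p ^ (j + 2)) =
        (p : ℝ) ^ (j + 2) * c + (p : ℝ) ^ (2 * j) * p ^ 4 := by ring
    have f4 : (p : ℝ) ^ (j + 2) * (p ^ (j + 1) * 2) = (p : ℝ) ^ (2 * j) * (p ^ 3 * 2) := by ring
    have f5 : 2 * ((p : ℝ) ^ j * p ^ (j + 1)) * 2 = (p : ℝ) ^ (2 * j) * (4 * p) := by ring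
    have f6 : (p : ℝ) ^ 4 + p ^ 3 * 2 + 4 * p ≤ 2 * p ^ 5 := by
      have g1 : 2 * (p : ℝ) ≤ p ^ 2 := by nlinarith
      have g2 : 2 * (p : ℝ) ^ 2 ≤ p ^ 3 := by nlinarith [sq_nonneg (p : ℝ)]
      have g3 : 2 * (p : ℝ) ^ 3 ≤ p ^ 4 := by nlinarith [pow_nonneg (by linarith : (0 : ℝ) ≤ p) 3]
      have g4 : 2 * (p : ℝ) ^ 4 ≤ p ^ 5 := by nlinarith [pow_nonneg (by linarith : (0 : ℝ) ≤ p) 4]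
      nlinarith
    have f7 := mul_le_mul_of_nonneg_left f6 hx
    have f8 : 0 ≤ (p : ℝ) ^ (2 * j) * p ^ 5 := by positivity
    have f9 : 0 ≤ (j : ℝ) * ((p : ℝ) ^ (2 * j) * p ^ 5) := by positivity
    rw [mul_assoc ((j : ℝ) + 2), f2, f1, f3, f4, f5]
    nlinarith

end PolyMulStep

/-! ### Quasilinear multiplication over every field. -/

section FastPolyMul

variable {F : Type u} [Field F] {X : Type v} {μ : ℕ → ℝ} {S : Know F X}

theorem PolyMul.mono_cost {N : ℕ} {a b : ℝ} (h : PolyMul μ F X N a) (hab : a ≤ b) :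
    PolyMul μ F X N b :=
  fun S f g hf hg kf kg => (h S f g hf hg kf kg).mono_cost hab

/-- The step roughly halves the exponent, while the cost per coefficient grows by a factor of at
most `p ^ 4 ≤ 81`. A sufficiently high power of `k + 1` absorbs this: the exponent `40` works
because `(6 / 7) ^ 40 ≤ 1 / 400`. Below `k = 5` the naive method is used. -/
theorem PolyMul.prime_pow {p : ℕ} (hp : p.Prime) (hp3 : p ≤ 3) (hpF : (p : F) ≠ 0) (k : ℕ) :
    PolyMul μ F X (p ^ k) (3402 * p ^ k * (k + 1) ^ 40) := by
  have hp1 : (1 : ℝ) ≤ p := by exact_mod_cast hp.one_le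
  have hp3' : (p : ℝ) ≤ 3 := by exact_mod_cast hp3
  induction k using Nat.strong_induction_on with
  | _ k ih =>
    have hpk : (0 : ℝ) < p ^ k := by positivity
    rcases Nat.lt_or_ge k 5 with hk | hk
    · refine (PolyMul.naive _).mono_cost ?_
      have h1 : (p : ℝ) ^ k ≤ 81 :=
        calc (p : ℝ) ^ k ≤ p ^ 4 := pow_le_pow_right₀ hp1 (by omega)
          _ ≤ 3 ^ 4 := by gcongr
          _ = 81 := by norm_num
      have h2 : (1 : ℝ) ≤ (k + 1) ^ 40 := one_le_pow₀ (by linarith [Nat.cast_nonneg (α := ℝ) k])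
      push_cast
      calc 4 * (p : ℝ) ^ k * (p ^ k + p ^ k) ≤ 4 * (p : ℝ) ^ k * (81 + 81) := by gcongr
        _ ≤ 3402 * p ^ k * 1 := by linarith
        _ ≤ _ := by gcongr
    · obtain ⟨j, hj⟩ : ∃ j, j = k / 2 := ⟨_, rfl⟩
      refine ((PolyMul.step hp hpF j (ih (j + 2) (by omega))).mono
        (Nat.pow_le_pow_right hp.pos (by omega : k ≤ 2 * j + 1))).mono_cost ?_
      have h0 : (p : ℝ) ^ (2 * j) ≤ p ^ k := pow_le_pow_right₀ hp1 (by omega)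
      have h4 : (p : ℝ) ^ 4 ≤ 81 := by
        calc (p : ℝ) ^ 4 ≤ 3 ^ 4 := by gcongr
          _ = 81 := by norm_num
      have h5 : (p : ℝ) ^ 5 ≤ 243 := by
        calc (p : ℝ) ^ 5 ≤ 3 ^ 5 := by gcongr
          _ = 243 := by norm_num
      -- This needs `k ≥ 5`, and is an equality at `k = 6`.
      have hr : ((j + 2 : ℕ) : ℝ) + 1 ≤ 6 / 7 * (k + 1) := by
        have : 7 * (j + 2 + 1) ≤ 6 * (k + 1) := by omega
        have : (7 : ℝ) * (j + 2 + 1) ≤ 6 * (k + 1) := by exact_mod_cast this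
        push_cast
        linarith
      have hk1 : (6 : ℝ) ≤ k + 1 := by
        have : (5 : ℝ) ≤ k := by exact_mod_cast hk
        linarith
      have e1 : (((j + 2 : ℕ) : ℝ) + 1) ^ 40 ≤ 1 / 400 * (k + 1) ^ 40 := by
        calc (((j + 2 : ℕ) : ℝ) + 1) ^ 40 ≤ (6 / 7 * ((k : ℝ) + 1)) ^ 40 := by gcongr
          _ = (6 / 7 : ℝ) ^ 40 * ((k : ℝ) + 1) ^ 40 := mul_pow _ _ _
          _ ≤ _ := by gcongr; norm_num
      have e2 : (j : ℝ) + 2 ≤ (k + 1) ^ 40 := by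
        calc (j : ℝ) + 2 ≤ k + 1 := by push_cast at hr; linarith
          _ = ((k : ℝ) + 1) ^ 1 := (pow_one _).symm
          _ ≤ _ := pow_le_pow_right₀ (by linarith) (by norm_num)
      have e3 : (k + 1 : ℝ) ≥ 0 := by linarith
      calc (p : ℝ) ^ (j + 2) * (3402 * p ^ (j + 2) * (((j + 2 : ℕ) : ℝ) + 1) ^ 40) +
            7 * (j + 2) * p ^ (2 * j + 5)
          = (p : ℝ) ^ (2 * j) * (3402 * p ^ 4 * (((j + 2 : ℕ) : ℝ) + 1) ^ 40 +
            7 * ((j : ℝ) + 2) * p ^ 5) := by ring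
        _ ≤ (p : ℝ) ^ k * (3402 * 81 * (1 / 400 * ((k : ℝ) + 1) ^ 40) + 7 * ((k : ℝ) + 1) ^ 40 * 243) := by
          gcongr
        _ ≤ (p : ℝ) ^ k * (3402 * ((k : ℝ) + 1) ^ 40) := by
          gcongr
          have : (0 : ℝ) ≤ (k + 1) ^ 40 := by positivity
          linarith
        _ = _ := by ring

/-- The cost of multiplying two polynomials of degree less than `2 ^ k`. -/
noncomputable def polyCost (k : ℕ) : ℝ := 10206 * 2 ^ k * (k + 1) ^ 40

theorem polyCost_succ (k : ℕ) : 2 * polyCost k ≤ polyCost (k + 1) := by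
  rw [polyCost, polyCost, pow_succ (2 : ℝ)]
  push_cast
  have : ((k : ℝ) + 1) ^ 40 ≤ (k + 1 + 1) ^ 40 := by gcongr; linarith
  have h2 : (0 : ℝ) ≤ 2 ^ k := by positivity
  nlinarith

theorem two_pow_le_polyCost (k : ℕ) : 10206 * 2 ^ k ≤ polyCost k := by
  rw [polyCost]
  exact le_mul_of_one_le_right (by positivity) (one_le_pow₀ (by
    linarith [Nat.cast_nonneg (α := ℝ) k]))

theorem polyCost_nonneg (k : ℕ) : 0 ≤ polyCost k := by
  rw [polyCost]; positivity

/-- The primes `2` and `3` cannot both vanish in a field. With `p = 3` the length is rounded up to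
`3 ^ l ≤ 3 * 2 ^ k`, whence the constant `10206 = 3 * 3402`. -/
theorem PolyMul.two_pow (k : ℕ) : PolyMul μ F X (2 ^ k) (polyCost k) := by
  by_cases h2 : ((2 : ℕ) : F) = 0
  · have h3 : ((3 : ℕ) : F) ≠ 0 := by
      intro h3
      have : (1 : F) = ((3 : ℕ) : F) - ((2 : ℕ) : F) := by push_cast; ring
      rw [h2, h3, sub_zero] at this
      exact one_ne_zero this
    obtain ⟨l, hl⟩ : ∃ l, l = Nat.clog 3 (2 ^ k) := ⟨_, rfl⟩
    have hlk : l ≤ k := hl ▸ Nat.clog_le_of_le_pow (Nat.pow_le_pow_left (by norm_num) k)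
    have hl1 : 2 ^ k ≤ 3 ^ l := hl ▸ Nat.le_pow_clog (by norm_num) _
    have hl2 : 3 ^ l ≤ 3 * 2 ^ k := by
      rcases l with _ | l
      · have := Nat.one_le_two_pow (n := k); omega
      · have : 3 ^ l < 2 ^ k := (Nat.lt_clog_iff_pow_lt (by norm_num)).1 (by omega)
        rw [pow_succ]; omega
    refine ((PolyMul.prime_pow Nat.prime_three le_rfl h3 l).mono hl1).mono_cost ?_
    have h1 : ((3 : ℕ) : ℝ) ^ l ≤ 3 * 2 ^ k := by exact_mod_cast hl2
    have h2 : (l : ℝ) ≤ k := by exact_mod_cast hlk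
    rw [polyCost]
    calc 3402 * ((3 : ℕ) : ℝ) ^ l * (l + 1) ^ 40 ≤ 3402 * (3 * 2 ^ k) * ((k : ℝ) + 1) ^ 40 := by
          gcongr
      _ = _ := by ring
  · refine (PolyMul.prime_pow Nat.prime_two (by norm_num) h2 k).mono_cost ?_
    rw [polyCost]
    push_cast
    gcongr
    norm_num

end FastPolyMul

/-! ### Division with remainder by constants, and multipoint evaluation. -/

section MultipointEvaluation

variable {F : Type u} [Field F] {X : Type v} {μ : ℕ → ℝ} {S : Know F X}

theorem KnP.const (S : Know F X) (p : F[X]) : KnP S fun _ => p := fun i => S.const_mem (p.coeff i)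

/-- The quotient by a monic polynomial is the high part of a product with a constant. -/
theorem coeff_divByMonic_eq_coeff_mul {f G : F[X]} {n : ℕ} (hG : G.Monic) (hn : G.natDegree = n)
    (hf : f.natDegree < 2 * n) (i : ℕ) :
    (f /ₘ G).coeff i = (f * (Polynomial.X ^ (2 * n) /ₘ G)).coeff (i + 2 * n) := by
  have hG1 : G ≠ 1 := by
    rintro rfl
    simp at hn
    omega
  have h1 := modByMonic_add_div (Polynomial.X ^ (2 * n) : F[X]) G
  have h2 := modByMonic_add_div f G
  have d1 := natDegree_modByMonic_lt (Polynomial.X ^ (2 * n) : F[X]) hG hG1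
  have d2 := natDegree_modByMonic_lt f hG hG1
  set r := (Polynomial.X ^ (2 * n) : F[X]) %ₘ G
  set Q := f /ₘ G
  set R := f %ₘ G
  set H := (Polynomial.X ^ (2 * n) : F[X]) /ₘ G
  have h3 : G * (Q * Polynomial.X ^ (2 * n) - f * H) = f * r - R * Polynomial.X ^ (2 * n) := by
    linear_combination (Polynomial.X ^ (2 * n)) * h2 - f * h1
  have h4 : (f * r - R * Polynomial.X ^ (2 * n)).natDegree < 3 * n := by
    refine (natDegree_sub_le _ _).trans_lt (max_lt ?_ ?_)
    · have := natDegree_mul_le (p := f) (q := r)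
      omega
    · have := natDegree_mul_le (p := R) (q := Polynomial.X ^ (2 * n))
      rw [natDegree_X_pow] at this
      omega
  have h5 : (Q * Polynomial.X ^ (2 * n) - f * H).coeff (i + 2 * n) = 0 := by
    by_cases h0 : Q * Polynomial.X ^ (2 * n) - f * H = 0
    · rw [h0, coeff_zero]
    · rw [← h3, hG.natDegree_mul' h0] at h4
      exact coeff_eq_zero_of_natDegree_lt (by omega)
  rw [coeff_sub, coeff_mul_X_pow, sub_eq_zero] at h5
  exact h5

theorem Attains.polySub {N : ℕ} {f g : X → F[X]} (hf : KnP S f) (hg : KnP S g)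
    (h : ∀ x, (f x - g x).natDegree < N) :
    Attains μ S (fun T => KnP T fun x => f x - g x) N := by
  refine (Attains.knP_of_lt (c := 1) h fun i _ T hT => ?_).mono_cost (by simp)
  simp only [coeff_sub]
  exact Attains.sub (hT _ (hf i)) (hT _ (hg i))

theorem Attains.polyAdd {N : ℕ} {f g : X → F[X]} (hf : KnP S f) (hg : KnP S g)
    (h : ∀ x, (f x + g x).natDegree < N) :
    Attains μ S (fun T => KnP T fun x => f x + g x) N := by
  refine (Attains.knP_of_lt (c := 1) h fun i _ T hT => ?_).mono_cost (by simp)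
  simp only [coeff_add]
  exact Attains.add (hT _ (hf i)) (hT _ (hg i))

/-- Reduction modulo a constant monic polynomial. -/
theorem Attains.modByMonic {i : ℕ} {f : X → F[X]} {G : F[X]} (hG : G.Monic)
    (hn : G.natDegree = 2 ^ i) (hf : ∀ x, (f x).natDegree < 2 ^ (i + 1)) (kf : KnP S f) :
    Attains μ S (fun T => KnP T fun x => f x %ₘ G) (2 * polyCost (i + 1) + 2 ^ i) := by
  have hpos : 0 < 2 ^ i := by positivity
  have hG1 : G ≠ 1 := by
    rintro rfl
    rw [natDegree_one] at hn
    omega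
  rw [pow_succ'] at hf
  have hH : (Polynomial.X ^ (2 * 2 ^ i) /ₘ G).natDegree < 2 ^ (i + 1) := by
    rw [natDegree_divByMonic _ hG, natDegree_X_pow, hn, pow_succ']
    omega
  -- The quotient of `X ^ (2 n)` by the constant polynomial `G` is itself constant, hence free. Only
  -- two products are paid for.
  refine Attains.bind (PolyMul.two_pow (i + 1) S f (fun _ => Polynomial.X ^ (2 * 2 ^ i) /ₘ G)
    (by simpa only [pow_succ'] using hf) (fun _ => hH) kf (KnP.const S _)) fun T₁ h₁ k₁ => ?_
  have kQ : KnP T₁ fun x => f x /ₘ G := by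
    intro a
    simp only [fun x => coeff_divByMonic_eq_coeff_mul hG hn (hf x) a]
    exact k₁ _
  refine Attains.bind (PolyMul.two_pow (i + 1) T₁ (fun _ => G) (fun x => f x /ₘ G)
    (fun _ => by rw [hn, pow_succ']; omega)
    (fun x => by rw [natDegree_divByMonic _ hG, pow_succ']; have := hf x; omega)
    (KnP.const T₁ _) kQ) fun T₂ h₂ k₂ => ?_
  simp only [modByMonic_eq_sub_mul_div]
  refine (Attains.polySub (N := 2 ^ i) ((kf.mono h₁).mono h₂) k₂ fun x => ?_).mono_cost ?_
  · rw [← modByMonic_eq_sub_mul_div, ← hn]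
    exact natDegree_modByMonic_lt _ hG hG1
  · push_cast
    linarith

/-- Evaluation of a polynomial of degree less than `2 ^ k` at `2 ^ k` constants. -/
theorem Attains.multipointEval (pt : ℕ → F) (k : ℕ) : ∀ (a : ℕ) (S : Know F X) (f : X → F[X]),
    (∀ x, (f x).natDegree < 2 ^ k) → KnP S f →
    Attains μ S (fun T => ∀ l ∈ Finset.Ico a (a + 2 ^ k), (fun x => (f x).eval (pt l)) ∈ T)
      (5 * k * polyCost k) := by
  induction k with
  | zero =>
    intro a S f hf kf
    refine Attains.pure (fun l _ => ?_) (by simp)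
    have : ∀ x, (f x).eval (pt l) = (f x).coeff 0 := by
      intro x
      rw [eq_C_of_natDegree_eq_zero (by simpa using hf x : (f x).natDegree = 0), eval_C, coeff_C_zero]
    simp only [this]
    exact kf 0
  | succ k ih =>
    intro a S f hf kf
    have half : ∀ (b : ℕ) (S' : Know F X), S ≤ S' → Attains μ S' (fun T =>
        ∀ l ∈ Finset.Ico b (b + 2 ^ k), (fun x => (f x).eval (pt l)) ∈ T)
        (2 * polyCost (k + 1) + 2 ^ k + 5 * k * polyCost k) := by
      intro b S' hS'
      have hm : (Lagrange.nodal (Finset.Ico b (b + 2 ^ k)) pt).Monic := Lagrange.nodal_monic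
      have hd : (Lagrange.nodal (Finset.Ico b (b + 2 ^ k)) pt).natDegree = 2 ^ k := by
        rw [Lagrange.natDegree_nodal, Nat.card_Ico, Nat.add_sub_cancel_left]
      refine Attains.bind (Attains.modByMonic hm hd hf (kf.mono hS')) fun T₁ h₁ k₁ => ?_
      refine (Attains.imp (ih b T₁ _ (fun x => ?_) k₁) fun T₂ h₂ k₂ l hl => ?_).mono_cost
        (by linarith)
      · refine (natDegree_modByMonic_lt _ hm fun h => ?_).trans_eq hd
        rw [h, natDegree_one] at hd
        exact absurd hd (by positivity)
      -- Descending the remainder tree preserves values: the nodal polynomial of the block vanishes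
      -- at its points.
      · have : ∀ x, (f x).eval (pt l) =
            (f x %ₘ Lagrange.nodal (Finset.Ico b (b + 2 ^ k)) pt).eval (pt l) := by
          intro x
          conv_lhs => rw [← modByMonic_add_div (f x) (Lagrange.nodal (Finset.Ico b (b + 2 ^ k)) pt)]
          rw [eval_add, eval_mul, Lagrange.eval_nodal_at_node hl, zero_mul, add_zero]
        simp only [this]
        exact k₂ l hl
    refine Attains.bind (half a S le_rfl) fun T₁ h₁ k₁ => ?_
    refine (Attains.imp (half (a + 2 ^ k) T₁ h₁) fun T₂ h₂ k₂ l hl => ?_).mono_cost ?_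
    · rw [Finset.mem_Ico, pow_succ] at hl
      by_cases h : l < a + 2 ^ k
      · exact h₂ _ (k₁ l (Finset.mem_Ico.2 ⟨hl.1, h⟩))
      · exact k₂ l (Finset.mem_Ico.2 ⟨by omega, by omega⟩)
    · have h1 := polyCost_succ k
      have h2 := two_pow_le_polyCost (k + 1)
      have h3 : (0 : ℝ) ≤ 2 ^ k := by positivity
      have h4 : (k : ℝ) * (2 * polyCost k) ≤ k * polyCost (k + 1) := by gcongr
      rw [pow_succ] at h2
      push_cast
      nlinarith

end MultipointEvaluation

/-! ### Fast Lagrange interpolation. -/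

section Interpolation

variable {F : Type u} [Field F] {X : Type v} {μ : ℕ → ℝ} {S : Know F X}

/-- `∑ l, u l * ∏ j ≠ l, (X - pt j)` over the block of length `2 ^ k` starting at `a`. -/
noncomputable def interpolationTree (pt u : ℕ → F) : ℕ → ℕ → F[X]
  | 0, a => C (u a)
  | k + 1, a => interpolationTree pt u k a * Lagrange.nodal (Finset.Ico (a + 2 ^ k) (a + 2 ^ (k + 1))) pt +
      Lagrange.nodal (Finset.Ico a (a + 2 ^ k)) pt * interpolationTree pt u k (a + 2 ^ k)

theorem natDegree_interpolationTree_lt (pt u : ℕ → F) (k : ℕ) :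
    ∀ a, (interpolationTree pt u k a).natDegree < 2 ^ k := by
  induction k with
  | zero => intro a; simp [interpolationTree]
  | succ k ih =>
    intro a
    rw [interpolationTree]
    have h1 := ih a
    have h2 := ih (a + 2 ^ k)
    refine (natDegree_add_le _ _).trans_lt (max_lt ?_ ?_)
    · refine natDegree_mul_le.trans_lt ?_
      rw [Lagrange.natDegree_nodal, Nat.card_Ico, pow_succ]
      omega
    · refine natDegree_mul_le.trans_lt ?_
      rw [Lagrange.natDegree_nodal, Nat.card_Ico, pow_succ]
      omega

/-- At each node one of the two summands contains a vanishing nodal factor, and the other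
contributes the missing differences. Scaling `u l` by the constant nodal weight therefore turns the
tree into the Lagrange interpolant. -/
theorem eval_interpolationTree (pt u : ℕ → F) (k : ℕ) : ∀ a, ∀ l ∈ Finset.Ico a (a + 2 ^ k),
    (interpolationTree pt u k a).eval (pt l) =
      u l * ∏ j ∈ (Finset.Ico a (a + 2 ^ k)).erase l, (pt l - pt j) := by
  induction k with
  | zero =>
    intro a l hl
    have : l = a := by simp at hl; omega
    subst this
    simp [interpolationTree]
  | succ k ih =>
    intro a l hl
    have hu : Finset.Ico a (a + 2 ^ (k + 1)) = Finset.Ico a (a + 2 ^ k) ∪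
        Finset.Ico (a + 2 ^ k) (a + 2 ^ (k + 1)) :=
      (Finset.Ico_union_Ico_eq_Ico (Nat.le_add_right _ _) (by rw [pow_succ]; omega)).symm
    have hd : Disjoint (Finset.Ico a (a + 2 ^ k)) (Finset.Ico (a + 2 ^ k) (a + 2 ^ (k + 1))) :=
      Finset.Ico_disjoint_Ico_consecutive _ _ _
    have hk : a + 2 ^ (k + 1) = a + 2 ^ k + 2 ^ k := by rw [pow_succ]; omega
    rw [interpolationTree, eval_add, eval_mul, eval_mul]
    rw [hu, Finset.mem_union] at hl
    rcases hl with hl | hl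
    · rw [Lagrange.eval_nodal_at_node hl, zero_mul, add_zero, ih a l hl, hu, Finset.erase_union_distrib,
        Finset.erase_eq_of_notMem (Finset.disjoint_left.1 hd hl),
        Finset.prod_union (hd.mono_left (Finset.erase_subset _ _)), Lagrange.eval_nodal, mul_assoc]
    · rw [Lagrange.eval_nodal_at_node hl, mul_zero, zero_add, ih (a + 2 ^ k) l (hk ▸ hl), hu,
        Finset.erase_union_distrib, Finset.erase_eq_of_notMem (Finset.disjoint_right.1 hd hl),
        Finset.prod_union (hd.mono_right (Finset.erase_subset _ _)), Lagrange.eval_nodal, hk]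
      ring

theorem Attains.interpolationTree (pt : ℕ → F) {u : ℕ → X → F} (k : ℕ) :
    ∀ (a : ℕ) (S : Know F X), (∀ l ∈ Finset.Ico a (a + 2 ^ k), u l ∈ S) →
    Attains μ S (fun T => KnP T fun x => _root_.interpolationTree pt (fun l => u l x) k a)
      (3 * k * polyCost k) := by
  induction k with
  | zero =>
    intro a S hu
    refine Attains.pure (fun i => ?_) (by simp)
    simp only [_root_.interpolationTree, coeff_C]
    split_ifs
    · exact hu a (by simp)
    · exact S.const_mem 0
  | succ k ih =>
    intro a S hu
    have h0 : 0 < 2 ^ k := by positivity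
    have hdn : ∀ b b', (Lagrange.nodal (Finset.Ico b b') pt).natDegree = b' - b := fun b b' => by
      rw [Lagrange.natDegree_nodal, Nat.card_Ico]
    refine Attains.bind (ih a S fun l hl => hu l ?_) fun T₁ h₁ k₁ => ?_
    · rw [Finset.mem_Ico, pow_succ] at *
      omega
    refine Attains.bind (ih (a + 2 ^ k) T₁ fun l hl => h₁ _ (hu l ?_)) fun T₂ h₂ k₂ => ?_
    · rw [Finset.mem_Ico, pow_succ] at *
      omega
    refine Attains.bind (PolyMul.two_pow (k + 1) T₂ _ (fun _ =>
      Lagrange.nodal (Finset.Ico (a + 2 ^ k) (a + 2 ^ (k + 1))) pt)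
      (fun x => (natDegree_interpolationTree_lt pt (fun l => u l x) k a).trans
        (by rw [pow_succ]; omega))
      (fun _ => by rw [hdn, pow_succ]; omega) (k₁.mono h₂) (KnP.const _ _)) fun T₃ h₃ k₃ => ?_
    refine Attains.bind (PolyMul.two_pow (k + 1) T₃ (fun _ =>
      Lagrange.nodal (Finset.Ico a (a + 2 ^ k)) pt) _
      (fun _ => by rw [hdn, pow_succ]; omega)
      (fun x => (natDegree_interpolationTree_lt pt (fun l => u l x) k (a + 2 ^ k)).trans
        (by rw [pow_succ]; omega)) (KnP.const _ _) (k₂.mono h₃)) fun T₄ h₄ k₄ => ?_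
    refine (Attains.polyAdd (N := 2 ^ (k + 1)) (k₃.mono h₄) k₄ fun x =>
      natDegree_interpolationTree_lt pt (fun l => u l x) (k + 1) a).mono_cost ?_
    have h1 := polyCost_succ k
    have h2 := two_pow_le_polyCost (k + 1)
    have h3 : (0 : ℝ) ≤ 2 ^ (k + 1) := by positivity
    have h4 : (k : ℝ) * (2 * polyCost k) ≤ k * polyCost (k + 1) := by gcongr
    push_cast
    nlinarith

/-- Interpolation of a polynomial of degree less than `2 ^ k` from its values at `2 ^ k`
distinct constants. -/
theorem Attains.interpolate {pt : ℕ → F} {k : ℕ} (hpt : Set.InjOn pt (Finset.range (2 ^ k)))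
    {f : X → F[X]} (hf : ∀ x, (f x).natDegree < 2 ^ k)
    (kf : ∀ l < 2 ^ k, (fun x => (f x).eval (pt l)) ∈ S) :
    Attains μ S (fun T => KnP T f) ((3 * k + 1) * polyCost k) := by
  set wt := Lagrange.nodalWeight (Finset.range (2 ^ k)) pt
  refine Attains.bind (Attains.family_lt (v := fun l x => (f x).eval (pt l) * wt l) (c := 1)
    fun l hl T hT => Attains.mul (hT _ (kf l hl)) (T.const_mem (wt l))) fun T₁ h₁ k₁ => ?_
  refine (Attains.imp (Attains.interpolationTree pt k 0 T₁ fun l hl => k₁ l (by simpa using hl))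
    fun T₂ h₂ k₂ => ?_).mono_cost ?_
  · convert k₂ with x
    refine Polynomial.eq_of_degrees_lt_of_eval_index_eq (Finset.range (2 ^ k)) hpt ?_ ?_ ?_
    · rw [Finset.card_range]
      exact degree_le_natDegree.trans_lt (Nat.cast_lt.2 (hf x))
    · rw [Finset.card_range]
      exact degree_le_natDegree.trans_lt
        (Nat.cast_lt.2 (natDegree_interpolationTree_lt _ _ _ _))
    · intro l hl
      rw [eval_interpolationTree _ _ _ _ _ (by simpa using hl), zero_add,
        ← Finset.range_eq_Ico, mul_assoc]
      simp only [wt, Lagrange.nodalWeight]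
      rw [← Finset.prod_mul_distrib, Finset.prod_eq_one, mul_one]
      intro j hj
      refine inv_mul_cancel₀ (sub_ne_zero.2 fun h => ?_)
      have := hpt hl (Finset.mem_of_mem_erase hj) h
      exact Finset.ne_of_mem_erase hj this.symm
  · have h2 := two_pow_le_polyCost k
    have h3 : (0 : ℝ) ≤ 2 ^ k := by positivity
    push_cast
    linarith

end Interpolation

/-! ### Exact division by power series inversion. -/

section ExactDivision

variable {F : Type u} [Field F] {X : Type v} {μ : ℕ → ℝ} {S : Know F X}

theorem coeff_divX_iterate (f : F[X]) (m i : ℕ) : (divX^[m] f).coeff i = f.coeff (i + m) := by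
  induction m generalizing f with
  | zero => rfl
  | succ m ih => rw [Function.iterate_succ_apply, ih, coeff_divX, add_assoc]

theorem X_pow_mul_divX_iterate {f : F[X]} {m : ℕ} (h : ∀ l < m, f.coeff l = 0) :
    Polynomial.X ^ m * divX^[m] f = f := by
  ext i
  rw [coeff_X_pow_mul', coeff_divX_iterate]
  split_ifs with hi
  · rw [Nat.sub_add_cancel hi]
  · exact (h i (by omega)).symm

theorem natDegree_divX_iterate_le (f : F[X]) (m : ℕ) : (divX^[m] f).natDegree ≤ f.natDegree := by
  refine natDegree_le_iff_coeff_eq_zero.2 fun i hi => ?_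
  rw [coeff_divX_iterate]
  exact coeff_eq_zero_of_natDegree_lt (by omega)

open Classical in
/-- Dividing out a power of `X` from a divisor and its multiple. -/
theorem Attains.divX_normalize {P : X → F[X]} (k i : ℕ) : ∀ (S : Know F X) (b w : X → F[X]),
    (∀ x, (b x).natDegree < 2 ^ k) → (∀ x, (w x).natDegree < 2 ^ k) → KnP S b → KnP S w →
    (∀ x, w x = b x * P x) → (∀ x, ∃ l < 2 ^ i, (b x).coeff l ≠ 0) → i ≤ k →
    Attains μ S (fun T => ∃ b' w' : X → F[X], (∀ x, (b' x).natDegree < 2 ^ k) ∧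
      (∀ x, (w' x).natDegree < 2 ^ k) ∧ KnP T b' ∧ KnP T w' ∧ (∀ x, w' x = b' x * P x) ∧
      ∀ x, (b' x).coeff 0 ≠ 0) (i * (3 * 2 ^ k)) := by
  induction i with
  | zero =>
    intro S b w hb hw kb kw hP h0 _
    refine Attains.pure ⟨b, w, hb, hw, kb, kw, hP, fun x => ?_⟩ (by simp)
    obtain ⟨l, hl, h⟩ := h0 x
    have : l = 0 := by simpa using hl
    rwa [this] at h
  | succ i ih =>
    intro S b w hb hw kb kw hP h0 hik
    -- A binary search for the order of vanishing of `b` at `0`: if the lowest `2 ^ i` coefficients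
    -- vanish, both polynomials are shifted by `2 ^ i`. The choice is made coefficient by
    -- coefficient with zero tests.
    refine Attains.bind (Attains.ite_forall_zero (Finset.range (2 ^ i)) (v := fun l x => (b x).coeff l)
      (fun l _ => kb l) (S.const_mem 0) (S.const_mem 1)) fun T hT kT => ?_
    have red : ∀ (f : X → F[X]), KnP S f → (∀ x, (f x).natDegree < 2 ^ k) → ∀ T', T ≤ T' →
        Attains μ T' (fun T'' => KnP T'' fun x =>
          if ∀ l ∈ Finset.range (2 ^ i), (b x).coeff l = 0 then divX^[2 ^ i] (f x) else f x)
          (2 ^ k) := by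
      intro f kf hf T' hT'
      refine (Attains.knP_of_lt (c := 1) (N := 2 ^ k) (fun x => ?_) fun a _ T₁ h₁ => ?_).mono_cost
        (by simp)
      · split_ifs
        · exact (natDegree_divX_iterate_le _ _).trans_lt (hf x)
        · exact hf x
      · refine (Attains.sel (h₁ _ (hT' _ kT)) (h₁ _ (hT' _ (hT _ (kf (a + 2 ^ i)))))
          (h₁ _ (hT' _ (hT _ (kf a))))).imp fun T₂ _ k₂ => ?_
        convert k₂ using 2 with x
        simp only [selectZero]
        split_ifs <;> simp_all [coeff_divX_iterate]
    refine Attains.bind (red b kb hb T le_rfl) fun T₁ h₁ k₁ => ?_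
    refine Attains.bind (red w kw hw T₁ h₁) fun T₂ h₂ k₂ => ?_
    refine (ih T₂ _ _ (fun x => ?_) (fun x => ?_) (k₁.mono h₂) k₂ (fun x => ?_) (fun x => ?_)
      (by omega)).mono_cost ?_
    · split_ifs
      · exact (natDegree_divX_iterate_le _ _).trans_lt (hb x)
      · exact hb x
    · split_ifs
      · exact (natDegree_divX_iterate_le _ _).trans_lt (hw x)
      · exact hw x
    · split_ifs with hc
      · have hb' := X_pow_mul_divX_iterate fun l hl => hc l (Finset.mem_range.2 hl)
        have hw' : Polynomial.X ^ (2 ^ i) * divX^[2 ^ i] (w x) = w x := by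
          refine X_pow_mul_divX_iterate (X_pow_dvd_iff.1 ?_)
          rw [hP x, ← hb', mul_assoc]
          exact dvd_mul_right _ _
        refine mul_left_cancel₀ (pow_ne_zero (2 ^ i) X_ne_zero) ?_
        rw [hw', hP x, ← mul_assoc, hb']
      · exact hP x
    · obtain ⟨l, hl, h⟩ := h0 x
      split_ifs with hc
      · have hl' : 2 ^ i ≤ l := by
          by_contra hlt
          exact h (hc l (Finset.mem_range.2 (by omega)))
        refine ⟨l - 2 ^ i, by rw [pow_succ] at hl; omega, ?_⟩
        rwa [coeff_divX_iterate, Nat.sub_add_cancel hl']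
      · push Not at hc
        obtain ⟨l', hl', h'⟩ := hc
        exact ⟨l', Finset.mem_range.1 hl', h'⟩
    · have : (2 : ℝ) ^ i ≤ 2 ^ k := pow_le_pow_right₀ (by norm_num) (by omega)
      rw [Finset.card_range]
      push_cast
      linarith

/-- The low part of a polynomial. -/
theorem X_pow_dvd_sub_polyBlock (N : ℕ) (f : F[X]) :
    Polynomial.X ^ N ∣ f - polyBlock N 0 f := by
  refine X_pow_dvd_iff.2 fun l hl => ?_
  rw [coeff_sub, coeff_polyBlock, if_pos hl, mul_zero, zero_add, sub_self]

theorem KnP.polyBlock {f : X → F[X]} (h : KnP S f) (m i : ℕ) :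
    KnP S fun x => _root_.polyBlock m i (f x) := by
  intro a
  simp only [coeff_polyBlock]
  split_ifs
  · exact h _
  · exact S.const_mem 0

/-- Newton iteration for the inverse of a power series. -/
theorem Attains.newtonInverse {k : ℕ} {b : X → F[X]} (hb : ∀ x, (b x).natDegree < 2 ^ k)
    (h0 : ∀ x, (b x).coeff 0 ≠ 0) (i : ℕ) (hik : i ≤ k) : ∀ S : Know F X, KnP S b →
    Attains μ S (fun T => ∃ g : X → F[X], KnP T g ∧ (∀ x, (g x).natDegree < 2 ^ k) ∧
      ∀ x, Polynomial.X ^ 2 ^ i ∣ 1 - b x * g x) (3 * i * polyCost k + 1) := by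
  have hpos : 1 ≤ 2 ^ k := Nat.one_le_two_pow
  induction i with
  | zero =>
    intro S kb
    refine Attains.bind (Attains.div (S.const_mem 1) (kb 0)) fun T hT kT => ?_
    refine Attains.pure ⟨fun x => C (1 / (b x).coeff 0), fun l => ?_, fun x => ?_, fun x => ?_⟩
      (by simp)
    · simp only [coeff_C]
      split_ifs
      · exact kT
      · exact T.const_mem 0
    · rw [natDegree_C]; omega
    · refine X_pow_dvd_iff.2 fun l hl => ?_
      have : l = 0 := by simpa using hl
      subst this
      rw [coeff_sub, coeff_mul_C, coeff_one_zero, mul_one_div_cancel (h0 x), sub_self]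
  | succ i ih =>
    intro S kb
    refine Attains.bind (ih (by omega) S kb) fun T₁ h₁ => ?_
    rintro ⟨g, kg, hg, hbg⟩
    refine Attains.bind (PolyMul.two_pow k T₁ b g hb hg (kb.mono h₁) kg) fun T₂ h₂ k₂ => ?_
    have hlt : ∀ f : F[X], (_root_.polyBlock (2 ^ k) 0 f).natDegree < 2 ^ k :=
      fun f => natDegree_polyBlock_lt hpos 0 f
    refine Attains.bind (Attains.polySub (N := 2 ^ k) (KnP.const T₂ 2) (k₂.polyBlock (2 ^ k) 0)
      fun x => ?_) fun T₃ h₃ k₃ => ?_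
    · refine (natDegree_sub_le _ _).trans_lt (max_lt ?_ (hlt _))
      rw [show (2 : F[X]) = ((2 : ℕ) : F[X]) by norm_num, natDegree_natCast]
      omega
    refine (Attains.imp (PolyMul.two_pow k T₃ g _ hg (fun x => ?deg) ((kg.mono h₂).mono h₃) k₃)
      fun T₄ h₄ k₄ => ⟨_, k₄.polyBlock (2 ^ k) 0, fun x => hlt _, fun x => ?dvd⟩).mono_cost ?cost
    case deg =>
      refine (natDegree_sub_le _ _).trans_lt (max_lt ?_ (hlt _))
      rw [show (2 : F[X]) = ((2 : ℕ) : F[X]) by norm_num, natDegree_natCast]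
      omega
    case dvd =>
      set N := 2 ^ k
      set t := _root_.polyBlock N 0 (b x * g x)
      set r := _root_.polyBlock N 0 (g x * (2 - t))
      have hN : Polynomial.X ^ 2 ^ (i + 1) ∣ (Polynomial.X ^ N : F[X]) :=
        pow_dvd_pow _ (Nat.pow_le_pow_right (by norm_num) hik)
      have e1 : Polynomial.X ^ 2 ^ (i + 1) ∣ b x * g x - t :=
        hN.trans (X_pow_dvd_sub_polyBlock N _)
      have e2 : Polynomial.X ^ 2 ^ (i + 1) ∣ g x * (2 - t) - r :=
        hN.trans (X_pow_dvd_sub_polyBlock N _)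
      have e3 : Polynomial.X ^ 2 ^ (i + 1) ∣ (1 - b x * g x) * (1 - b x * g x) := by
        rw [pow_succ, pow_mul, sq]
        exact mul_dvd_mul (hbg x) (hbg x)
      -- The untruncated iterate `g (2 - b g)` squares the error `1 - b g`. The other two terms come
      -- from truncation at `X ^ N`.
      have : 1 - b x * r = (1 - b x * g x) * (1 - b x * g x) - b x * g x * (b x * g x - t) +
          b x * (g x * (2 - t) - r) := by ring
      rw [this]
      exact dvd_add (dvd_sub e3 (e1.mul_left _)) (e2.mul_left _)
    case cost =>
      have h2 := two_pow_le_polyCost k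
      have h3 : (0 : ℝ) ≤ 2 ^ k := by positivity
      push_cast
      linarith

/-- Exact division of polynomials of degree less than `2 ^ k`. -/
theorem Attains.exactDiv {k : ℕ} {b P w : X → F[X]} (hb : ∀ x, (b x).natDegree < 2 ^ k)
    (hw : ∀ x, (w x).natDegree < 2 ^ k) (hP : ∀ x, (P x).natDegree < 2 ^ k)
    (h : ∀ x, w x = b x * P x) (hb0 : ∀ x, b x ≠ 0) (kb : KnP S b) (kw : KnP S w) :
    Attains μ S (fun T => KnP T P) ((4 * k + 2) * polyCost k) := by
  refine Attains.bind (Attains.divX_normalize k k S b w hb hw kb kw h (fun x => ?_) le_rfl)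
    fun T₁ h₁ => ?_
  · exact ⟨_, hb x, leadingCoeff_ne_zero.2 (hb0 x)⟩
  rintro ⟨b', w', hb', hw', kb', kw', h', h0⟩
  refine Attains.bind (Attains.newtonInverse hb' h0 k le_rfl T₁ kb') fun T₂ h₂ => ?_
  rintro ⟨g, kg, hg, hbg⟩
  refine (Attains.imp (PolyMul.two_pow k T₂ w' g hw' hg (kw'.mono h₂) kg) fun T₃ h₃ k₃ l => ?_).mono_cost
    ?_
  -- The product `w' g` agrees with `P` modulo `X ^ (2 ^ k)`, and this determines `P` because its
  -- degree is smaller.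
  · have key : ∀ x, (P x).coeff l = if l < 2 ^ k then (w' x * g x).coeff l else 0 := by
      intro x
      split_ifs with hl
      · have h1 : Polynomial.X ^ 2 ^ k ∣ P x - w' x * g x := by
          have : P x - w' x * g x = P x * (1 - b' x * g x) := by rw [h']; ring
          rw [this]
          exact (hbg x).mul_left _
        have h2 := X_pow_dvd_iff.1 h1 l hl
        rwa [coeff_sub, sub_eq_zero] at h2
      · exact coeff_eq_zero_of_natDegree_lt ((hP x).trans_le (by omega))
    simp only [key]
    split_ifs
    · exact k₃ l
    · exact T₃.const_mem 0
  · have h2 := two_pow_le_polyCost k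
    have h3 : (1 : ℝ) ≤ 2 ^ k := one_le_pow₀ (by norm_num)
    have h4 : (k : ℝ) * (3 * 2 ^ k) ≤ k * polyCost k := by
      gcongr
      linarith
    linarith

end ExactDivision

/-! ### Degrees and values of determinants and adjugates. -/

section DegreeBounds

variable {F : Type u} [Field F] {n : ℕ}

theorem natDegree_det_le {d : ℕ} {A : Matrix (Fin n) (Fin n) F[X]} (hA : DegreeLE d A) :
    A.det.natDegree ≤ n * d := by
  rw [Matrix.det_apply']
  refine natDegree_sum_le_of_forall_le _ _ fun σ _ => ?_
  refine natDegree_mul_le.trans ?_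
  rw [natDegree_intCast, zero_add]
  refine (natDegree_prod_le _ _).trans ((Finset.sum_le_card_nsmul _ _ d fun i _ => hA _ _).trans ?_)
  simp

theorem natDegree_adjugate_le {d : ℕ} {A : Matrix (Fin n) (Fin n) F[X]} (hA : DegreeLE d A)
    (i j : Fin n) : (A.adjugate i j).natDegree ≤ n * d := by
  rw [Matrix.adjugate_apply]
  refine natDegree_det_le fun a b => ?_
  rw [Matrix.updateRow_apply]
  split_ifs
  · by_cases h : b = i
    · subst h; simp
    · simp [h]
  · exact hA a b

theorem DegreeLE.add {d : ℕ} {A B : Matrix (Fin n) (Fin n) F[X]} (hA : DegreeLE d A)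
    (hB : DegreeLE d B) : DegreeLE d (A + B) :=
  fun i j => (natDegree_add_le _ _).trans (max_le (hA i j) (hB i j))

theorem eval_adjugate (A : Matrix (Fin n) (Fin n) F[X]) (r : F) (i j : Fin n) :
    (A.adjugate i j).eval r = (A.map (eval r)).adjugate i j := by
  have := congrFun (congrFun (RingHom.map_adjugate (evalRingHom r) A) i) j
  simpa using this

theorem eval_det_map (A : Matrix (Fin n) (Fin n) F[X]) (r : F) :
    A.det.eval r = (A.map (eval r)).det := by
  have := RingHom.map_det (evalRingHom r) A
  simpa using this

end DegreeBounds

/-- The functions `st l` of a polynomial matrix `A` can be computed, with the adjugate of `A`,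
at cost `a`, and they suffice to compute an entry of the adjugate of a matrix differing from `A`
in `f > 0` positions at cost `q f`. -/
def DynAdj (μ : ℕ → ℝ) {F : Type u} [Field F] (n d : ℕ) {ι : Type}
    (st : ι → Matrix (Fin n) (Fin n) F[X] → F) (X : Type v) (a : ℝ) (q : ℕ → ℝ) : Prop :=
  (∀ (S : Know F X) (A : X → Matrix (Fin n) (Fin n) F[X]), (∀ x, DegreeLE d (A x)) →
    (∀ x, (A x).det ≠ 0) → (∀ i j, KnP S fun x => A x i j) →
    Attains μ S (fun T => (∀ l, (fun x => st l (A x)) ∈ T) ∧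
      ∀ i j, KnP T fun x => (A x).adjugate i j) a) ∧
  ∀ (S : Know F X) (A C : X → Matrix (Fin n) (Fin n) F[X]) (P : Finset (Fin n × Fin n))
    (i j : Fin n), P.Nonempty → (∀ x, DegreeLE d (A x)) → (∀ x, (A x).det ≠ 0) →
    (∀ x, DegreeLE d (C x)) → (∀ x p q, (p, q) ∉ P → C x p q = 0) →
    (∀ x, (A x + C x).det ≠ 0) → (∀ l, (fun x => st l (A x)) ∈ S) →
    (∀ p ∈ P, KnP S fun x => C x p.1 p.2) →
    Attains μ S (fun T => KnP T fun x => (A x + C x).adjugate i j) (q P.card)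

/-! ### Evaluation and interpolation when the field has enough points. -/

section LargeField

variable {F : Type u} [Field F] {X : Type v} {μ : ℕ → ℝ} {n d : ℕ}

/-- The determinants and inverses of the values of a polynomial matrix. -/
noncomputable def pointData (pt : ℕ → F) (k : ℕ) :
    Fin (2 ^ k) ⊕ Fin (2 ^ k) × Fin n × Fin n → Matrix (Fin n) (Fin n) F[X] → F
  | .inl l, A => (A.map (eval (pt l))).det
  | .inr (l, i, j), A => (A.map (eval (pt l)))⁻¹ i j

/-- A bound for the costs of evaluation, interpolation and exact division. -/
noncomputable def fftCost (k : ℕ) : ℝ := 5 * (k + 1) * polyCost k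

/-- All quantities are computed pointwise after multiplication by the determinants whose vanishing
would spoil them. No point has to be avoided, and the determinants are removed afterwards by exact
division of polynomials, where they are nonzero. The largest degree is that of `det A * det (A + C)
* adj (A + C)`, which explains `3 * (n * d) < 2 ^ k`. -/
theorem dynAdj_of_injOn (hμ : MulCost μ) {pt : ℕ → F} {k : ℕ}
    (hpt : Set.InjOn pt (Finset.range (2 ^ k))) (hk : 3 * (n * d) < 2 ^ k) (hd : d ≤ n * d) :
    DynAdj μ n d (pointData pt k) X
      ((3 * (n : ℝ) ^ 2 + 1) * fftCost k + 2 ^ k * (invCost μ n + 2 * (n : ℝ) ^ 2))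
      fun f => (f + 3) * fftCost k + 2 ^ k * (invCost μ f + 12 * (f : ℝ) ^ 2) := by
  have hc1 : 5 * k * polyCost k ≤ fftCost k := by
    rw [fftCost]; nlinarith [polyCost_nonneg k]
  have hc2 : (3 * k + 1) * polyCost k ≤ fftCost k := by
    rw [fftCost]
    nlinarith [polyCost_nonneg k, mul_nonneg (Nat.cast_nonneg (α := ℝ) k) (polyCost_nonneg k)]
  have hc3 : (4 * k + 2) * polyCost k ≤ fftCost k := by
    rw [fftCost]
    nlinarith [polyCost_nonneg k, mul_nonneg (Nat.cast_nonneg (α := ℝ) k) (polyCost_nonneg k)]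
  constructor
  · intro S A hA hdet kA
    refine Attains.bind (Attains.forall_fintype (ι := Fin n × Fin n) (c := fftCost k)
      (Φ := fun s T => ∀ l < 2 ^ k, (fun x => (A x s.1 s.2).eval (pt l)) ∈ T)
      (fun _ _ _ hS h l hl => hS _ (h l hl)) fun s T hT =>
        (Attains.imp (Attains.multipointEval pt k 0 T _
          (fun x => (hA x s.1 s.2).trans_lt (by omega)) ((kA _ _).mono hT))
          fun T' _ h l hl => h l (by simpa using hl)).mono_cost hc1) fun T₁ h₁ k₁ => ?_
    refine Attains.bind (Attains.forall_lt (N := 2 ^ k) (Φ := fun l T =>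
      (fun x => ((A x).map (eval (pt l))).det) ∈ T ∧
      (KnM T fun x => ((A x).map (eval (pt l)))⁻¹) ∧
      KnM T fun x => ((A x).map (eval (pt l))).det • ((A x).map (eval (pt l))).adjugate)
      (fun _ _ _ hS h => ⟨hS _ h.1, h.2.1.mono hS, h.2.2.mono hS⟩) fun l hl T hT =>
        Attains.det_adjugate hμ fun i j => hT _ (k₁ (i, j) l hl)) fun T₂ h₂ k₂ => ?_
    have hdd : ∀ x, (A x).det.natDegree < 2 ^ k := fun x =>
      (natDegree_det_le (hA x)).trans_lt (by omega)
    have hda : ∀ x i j, ((A x).adjugate i j).natDegree < 2 ^ k := fun x i j =>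
      (natDegree_adjugate_le (hA x) i j).trans_lt (by omega)
    have hdp : ∀ x i j, ((A x).det * (A x).adjugate i j).natDegree < 2 ^ k := by
      intro x i j
      have h1 := natDegree_det_le (hA x)
      have h2 := natDegree_adjugate_le (hA x) i j
      exact natDegree_mul_le.trans_lt (by omega)
    refine Attains.bind (Attains.interpolate hpt hdd fun l hl => ?_) fun T₃ h₃ k₃ => ?_
    · simp only [eval_det_map]
      exact (k₂ l hl).1
    refine (Attains.imp (Attains.forall_fintype (ι := Fin n × Fin n) (c := 2 * fftCost k)
      (Φ := fun s T => KnP T fun x => (A x).adjugate s.1 s.2) (fun _ _ _ hS h => h.mono hS)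
      fun s T hT => ?adj) fun T hT kT => ⟨?data, fun i j => kT (i, j)⟩).mono_cost ?cost
    case cost =>
      rw [Fintype.card_prod, Fintype.card_fin]
      push_cast
      linarith
    case data =>
      rintro (l | ⟨l, i, j⟩)
      · exact hT _ (h₃ _ (k₂ l l.2).1)
      · exact hT _ (h₃ _ ((k₂ l l.2).2.1 i j))
    case adj =>
      refine Attains.bind (Attains.interpolate hpt
        (f := fun x => (A x).det * (A x).adjugate s.1 s.2) (fun x => hdp x _ _) fun l hl => ?_)
        fun T₄ h₄ k₄ => ?_
      · simp only [eval_mul, eval_det_map, eval_adjugate]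
        exact hT _ (h₃ _ ((k₂ l hl).2.2 s.1 s.2))
      · exact (Attains.exactDiv hdd (fun x => hdp x _ _) (fun x => hda x s.1 s.2) (fun x => rfl)
          hdet ((k₃.mono hT).mono h₄) k₄).mono_cost (by linarith)
  · intro S A C P i j hP hA hdA hC hCP hdC kA kC
    refine Attains.bind (Attains.forall_finset P (c := fun _ => fftCost k)
      (Φ := fun s T => ∀ l < 2 ^ k, (fun x => (C x s.1 s.2).eval (pt l)) ∈ T)
      (fun _ _ _ _ hS h l hl => hS _ (h l hl)) fun s hs T hT =>
        (Attains.imp (Attains.multipointEval pt k 0 T _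
          (fun x => (hC x s.1 s.2).trans_lt (by omega)) ((kC s hs).mono hT))
          fun T' _ h l hl => h l (by simpa using hl)).mono_cost hc1) fun T₁ h₁ k₁ => ?_
    refine Attains.bind (Attains.forall_lt (N := 2 ^ k) (Φ := fun l T =>
      (fun x => ((A x).map (eval (pt l))).det *
        ((A x).map (eval (pt l)) + (C x).map (eval (pt l))).det) ∈ T ∧
      (fun x => ((A x).map (eval (pt l))).det *
        ((A x).map (eval (pt l)) + (C x).map (eval (pt l))).det *
        ((A x).map (eval (pt l)) + (C x).map (eval (pt l))).adjugate i j) ∈ T)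
      (fun _ _ _ hS h => ⟨hS _ h.1, hS _ h.2⟩) fun l hl T hT =>
        Attains.update hμ hP (fun x p q hpq => by rw [Matrix.map_apply, hCP x p q hpq, eval_zero])
          (hT _ (h₁ _ (kA (.inl ⟨l, hl⟩))))
          (fun a b => hT _ (h₁ _ (kA (.inr (⟨l, hl⟩, a, b)))))
          (fun p hp => hT _ (k₁ p hp l hl)) i j) fun T₂ h₂ k₂ => ?_
    have hAC : ∀ x, DegreeLE d (A x + C x) := fun x => (hA x).add (hC x)
    have hmap : ∀ x r, (A x).map (eval r) + (C x).map (eval r) = (A x + C x).map (eval r) := by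
      intro x r
      ext a b
      simp
    simp only [hmap, ← eval_det_map, ← eval_adjugate, ← eval_mul] at k₂
    have e1 : ∀ x, ((A x).det * (A x + C x).det).natDegree ≤ n * d + n * d := fun x =>
      natDegree_mul_le.trans (add_le_add (natDegree_det_le (hA x)) (natDegree_det_le (hAC x)))
    have e2 : ∀ x, ((A x + C x).adjugate i j).natDegree ≤ n * d := fun x =>
      natDegree_adjugate_le (hAC x) i j
    have e3 : ∀ x, ((A x).det * (A x + C x).det * (A x + C x).adjugate i j).natDegree < 2 ^ k :=
      fun x => natDegree_mul_le.trans_lt (by have := e1 x; have := e2 x; omega)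
    refine Attains.bind (Attains.interpolate hpt (fun x => (e1 x).trans_lt (by omega))
      fun l hl => (k₂ l hl).1) fun T₃ h₃ k₃ => ?_
    refine Attains.bind (Attains.interpolate hpt e3 fun l hl => h₃ _ (k₂ l hl).2)
      fun T₄ h₄ k₄ => ?_
    refine (Attains.exactDiv (fun x => (e1 x).trans_lt (by omega)) e3
      (fun x => (e2 x).trans_lt (by omega)) (fun x => rfl)
      (fun x => mul_ne_zero (hdA x) (hdC x)) (k₃.mono h₄) k₄).mono_cost ?_
    simp only [Finset.sum_const, nsmul_eq_mul]
    push_cast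
    linarith

end LargeField

/-! ### Matrices of degree zero. -/

section ConstantMatrices

variable {F : Type u} [Field F] {X : Type v} {μ : ℕ → ℝ} {n : ℕ}

/-- The determinant and inverse of a constant matrix. -/
noncomputable def constData : Unit ⊕ Fin n × Fin n → Matrix (Fin n) (Fin n) F[X] → F
  | .inl _, A => (A.map (eval 0)).det
  | .inr (i, j), A => (A.map (eval 0))⁻¹ i j

/-- The single point `0` carries all information, and the exact division becomes one division by a
nonzero field element. No transform occurs, hence no logarithm from it. -/
theorem dynAdj_const (hμ : MulCost μ) :
    DynAdj μ n 0 (constData (F := F)) X (invCost μ n + 3 * (n : ℝ) ^ 2)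
      fun f => invCost μ f + 12 * (f : ℝ) ^ 2 + 1 := by
  have hC : ∀ {p : F[X]}, p.natDegree ≤ 0 → ∀ i, p.coeff i = if i = 0 then p.eval 0 else 0 := by
    intro p hp i
    rw [eq_C_of_natDegree_le_zero hp, eval_C, coeff_C]
  have hdet : ∀ {A : Matrix (Fin n) (Fin n) F[X]}, DegreeLE 0 A → A.det ≠ 0 →
      (A.map (eval 0)).det ≠ 0 := by
    intro A hA h0 h
    have hd := eq_C_of_natDegree_le_zero ((natDegree_det_le hA).trans_eq (mul_zero n))
    rw [← eval_det_map, hd, eval_C] at h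
    rw [hd, h, C_0] at h0
    exact h0 rfl
  constructor
  · intro S A hA hd kA
    refine Attains.bind (Attains.det_adjugate (A := fun x => (A x).map (eval 0)) hμ fun i j => ?_)
      fun T hT k => ?_
    · simpa only [Matrix.map_apply, ← coeff_zero_eq_eval_zero] using kA i j 0
    refine (Attains.imp (Attains.forall_fintype (ι := Fin n × Fin n) (c := 1)
      (Φ := fun s T => KnP T fun x => (A x).adjugate s.1 s.2) (fun _ _ _ hS h => h.mono hS)
      fun s T' hT' => ?adj) fun T' hT' kT => ⟨?data, fun i j => kT (i, j)⟩).mono_cost ?cost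
    case cost =>
      rw [Fintype.card_prod, Fintype.card_fin]
      push_cast
      linarith
    case data =>
      rintro (l | ⟨i, j⟩)
      · exact hT' _ k.1
      · exact hT' _ (k.2.1 i j)
    case adj =>
      refine (Attains.div (hT' _ (k.2.2 s.1 s.2)) (hT' _ k.1)).imp fun T₁ _ k₁ a => ?_
      simp only [fun x => hC (by simpa using natDegree_adjugate_le (hA x) s.1 s.2) a, eval_adjugate]
      split_ifs
      · convert k₁ using 2 with x
        simp only [Matrix.smul_apply, smul_eq_mul]
        rw [mul_div_cancel_left₀ _ (hdet (hA x) (hd x))]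
      · exact T₁.const_mem 0
  · intro S A C P i j hP hA hdA hC' hCP hdC kA kC
    have hAC : ∀ x, DegreeLE 0 (A x + C x) := fun x => (hA x).add (hC' x)
    have hmap : ∀ x, (A x).map (eval 0) + (C x).map (eval 0) = (A x + C x).map (eval 0) := by
      intro x
      ext a b
      simp
    refine Attains.bind (Attains.update hμ (A := fun x => (A x).map (eval 0))
      (C := fun x => (C x).map (eval 0)) hP
      (fun x p q hpq => by rw [Matrix.map_apply, hCP x p q hpq, eval_zero])
      (kA (.inl ())) (fun a b => kA (.inr (a, b)))
      (fun p hp => by simpa only [Matrix.map_apply, ← coeff_zero_eq_eval_zero] using kC p hp 0)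
      i j) fun T hT k => ?_
    simp only [hmap] at k
    refine (Attains.imp (Attains.div k.2 k.1) fun T₁ _ k₁ a => ?_).mono_cost (by linarith)
    simp only [fun x => hC (by simpa using natDegree_adjugate_le (hAC x) i j) a, eval_adjugate]
    split_ifs
    · convert k₁ using 2 with x
      rw [mul_div_cancel_left₀]
      exact mul_ne_zero (hdet (hA x) (hdA x)) (hdet (hAC x) (hdC x))
    · exact T₁.const_mem 0

end ConstantMatrices

/-! ### Simulating an extension field in coordinates. -/

section RestrictionOfScalars

variable {F : Type u} [Field F] {E : Type w} [Field E] [Algebra F E] {X : Type v} {μ : ℕ → ℝ}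
  {e : ℕ} {b : Module.Basis (Fin e) F E} {T : Know F X}

/-- The `E`-valued functions whose coordinates are known. -/
def Know.lift (b : Module.Basis (Fin e) F E) (T : Know F X) : Know E X :=
  ⟨{g | ∀ l, (fun x => b.repr (g x) l) ∈ T}, fun _ _ => T.const_mem _⟩

theorem Know.lift_mono {T' : Know F X} (h : T ≤ T') : T.lift b ≤ T'.lift b :=
  fun _ hg l => h _ (hg l)

/-- The cost over `F` of simulating one operation over an extension of degree `e`. -/
noncomputable def extCost (μ : ℕ → ℝ) (e : ℕ) : ℝ :=
  2 * (e : ℝ) ^ 3 + 3 * (e : ℝ) ^ 2 + invCost μ e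

theorem Attains.leftMulMatrix {g : X → E} (hg : g ∈ T.lift b) :
    Attains μ T (fun T' => KnM T' fun x => Algebra.leftMulMatrix b (g x)) (2 * (e : ℝ) ^ 3) := by
  refine (Attains.imp (Attains.family (ι := Fin e × Fin e)
    (v := fun s x => Algebra.leftMulMatrix b (g x) s.1 s.2) (c := 2 * e) fun s T' hT' => ?_)
    fun T' _ h i j => h (i, j)).mono_cost (le_of_eq ?_)
  · have : ∀ x, Algebra.leftMulMatrix b (g x) s.1 s.2 =
        ∑ l : Fin e, b.repr (g x) l * b.repr (b l * b s.2) s.1 := by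
      intro x
      rw [Algebra.leftMulMatrix_eq_repr_mul]
      conv_lhs => rw [← b.sum_repr (g x), Finset.sum_mul, map_sum, Finset.sum_apply']
      simp only [smul_mul_assoc, map_smul, Finsupp.smul_apply, smul_eq_mul]
    simp only [this]
    exact (Attains.sum_mul Finset.univ (v := fun l x => b.repr (g x) l)
      (w := fun l _ => b.repr (b l * b s.2) s.1) (fun l _ => hT' _ (hg l))
      fun l _ => T'.const_mem _).mono_cost (by simp)
  · rw [Fintype.card_prod, Fintype.card_fin]
    push_cast
    ring

theorem Attains.repr_mulVec {M : X → Matrix (Fin e) (Fin e) F} {g h : X → E} (hM : KnM T M)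
    (hg : g ∈ T.lift b) (hMg : ∀ x, (M x).mulVec (b.repr (g x)) = b.repr (h x)) :
    Attains μ T (fun T' => h ∈ T'.lift b) (2 * (e : ℝ) ^ 2) := by
  refine (Attains.family (v := fun l x => b.repr (h x) l) (c := 2 * e)
    fun l T' hT' => ?_).mono_cost (le_of_eq (by rw [Fintype.card_fin]; ring))
  simp only [← hMg, Matrix.mulVec, dotProduct]
  exact (Attains.sum_mul Finset.univ (fun i _ => hT' _ (hM l i))
    fun i _ => hT' _ (hg i)).mono_cost (by simp)

theorem invCost_nonneg (hμ : MulCost μ) (n : ℕ) : 0 ≤ invCost μ n := by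
  have h : ∀ k, 0 ≤ regCost μ k := by
    intro k
    induction k with
    | zero => simp [regCost]
    | succ k ih =>
      rw [regCost]
      linarith [(sq_nonneg _).trans (hμ.sq_le (2 ^ (k + 1)))]
  rw [invCost]
  linarith [h (Nat.clog 2 n), (sq_nonneg _).trans (hμ.sq_le (2 ^ Nat.clog 2 n))]

theorem IsOp.mono {S S' : Know F X} {g : X → F} (h : IsOp S g) (hS : S ≤ S') : IsOp S' g := by
  cases h with
  | add hf hg => exact .add (hS _ hf) (hS _ hg)
  | sub hf hg => exact .sub (hS _ hf) (hS _ hg)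
  | mul hf hg => exact .mul (hS _ hf) (hS _ hg)
  | div hf hg => exact .div (hS _ hf) (hS _ hg)
  | sel he hf hg => exact .sel (hS _ he) (hS _ hf) (hS _ hg)

/-- Division becomes inversion of the multiplication matrix. The conventions at `y = 0` agree: both
sides are zero. -/
theorem leftMulMatrix_inv_mulVec (y z : E) :
    (Algebra.leftMulMatrix b y)⁻¹.mulVec (b.repr z) = b.repr (z / y) := by
  by_cases hy : y = 0
  · subst hy
    rcases isEmpty_or_nonempty (Fin e) with h | h
    · ext i; exact h.elim i
    · simp
  · have : (Algebra.leftMulMatrix b y)⁻¹ = Algebra.leftMulMatrix b y⁻¹ := by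
      refine Matrix.inv_eq_right_inv ?_
      rw [← map_mul, mul_inv_cancel₀ hy, map_one]
    rw [this, Algebra.leftMulMatrix_mulVec_repr, div_eq_inv_mul]

theorem Attains.lift_isOp (hμ : MulCost μ) {g : X → E} (hg : IsOp (T.lift b) g) :
    Attains μ T (fun T' => g ∈ T'.lift b) (extCost μ e) := by
  have h0 := invCost_nonneg hμ e
  have he : (e : ℝ) ≤ (e : ℝ) ^ 2 := by exact_mod_cast Nat.le_self_pow (by norm_num) e
  have he3 : (0 : ℝ) ≤ (e : ℝ) ^ 3 := by positivity
  have he2 : (0 : ℝ) ≤ (e : ℝ) ^ 2 := by positivity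
  cases hg with
  | @add f g hf hg =>
    refine (Attains.family (v := fun l x => b.repr (f x + g x) l) (c := 1)
      fun l T' hT' => ?_).mono_cost (by rw [Fintype.card_fin, extCost]; linarith)
    simp only [map_add, Finsupp.add_apply]
    exact Attains.add (hT' _ (hf l)) (hT' _ (hg l))
  | @sub f g hf hg =>
    refine (Attains.family (v := fun l x => b.repr (f x - g x) l) (c := 1)
      fun l T' hT' => ?_).mono_cost (by rw [Fintype.card_fin, extCost]; linarith)
    simp only [map_sub, Finsupp.sub_apply]
    exact Attains.sub (hT' _ (hf l)) (hT' _ (hg l))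
  | @mul f g hf hg =>
    refine Attains.bind (Attains.leftMulMatrix hf) fun T₁ h₁ k₁ => ?_
    exact (Attains.repr_mulVec k₁ (Know.lift_mono h₁ _ hg)
      fun x => Algebra.leftMulMatrix_mulVec_repr b (f x) (g x)).mono_cost
      (by rw [extCost]; linarith)
  | @div f g hf hg =>
    refine Attains.bind (Attains.leftMulMatrix hg) fun T₁ h₁ k₁ => ?_
    refine Attains.bind (Attains.det_inv hμ k₁) fun T₂ h₂ k₂ => ?_
    exact (Attains.repr_mulVec k₂.2 (Know.lift_mono (h₁.trans h₂) _ hf)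
      fun x => leftMulMatrix_inv_mulVec (g x) (f x)).mono_cost
      (by rw [extCost, Fintype.card_fin]; linarith)
  | @sel a f g ha hf hg =>
    refine (Attains.family (v := fun l x => b.repr (selectZero a f g x) l) (c := e)
      fun l T' hT' => ?_).mono_cost (by rw [Fintype.card_fin, extCost, ← sq]; linarith)
    refine (Attains.imp (Attains.ite_forall_zero Finset.univ (fun i _ => hT' _ (ha i))
      (hT' _ (hf l)) (hT' _ (hg l))) fun T₁ _ k₁ => ?_).mono_cost (by simp)
    convert k₁ using 2 with x
    have h : a x = 0 ↔ ∀ i ∈ Finset.univ, b.repr (a x) i = 0 := by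
      rw [← b.repr.map_eq_zero_iff, Finsupp.ext_iff]
      simp
    by_cases hx : a x = 0
    · rw [selectZero, if_pos hx, if_pos (h.1 hx)]
    · rw [selectZero, if_neg hx, if_neg fun h' => hx (h.2 h')]

/-- In coordinates, a product over `E` is a combination of `e ^ 2` matrix products over `F`. The
left factors collect one fixed entry of the multiplication matrices of the entries of `A`. -/
theorem Attains.lift_matMul (hμ : MulCost μ) {n : ℕ} {A B : X → Matrix (Fin n) (Fin n) E}
    (hA : KnM (T.lift b) A) (hB : KnM (T.lift b) B) :
    Attains μ T (fun T' => KnM (T'.lift b) fun x => A x * B x) (extCost μ e * μ n) := by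
  have hn := hμ.sq_le n
  refine Attains.bind (Attains.forall_fintype (ι := Fin n × Fin n)
    (Φ := fun s T' => KnM T' fun x => Algebra.leftMulMatrix b (A x s.1 s.2))
    (fun _ _ _ hS h => h.mono hS)
    fun s T' hT' => Attains.leftMulMatrix (Know.lift_mono hT' _ (hA s.1 s.2))) fun T₁ h₁ k₁ => ?_
  refine Attains.bind (Attains.forall_fintype (ι := Fin e × Fin e)
    (Φ := fun s T' => KnM T' fun x => Matrix.of (fun i j : Fin n =>
      Algebra.leftMulMatrix b (A x i j) s.1 s.2) * Matrix.of fun i j : Fin n => b.repr (B x i j) s.2)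
    (c := μ n) (fun _ _ _ hS h => h.mono hS)
    fun s T' hT' => (Attains.matMul (fun i j => hT' _ (k₁ (i, j) s.1 s.2))
      fun i j => hT' _ (h₁ _ (hB i j s.2))).mono_cost (by simp)) fun T₂ h₂ k₂ => ?_
  refine (Attains.imp (Attains.family (ι := (Fin n × Fin n) × Fin e)
    (v := fun s x => b.repr ((A x * B x) s.1.1 s.1.2) s.2) (c := e) fun s T' hT' => ?_)
    fun T' _ h i j l => h ((i, j), l)).mono_cost ?_
  · have : ∀ x, b.repr ((A x * B x) s.1.1 s.1.2) s.2 = ∑ t : Fin e,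
        (Matrix.of (fun i j : Fin n => Algebra.leftMulMatrix b (A x i j) s.2 t) *
          Matrix.of fun i j : Fin n => b.repr (B x i j) t) s.1.1 s.1.2 := by
      intro x
      simp only [Matrix.mul_apply, Matrix.of_apply]
      rw [Finset.sum_comm, map_sum, Finset.sum_apply']
      refine Finset.sum_congr rfl fun j _ => ?_
      rw [← Algebra.leftMulMatrix_mulVec_repr]
      rfl
    simp only [this]
    exact (Attains.sum Finset.univ fun t _ => hT' _ (k₂ (s.2, t) s.1.1 s.1.2)).mono_cost (by simp)
  · have h0 := invCost_nonneg hμ e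
    have hμ0 : 0 ≤ μ n := (sq_nonneg _).trans hn
    have h3 : (0 : ℝ) ≤ (e : ℝ) ^ 3 := by positivity
    have h2 : (0 : ℝ) ≤ (e : ℝ) ^ 2 := by positivity
    simp only [Fintype.card_prod, Fintype.card_fin]
    rw [extCost]
    push_cast
    nlinarith [mul_le_mul_of_nonneg_left hn h3, mul_le_mul_of_nonneg_left hn h2,
      mul_nonneg h0 hμ0, mul_nonneg h2 hμ0]

theorem Reach.lift (hμ : MulCost μ) {S S' : Know E X} {c : ℝ} (h : Reach μ S c S') :
    ∀ T : Know F X, S ≤ T.lift b → Attains μ T (fun T' => S' ≤ T'.lift b) (extCost μ e * c) := by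
  induction h with
  | refl S => exact fun T h => Attains.pure h (by simp)
  | @op S S' c g hg _ ih =>
    intro T hT
    refine Attains.bind (Attains.lift_isOp hμ (hg.mono hT)) fun T₁ h₁ k₁ => ?_
    refine (ih T₁ ?_).mono_cost (by linarith)
    rintro g' (hg' | rfl)
    · exact Know.lift_mono h₁ _ (hT _ hg')
    · exact k₁
  | matMul n A B hA hB _ ih =>
    intro T hT
    refine Attains.bind (Attains.lift_matMul hμ (hA.mono hT) (hB.mono hT)) fun T₁ h₁ k₁ => ?_
    refine (ih T₁ ?_).mono_cost (by linarith)
    rintro g (hg | ⟨s, rfl⟩)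
    · exact Know.lift_mono h₁ _ (hT _ hg)
    · exact k₁ s.1 s.2

theorem repr_algebraMap (a : F) (l : Fin e) :
    b.repr (algebraMap F E a) l = a * b.repr 1 l := by
  rw [Algebra.algebraMap_eq_smul_one, map_smul, Finsupp.smul_apply, smul_eq_mul]

theorem Attains.lift_map {p : X → F[X]} {D : ℕ} (hp : ∀ x, (p x).natDegree ≤ D) (kp : KnP T p) :
    Attains μ T (fun T' => KnP (T'.lift b) fun x => (p x).map (algebraMap F E)) ((D + 1) * e) := by
  refine (Attains.imp (Attains.forall_lt (N := D + 1) (c := e)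
    (Φ := fun i T' => (fun x => ((p x).map (algebraMap F E)).coeff i) ∈ T'.lift b)
    (fun _ _ _ hS h => Know.lift_mono hS _ h) fun i _ T' hT' => ?_) fun T' _ h i => ?_).mono_cost
    (by push_cast; rfl)
  · refine (Attains.family (v := fun l x => b.repr (((p x).map (algebraMap F E)).coeff i) l) (c := 1)
      fun l T₁ h₁ => ?_).mono_cost (by simp)
    simp only [coeff_map, repr_algebraMap]
    exact Attains.mul (h₁ _ (hT' _ (kp i))) (T₁.const_mem _)
  · by_cases hi : i < D + 1
    · exact h i hi
    · convert (T'.lift b).const_mem 0 using 2 with x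
      rw [coeff_map, coeff_eq_zero_of_natDegree_lt (by have := hp x; omega), map_zero]

theorem Attains.of_lift_map {p : X → F[X]} {D : ℕ} (hp : ∀ x, (p x).natDegree ≤ D)
    (kp : KnP (T.lift b) fun x => (p x).map (algebraMap F E)) :
    Attains μ T (fun T' => KnP T' p) (D + 1) := by
  -- The basis need not contain `1`. Some coordinate of `1` is nonzero, and dividing the same
  -- coordinate of the image of `a` by it recovers `a`.
  obtain ⟨l, hl⟩ : ∃ l, b.repr (1 : E) l ≠ 0 := by
    by_contra! h
    exact one_ne_zero (b.repr.map_eq_zero_iff.1 (Finsupp.ext h))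
  refine (Attains.knP_of_lt (N := D + 1) (c := 1) (fun x => Nat.lt_succ_of_le (hp x))
    fun i _ T' hT' => ?_).mono_cost (by push_cast; linarith)
  have h := kp i l
  simp only [coeff_map, repr_algebraMap] at h
  refine (Attains.mul (hT' _ h) (T'.const_mem (b.repr (1 : E) l)⁻¹)).imp fun T₁ _ h₁ => ?_
  simpa only [mul_inv_cancel_right₀ hl] using h₁

theorem Attains.of_lift (hμ : MulCost μ) {Φ : Know E X → Prop} {c : ℝ}
    (mono : ∀ S S', S ≤ S' → Φ S → Φ S') (h : Attains μ (T.lift b) Φ c) :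
    Attains μ T (fun T' => Φ (T'.lift b)) (extCost μ e * c) := by
  obtain ⟨c', S', h₁, h₂, h₃⟩ := h
  refine ((h₁.lift hμ T le_rfl).imp fun T' _ hT' => mono _ _ hT' h₃).mono_cost ?_
  have := invCost_nonneg hμ e
  exact mul_le_mul_of_nonneg_left h₂ (by rw [extCost]; positivity)

theorem map_adjugate_apply {n : ℕ} (A : Matrix (Fin n) (Fin n) F[X]) (i j : Fin n) :
    (A.map (Polynomial.map (algebraMap F E))).adjugate i j =
      (A.adjugate i j).map (algebraMap F E) := by
  have := congrFun (congrFun (RingHom.map_adjugate (mapRingHom (algebraMap F E)) A) i) j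
  simpa using this.symm

theorem det_map_ne_zero {n : ℕ} {A : Matrix (Fin n) (Fin n) F[X]} (h : A.det ≠ 0) :
    (A.map (Polynomial.map (algebraMap F E))).det ≠ 0 := by
  have := RingHom.map_det (mapRingHom (algebraMap F E)) A
  simp only [coe_mapRingHom, RingHom.mapMatrix_apply] at this
  rw [← this]
  exact (Polynomial.map_ne_zero_iff (algebraMap F E).injective).2 h

theorem DegreeLE.map {n d : ℕ} {A : Matrix (Fin n) (Fin n) F[X]} (h : DegreeLE d A) :
    DegreeLE d (A.map (Polynomial.map (algebraMap F E))) :=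
  fun i j => natDegree_map_le.trans (h i j)

/-- The coordinates of the data stored over an extension field. -/
noncomputable def restrictData {n : ℕ} {ι : Type} (b : Module.Basis (Fin e) F E)
    (st : ι → Matrix (Fin n) (Fin n) E[X] → E) :
    ι × Fin e → Matrix (Fin n) (Fin n) F[X] → F :=
  fun p A => b.repr (st p.1 (A.map (Polynomial.map (algebraMap F E)))) p.2

/-- Adjugates commute with the base change from `F` to `E`, and nonzero determinants stay nonzero.
The computation can thus run over `E`, its stored data being kept as coordinates over `F`. -/
theorem DynAdj.restrict (hμ : MulCost μ) (b : Module.Basis (Fin e) F E) {n d : ℕ} {ι : Type}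
    {st : ι → Matrix (Fin n) (Fin n) E[X] → E} {a : ℝ} {q : ℕ → ℝ} (h : DynAdj μ n d st X a q) :
    DynAdj μ n d (restrictData b st) X
      (extCost μ e * a + (n : ℝ) ^ 2 * ((d + 1) * e + (n * d + 1)))
      fun f => extCost μ e * q f + f * ((d + 1) * e) + (n * d + 1) := by
  constructor
  · intro S A hA hdA kA
    refine Attains.bind (Attains.forall_fintype (ι := Fin n × Fin n)
      (Φ := fun s T => KnP (T.lift b) fun x => (A x s.1 s.2).map (algebraMap F E))
      (fun _ _ _ hS h => h.mono (Know.lift_mono hS)) fun s T hT =>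
        Attains.lift_map (fun x => hA x s.1 s.2) ((kA s.1 s.2).mono hT)) fun T₁ h₁ k₁ => ?_
    refine Attains.bind (Attains.of_lift hμ (fun _ _ hS h => ⟨fun l => hS _ (h.1 l),
      fun i j => (h.2 i j).mono hS⟩) (h.1 (T₁.lift b) (fun x => (A x).map (Polynomial.map _))
        (fun x => (hA x).map) (fun x => det_map_ne_zero (hdA x)) fun i j => k₁ (i, j)))
      fun T₂ h₂ k₂ => ?_
    refine (Attains.imp (Attains.forall_fintype (ι := Fin n × Fin n) (c := n * d + 1)
      (Φ := fun s T => KnP T fun x => (A x).adjugate s.1 s.2) (fun _ _ _ hS h => h.mono hS)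
      fun s T' hT' => ?adj) fun T' hT' kT => ⟨fun l => hT' _ (k₂.1 l.1 l.2),
        fun i j => kT (i, j)⟩).mono_cost ?cost
    case cost =>
      rw [Fintype.card_prod, Fintype.card_fin]
      push_cast
      apply le_of_eq
      ring
    case adj =>
      refine (Attains.of_lift_map (b := b) (D := n * d) (fun x => natDegree_adjugate_le (hA x) _ _)
        ?_).mono_cost (by push_cast; rfl)
      simp only [← map_adjugate_apply]
      exact (k₂.2 s.1 s.2).mono (Know.lift_mono hT')
  · intro S A C P i j hP hA hdA hC hCP hdC kA kC
    refine Attains.bind (Attains.forall_finset P (c := fun _ => (d + 1) * e)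
      (Φ := fun s T => KnP (T.lift b) fun x => (C x s.1 s.2).map (algebraMap F E))
      (fun _ _ _ _ hS h => h.mono (Know.lift_mono hS)) fun s hs T hT =>
        Attains.lift_map (fun x => hC x s.1 s.2) ((kC s hs).mono hT)) fun T₁ h₁ k₁ => ?_
    have hadd : ∀ x, (A x).map (Polynomial.map (algebraMap F E)) +
        (C x).map (Polynomial.map (algebraMap F E)) =
        (A x + C x).map (Polynomial.map (algebraMap F E)) := by
      intro x
      ext i j : 2
      simp
    refine Attains.bind (Attains.of_lift hμ (fun _ _ hS h => h.mono hS)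
      (h.2 (T₁.lift b) (fun x => (A x).map (Polynomial.map _))
        (fun x => (C x).map (Polynomial.map _)) P i j hP
        (fun x => (hA x).map) (fun x => det_map_ne_zero (hdA x)) (fun x => (hC x).map)
        (fun x p q hpq => by rw [Matrix.map_apply, hCP x p q hpq, Polynomial.map_zero])
        (fun x => by rw [hadd]; exact det_map_ne_zero (hdC x))
        (fun l l' => h₁ _ (kA (l, l'))) k₁)) fun T₂ h₂ k₂ => ?_
    simp only [hadd, map_adjugate_apply] at k₂
    refine (Attains.of_lift_map (b := b) (D := n * d)
      (fun x => natDegree_adjugate_le ((hA x).add (hC x)) i j) k₂).mono_cost ?_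
    simp only [Finset.sum_const, nsmul_eq_mul]
    push_cast
    linarith

end RestrictionOfScalars

/-! ### Compiling the cost calculus into programs. -/

namespace ArithProg

variable {F : Type u} {ι ι' κ : Type}

/-- Substitution of operands for the stored elements. -/
def Operand.subst (s : ι' → Operand F ι) : Operand F ι' → Operand F ι
  | .var i => s i
  | .const a => .const a

/-- Substitution of operands for the stored elements. -/
def Instr.subst (s : ι' → Operand F ι) : Instr F ι' → Instr F ι
  | .add a b => .add (a.subst s) (b.subst s)
  | .sub a b => .sub (a.subst s) (b.subst s)
  | .mul a b => .mul (a.subst s) (b.subst s)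
  | .div a b => .div (a.subst s) (b.subst s)
  | .ifZero a b c => .ifZero (a.subst s) (b.subst s) (c.subst s)

theorem Operand.eval_subst (s : ι' → Operand F ι) (a : Operand F ι') (y : ι → F) :
    (a.subst s).eval y = a.eval fun i => (s i).eval y := by
  cases a <;> rfl

theorem Instr.eval_subst [Field F] (s : ι' → Operand F ι) (a : Instr F ι') (y : ι → F) :
    (a.subst s).eval y = a.eval fun i => (s i).eval y := by
  cases a with
  | ifZero a b c =>
    classical
    exact if_congr (by rw [Operand.eval_subst]) (Operand.eval_subst _ _ _) (Operand.eval_subst _ _ _)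
  | _ => simp [Instr.subst, Instr.eval, Operand.eval_subst]

/-- The operand in the state after one more operation. -/
def Operand.lift : Operand F ι → Operand F (Option ι) := Operand.subst fun i => .var (some i)

theorem Operand.eval_lift (a : Operand F ι) (r : F) (y : ι → F) :
    a.lift.eval (fun o : Option ι => o.elim r y) = a.eval y :=
  Operand.eval_subst _ _ _

end ArithProg

section ProgramOfReach

open ArithProg

variable {F : Type u} {X : Type v} {S : Know F X} {ι κ : Type}

/-- Every function in `S` is an operand in the state with elements `y`. -/
def Represents (y : ι → X → F) (S : Know F X) : Prop :=
  ∀ g ∈ S, ∃ o : Operand F ι, ∀ x, o.eval (fun i => y i x) = g x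

theorem Represents.mono {S' : Know F X} {y : ι → X → F} (hy : Represents y S') (h : S ≤ S') :
    Represents y S := fun g hg => hy g (h g hg)

variable [Field F]

/-- A program of cost at most `c` computes the functions `w` from `y`. -/
def Computes (y : ι → X → F) (w : κ → X → F) (c : ℝ) : Prop :=
  ∃ P : Program F κ ι, (P.cost : ℝ) ≤ c ∧ ∀ x k, P.eval (fun i => y i x) k = w k x

theorem Computes.step {y : ι → X → F} {w : κ → X → F} {c : ℝ} (ins : Instr F ι)
    (h : Computes (fun (o : Option ι) x => o.elim (ins.eval fun i => y i x) fun i => y i x) w c) :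
    Computes y w (c + 1) := by
  obtain ⟨P, hP, h⟩ := h
  exact ⟨.step ins P, by simpa [Program.cost] using hP, h⟩

theorem Represents.step {y : ι → X → F} (hy : Represents y S) (ins : Instr F ι) :
    Represents (fun (o : Option ι) x => o.elim (ins.eval fun i => y i x) fun i => y i x)
      (S.extend {fun x => ins.eval fun i => y i x}) := by
  rintro g (hg | rfl)
  · obtain ⟨o, ho⟩ := hy g hg
    exact ⟨o.lift, fun x => (Operand.eval_lift o _ _).trans (ho x)⟩
  · exact ⟨.var none, fun x => rfl⟩

/-- Inlining a program. -/
theorem Computes.inline {ι' κ' : Type} (Q : Program F κ' ι') : ∀ {ι : Type} {y : ι → X → F}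
    {S : Know F X} (s : ι' → Operand F ι) {w : κ → X → F} {c : ℝ}, Represents y S →
    (∀ {ι₂ : Type} {y₂ : ι₂ → X → F}, Represents y₂ (S.extend (Set.range fun k x =>
      Q.eval (fun i => (s i).eval fun i => y i x) k)) → Computes y₂ w c) →
    Computes y w (c + Q.cost) := by
  induction Q with
  | ret out =>
    intro ι y S s w c hy h
    have : Represents y (S.extend (Set.range fun k x =>
        (Program.ret out).eval (fun i => (s i).eval fun i => y i x) k)) := by
      rintro g (hg | ⟨k, rfl⟩)
      · exact hy g hg
      · exact ⟨(out k).subst s, fun x => Operand.eval_subst _ _ _⟩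
    simpa [Program.cost] using h this
  | step ins rest ih =>
    intro ι y S s w c hy h
    rw [Program.cost, Nat.cast_add, Nat.cast_one, ← add_assoc]
    refine Computes.step (ins.subst s) (ih (fun o => o.elim (.var none) fun i => (s i).lift)
      (hy.step (ins.subst s)) fun hy₂ => h (hy₂.mono ?_))
    rintro g (hg | ⟨k, rfl⟩)
    · exact Know.le_extend _ _ _ (Know.le_extend _ _ _ hg)
    · refine Know.mem_extend ⟨k, ?_⟩
      funext x
      simp only [Program.eval]
      congr 2
      funext o
      cases o with
      | none => exact Instr.eval_subst _ _ _
      | some i => exact Operand.eval_lift _ _ _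

/-- Each operation becomes one instruction, and each matrix product an inlined copy of the program
provided by `hF`. The index type of the stored elements changes with every step, so the induction
quantifies over it. -/
theorem Computes.of_reach {ω c : ℝ} (hF : MatMulIn F ω c) {a : ℝ} {S' : Know F X}
    (h : Reach (fun n : ℕ => c * (n : ℝ) ^ ω) S a S') :
    ∀ {ι : Type} {y : ι → X → F} {w : κ → X → F}, Represents y S → (∀ k, w k ∈ S') →
    Computes y w a := by
  induction h with
  | refl S =>
    intro ι y w hy hw
    choose o ho using fun k => hy _ (hw k)
    exact ⟨.ret o, by simp [Program.cost], fun x k => ho k x⟩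
  | @op S S' a g hg _ ih =>
    intro ι y w hy hw
    obtain ⟨ins, hins⟩ : ∃ ins : Instr F ι, (fun x => ins.eval fun i => y i x) = g := by
      cases hg with
      | add h₁ h₂ =>
        obtain ⟨o₁, e₁⟩ := hy _ h₁
        obtain ⟨o₂, e₂⟩ := hy _ h₂
        exact ⟨.add o₁ o₂, by simp only [Instr.eval, e₁, e₂]⟩
      | sub h₁ h₂ =>
        obtain ⟨o₁, e₁⟩ := hy _ h₁
        obtain ⟨o₂, e₂⟩ := hy _ h₂
        exact ⟨.sub o₁ o₂, by simp only [Instr.eval, e₁, e₂]⟩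
      | mul h₁ h₂ =>
        obtain ⟨o₁, e₁⟩ := hy _ h₁
        obtain ⟨o₂, e₂⟩ := hy _ h₂
        exact ⟨.mul o₁ o₂, by simp only [Instr.eval, e₁, e₂]⟩
      | div h₁ h₂ =>
        obtain ⟨o₁, e₁⟩ := hy _ h₁
        obtain ⟨o₂, e₂⟩ := hy _ h₂
        exact ⟨.div o₁ o₂, by simp only [Instr.eval, e₁, e₂]⟩
      | sel h₁ h₂ h₃ =>
        obtain ⟨o₁, e₁⟩ := hy _ h₁
        obtain ⟨o₂, e₂⟩ := hy _ h₂
        obtain ⟨o₃, e₃⟩ := hy _ h₃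
        refine ⟨.ifZero o₁ o₂ o₃, ?_⟩
        classical
        ext x
        exact if_congr (by rw [e₁]) (e₂ x) (e₃ x)
    subst hins
    exact Computes.step ins (ih (hy.step ins) hw)
  | @matMul S S' a n A B hA hB _ ih =>
    intro ι y w hy hw
    obtain ⟨Q, hQc, hQ⟩ := hF n
    choose oA eA using fun p : Fin n × Fin n => hy _ (hA p.1 p.2)
    choose oB eB using fun p : Fin n × Fin n => hy _ (hB p.1 p.2)
    have hle : (S.extend (Set.range fun (p : Fin n × Fin n) x => (A x * B x) p.1 p.2)) ≤
        S.extend (Set.range fun k x => Q.eval (fun i => (Sum.elim oA oB i).eval fun i => y i x) k) := by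
      rintro g (hg | ⟨p, rfl⟩)
      · exact Know.le_extend _ _ _ hg
      · refine Know.mem_extend ⟨p, ?_⟩
        funext x
        refine Eq.trans ?_ (hQ (A x) (B x) p.1 p.2)
        dsimp only
        congr 1
        funext i
        cases i with
        | inl i => exact eA i x
        | inr i => exact eB i x
    obtain ⟨P, hP, h⟩ := Computes.inline (w := w) (c := a) Q (Sum.elim oA oB) hy
      fun hy₂ => ih (hy₂.mono hle) hw
    exact ⟨P, hP.trans (by linarith), h⟩

end ProgramOfReach

/-! ### Matrix multiplication needs `n ^ 2` operations. -/

section LowerBound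

open ArithProg

variable {F : Type u} [Field F]

/-- The outputs of a program are inputs, constants, or among as many functions as its cost. -/
theorem ArithProg.Program.exists_finset_results {κ ι : Type} {X : Type v} (P : Program F κ ι) :
    ∀ y : ι → X → F, ∃ R : Finset (X → F), R.card ≤ P.cost ∧ ∀ k,
      (fun x => P.eval (fun i => y i x) k) ∈ R ∨ (∃ i, (fun x => P.eval (fun i => y i x) k) = y i) ∨
      ∃ a : F, (fun x => P.eval (fun i => y i x) k) = fun _ => a := by
  classical
  induction P with
  | ret out =>
    refine fun y => ⟨∅, le_rfl, fun k => Or.inr ?_⟩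
    simp only [Program.eval]
    cases out k with
    | var i => exact Or.inl ⟨i, rfl⟩
    | const a => exact Or.inr ⟨a, rfl⟩
  | step ins rest ih =>
    intro y
    obtain ⟨R, hR, h⟩ := ih fun (o : Option _) x => o.elim (ins.eval fun i => y i x) fun i => y i x
    refine ⟨insert (fun x => ins.eval fun i => y i x) R,
      (Finset.card_insert_le _ _).trans (Nat.succ_le_succ hR), fun k => ?_⟩
    have e : (fun x => (Program.step ins rest).eval (fun i => y i x) k) =
        fun x => rest.eval (fun o => o.elim (ins.eval fun i => y i x) fun i => y i x) k := rfl
    rw [e]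
    rcases h k with h | ⟨o, h⟩ | h
    · exact Or.inl (Finset.mem_insert_of_mem h)
    · cases o with
      | none => exact Or.inl (h ▸ Finset.mem_insert_self _ _)
      | some i => exact Or.inr (Or.inl ⟨i, h⟩)
    · exact Or.inr (Or.inr h)

/-- As functions of the two factors, the entries of a product are pairwise distinct, and none is an
input or a constant. Each must therefore be the result of its own operation. -/
theorem sq_le_cost_of_matMul {n : ℕ}
    {P : Program F (Fin n × Fin n) ((Fin n × Fin n) ⊕ (Fin n × Fin n))}
    (hP : ∀ (A B : Matrix (Fin n) (Fin n) F) (i j : Fin n),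
      P.eval (Sum.elim (fun p => A p.1 p.2) (fun p => B p.1 p.2)) (i, j) = (A * B) i j) :
    n ^ 2 ≤ P.cost := by
  obtain ⟨R, hR, h⟩ := P.exists_finset_results
    (X := Matrix (Fin n) (Fin n) F × Matrix (Fin n) (Fin n) F)
    fun s x => Sum.elim (fun p => x.1 p.1 p.2) (fun p => x.2 p.1 p.2) s
  have hw : ∀ k : Fin n × Fin n, (fun x : Matrix (Fin n) (Fin n) F × Matrix (Fin n) (Fin n) F =>
      (x.1 * x.2) k.1 k.2) ∈ R := by
    rintro ⟨i, j⟩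
    have h' := h (i, j)
    have e : (fun x : Matrix (Fin n) (Fin n) F × Matrix (Fin n) (Fin n) F =>
      P.eval (fun s => Sum.elim (fun p => x.1 p.1 p.2) (fun p => x.2 p.1 p.2) s) (i, j)) =
        fun x => (x.1 * x.2) i j := by
      ext x
      exact hP x.1 x.2 i j
    rw [e] at h'
    rcases h' with h' | ⟨(p | p), h'⟩ | ⟨a, h'⟩
    · exact h'
    · have := congrFun h' (Matrix.of fun _ _ => 1, 0)
      simp at this
    · have := congrFun h' (0, Matrix.of fun _ _ => 1)
      simp at this
    · have h0 := congrFun h' (0, 0)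
      have h1 := congrFun h' (Matrix.single i i 1, Matrix.single i j 1)
      simp at h0 h1
      rw [← h0] at h1
      exact absurd h1 one_ne_zero
  have hinj : Function.Injective fun (k : Fin n × Fin n)
      (x : Matrix (Fin n) (Fin n) F × Matrix (Fin n) (Fin n) F) => (x.1 * x.2) k.1 k.2 := by
    rintro ⟨i, j⟩ ⟨i', j'⟩ hk
    have h1 := congrFun hk (Matrix.single i i 1, Matrix.single i j 1)
    simp only [Matrix.single_mul_single_same, Matrix.single_apply, mul_one] at h1
    by_contra hne
    rw [if_pos ⟨trivial, trivial⟩, if_neg (by simpa using hne)] at h1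
    exact one_ne_zero h1
  have hcard := Finset.card_le_card_of_injOn (s := Finset.univ) (t := R) _ (fun k _ => hw k)
    hinj.injOn
  rw [Finset.card_univ, Fintype.card_prod, Fintype.card_fin, ← sq] at hcard
  exact hcard.trans hR

/-- From `n ^ 2 ≤ c * n ^ ω` for all `n`: taking `n = 1` bounds `c`, and `ω < 2` would make the
unbounded `n ^ (2 - ω)` at most `c`. -/
theorem MatMulIn.two_le_and_one_le {ω c : ℝ} (h : MatMulIn F ω c) : 2 ≤ ω ∧ 1 ≤ c := by
  have key : ∀ n : ℕ, (n : ℝ) ^ 2 ≤ c * (n : ℝ) ^ ω := fun n => by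
    obtain ⟨P, hc, hP⟩ := h n
    exact le_trans (by exact_mod_cast sq_le_cost_of_matMul hP) hc
  refine ⟨?_, by simpa using key 1⟩
  by_contra! hω
  have h1 := (tendsto_rpow_atTop (by linarith : 0 < 2 - ω)).comp tendsto_natCast_atTop_atTop
  obtain ⟨n, hn, hn1⟩ := ((h1.eventually_gt_atTop c).and (Filter.eventually_ge_atTop 1)).exists
  have hn0 : (0 : ℝ) < n := by exact_mod_cast hn1
  have h2 := key n
  rw [Function.comp_apply, Real.rpow_sub hn0, lt_div_iff₀ (by positivity), Real.rpow_two] at hn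
  linarith

end LowerBound

/-! ### Preprocessing and query programs. -/

section ProgramsOfDynAdj

open ArithProg

variable {F : Type u} [Field F] {X : Type v}

/-- The constant functions and the functions `y i`. -/
def Know.ofFun {ι : Type} (y : ι → X → F) : Know F X :=
  ⟨{g | (∃ a : F, g = fun _ => a) ∨ ∃ i, g = y i}, fun a => Or.inl ⟨a, rfl⟩⟩

theorem Know.mem_ofFun {ι : Type} (y : ι → X → F) (i : ι) : y i ∈ Know.ofFun y :=
  Or.inr ⟨i, rfl⟩

theorem represents_ofFun {ι : Type} (y : ι → X → F) : Represents y (Know.ofFun y) := by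
  rintro g (⟨a, rfl⟩ | ⟨i, rfl⟩)
  · exact ⟨.const a, fun _ => rfl⟩
  · exact ⟨.var i, fun _ => rfl⟩

theorem Attains.computes {ω c : ℝ} (hF : MatMulIn F ω c) {ι κ : Type} {y : ι → X → F}
    {w : κ → X → F} {a : ℝ}
    (h : Attains (fun n : ℕ => c * (n : ℝ) ^ ω) (Know.ofFun y) (fun T => ∀ k, w k ∈ T) a) :
    Computes y w a := by
  obtain ⟨a', S', h₁, h₂, h₃⟩ := h
  obtain ⟨P, hP, h⟩ := Computes.of_reach hF h₁ (represents_ofFun y) h₃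
  exact ⟨P, hP.trans h₂, h⟩

theorem polyOfCoeffs_coeff {m : ℕ} {p : F[X]} (hp : p.natDegree ≤ m) :
    polyOfCoeffs (fun t : Fin (m + 1) => p.coeff t) = p := by
  rw [polyOfCoeffs, Fin.sum_univ_eq_sum_range (fun t => monomial t (p.coeff t)) (m + 1)]
  exact (p.as_sum_range' (m + 1) (Nat.lt_succ_of_le hp)).symm

theorem KnP.of_coeff_le {S : Know F X} {p : X → F[X]} {d : ℕ} (hp : ∀ x, (p x).natDegree ≤ d)
    (h : ∀ t : Fin (d + 1), (fun x => (p x).coeff t) ∈ S) : KnP S p := by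
  intro i
  by_cases hi : i < d + 1
  · exact h ⟨i, hi⟩
  · convert S.const_mem 0 using 2 with x
    exact coeff_eq_zero_of_natDegree_lt (by have := hp x; omega)

/-- The state is an admissible matrix for the preprocessing, and an admissible pair `(A, C)` for the
query. The preprocessing also stores the coefficients of `adj A`. -/
theorem DynAdj.exists_program {ω c : ℝ} (hF : MatMulIn F ω c) {n d : ℕ} {ι : Type} [Fintype ι]
    {st : ι → Matrix (Fin n) (Fin n) F[X] → F} {a : ℝ} {q : ℕ → ℝ}
    (h : ∀ X : Type u, DynAdj (fun n : ℕ => c * (n : ℝ) ^ ω) n d st X a q) :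
    ∃ (s : ℕ) (P : Program F (Fin s) (Fin n × Fin n × Fin (d + 1))), (P.cost : ℝ) ≤ a ∧
      ∀ (S : Finset (Fin n × Fin n)) (i j : Fin n),
        ∃ Q : Program F (Fin (n * d + 1)) (Fin s ⊕ ({p // p ∈ S} × Fin (d + 1))),
          (S = ∅ → Q.cost = 0) ∧ (S.Nonempty → (Q.cost : ℝ) ≤ q S.card) ∧
          ∀ A C : Matrix (Fin n) (Fin n) F[X], DegreeLE d A → A.det ≠ 0 →
            DegreeLE d C → (∀ p q, (p, q) ∉ S → C p q = 0) → (A + C).det ≠ 0 →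
            polyOfCoeffs (Q.eval (Sum.elim (P.eval (denseCoeffs d A)) (sparseCoeffs d S C))) =
              (A + C).adjugate i j := by
  let Y := {A : Matrix (Fin n) (Fin n) F[X] // DegreeLE d A ∧ A.det ≠ 0}
  let κ := ι ⊕ (Fin n × Fin n × Fin (n * d + 1))
  let w : κ → Matrix (Fin n) (Fin n) F[X] → F := Sum.elim st
    fun p A => (A.adjugate p.1 p.2.1).coeff p.2.2
  have hpre : Computes (fun p (A : Y) => denseCoeffs d A.1 p)
      (fun (k : Fin (Fintype.card κ)) (A : Y) => w ((Fintype.equivFin κ).symm k) A.1) a := by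
    refine Attains.computes hF (((h Y).1 _ (fun A => A.1) (fun A => A.2.1) (fun A => A.2.2)
      fun i j => KnP.of_coeff_le (fun A => A.2.1 i j) fun t => ?_).imp fun T _ hT k => ?_)
    · exact Know.mem_ofFun (fun p (A : Y) => denseCoeffs d A.1 p) (i, j, t)
    · rcases (Fintype.equivFin κ).symm k with l | ⟨i, j, t⟩
      · exact hT.1 l
      · exact hT.2 i j t
  obtain ⟨P, hPc, hP⟩ := hpre
  refine ⟨_, P, hPc, fun S i j => ?_⟩
  rcases S.eq_empty_or_nonempty with rfl | hS
  -- The cost bounds vanish for an empty set of positions. The query then has to return stored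
  -- coefficients of `adj A` without any operation.
  · refine ⟨.ret fun t => .var (.inl (Fintype.equivFin κ (.inr (i, j, t)))), fun _ => rfl,
      fun h => absurd h (by simp), fun A C hA hdA hC hC0 hdC => ?_⟩
    have hC' : C = 0 := Matrix.ext fun p q => hC0 p q (by simp)
    rw [hC', add_zero, ← polyOfCoeffs_coeff (natDegree_adjugate_le hA i j)]
    congr 1
    ext t
    refine (hP ⟨A, hA, hdA⟩ _).trans ?_
    simp only [Equiv.symm_apply_apply]
    rfl
  · let Z := {x : Matrix (Fin n) (Fin n) F[X] × Matrix (Fin n) (Fin n) F[X] //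
      (DegreeLE d x.1 ∧ x.1.det ≠ 0) ∧ DegreeLE d x.2 ∧ (∀ p q, (p, q) ∉ S → x.2 p q = 0) ∧
        (x.1 + x.2).det ≠ 0}
    let y : Fin (Fintype.card κ) ⊕ ({p // p ∈ S} × Fin (d + 1)) → Z → F := fun o x =>
      Sum.elim (P.eval (denseCoeffs d x.1.1)) (sparseCoeffs d S x.1.2) o
    have hq : Computes y (fun (t : Fin (n * d + 1)) (x : Z) =>
        ((x.1.1 + x.1.2).adjugate i j).coeff t) (q S.card) := by
      refine Attains.computes hF (((h Z).2 _ (fun x => x.1.1) (fun x => x.1.2) S i j hS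
        (fun x => x.2.1.1) (fun x => x.2.1.2) (fun x => x.2.2.1) (fun x => x.2.2.2.1)
        (fun x => x.2.2.2.2) (fun l => ?_) fun p hp =>
          KnP.of_coeff_le (fun x => x.2.2.1 _ _) fun t => ?_).imp fun T _ hT k => hT k)
      · convert Know.mem_ofFun y (.inl (Fintype.equivFin κ (.inl l))) using 2 with x
        refine ((hP ⟨x.1.1, x.2.1⟩ _).trans ?_).symm
        simp only [Equiv.symm_apply_apply]
        rfl
      · exact Know.mem_ofFun y (.inr (⟨p, hp⟩, t))
    obtain ⟨Q, hQc, hQ⟩ := hq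
    refine ⟨Q, fun h => absurd h hS.ne_empty, fun _ => hQc, fun A C hA hdA hC hC0 hdC => ?_⟩
    rw [← polyOfCoeffs_coeff (natDegree_adjugate_le (hA.add hC) i j)]
    congr 1
    ext t
    exact hQ ⟨(A, C), ⟨hA, hdA⟩, hC, hC0, hdC⟩ t

end ProgramsOfDynAdj

/-! ### Passing to an extension when the field is too small. -/

section AllFields

variable {μ : ℕ → ℝ}

/-- A bound for the cost of the preprocessing, over every field. -/
noncomputable def preCost (μ : ℕ → ℝ) (n d k : ℕ) : ℝ :=
  extCost μ k * ((3 * (n : ℝ) ^ 2 + 1) * fftCost k + 2 ^ k * (invCost μ n + 2 * (n : ℝ) ^ 2)) +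
    (n : ℝ) ^ 2 * ((d + 1) * k + (n * d + 1))

/-- A bound for the cost of a query, over every field. -/
noncomputable def queryCost (μ : ℕ → ℝ) (n d k f : ℕ) : ℝ :=
  extCost μ k * ((f + 3) * fftCost k + 2 ^ k * (invCost μ f + 12 * (f : ℝ) ^ 2)) +
    f * ((d + 1) * k) + (n * d + 1)

theorem DynAdj.mono {F : Type u} [Field F] {n d : ℕ} {ι : Type}
    {st : ι → Matrix (Fin n) (Fin n) F[X] → F} {X : Type v} {a a' : ℝ} {q q' : ℕ → ℝ}
    (h : DynAdj μ n d st X a q) (ha : a ≤ a') (hq : ∀ f, q f ≤ q' f) :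
    DynAdj μ n d st X a' q' :=
  ⟨fun S A h₁ h₂ h₃ => (h.1 S A h₁ h₂ h₃).mono_cost ha,
    fun S A C P i j h₁ h₂ h₃ h₄ h₅ h₆ h₇ h₈ =>
      (h.2 S A C P i j h₁ h₂ h₃ h₄ h₅ h₆ h₇ h₈).mono_cost (hq _)⟩

theorem exists_injOn_of_le_card {E : Type v} [Nonempty E] {N : ℕ} (h : Infinite E ∨ N ≤ Nat.card E) :
    ∃ pt : ℕ → E, Set.InjOn pt (Finset.range N) := by
  classical
  rcases finite_or_infinite E with hE | hE
  · have hN : N ≤ Nat.card E := h.resolve_left (not_infinite_iff_finite.2 hE)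
    let φ := (Finite.equivFin E).symm
    refine ⟨fun i => if hi : i < Nat.card E then φ ⟨i, hi⟩ else Classical.arbitrary E,
      fun i hi j hj hij => ?_⟩
    have hi' : i < Nat.card E := (Finset.mem_range.1 hi).trans_le hN
    have hj' : j < Nat.card E := (Finset.mem_range.1 hj).trans_le hN
    simp only [dif_pos hi', dif_pos hj'] at hij
    simpa using φ.injective hij
  · exact ⟨Infinite.natEmbedding E, (Infinite.natEmbedding E).injective.injOn⟩

/-- A field with fewer than `2 ^ k` elements is finite, and its extension of degree `k` has at least
`2 ^ k` elements. The degree is only logarithmic in the number of points. Over large fields the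
overhead `extCost μ k ≥ 1` is merely a weakening. -/
theorem exists_dynAdj (hμ : MulCost μ) (F : Type u) [Field F] {n d k : ℕ} (hk1 : 1 ≤ k)
    (hk : 3 * (n * d) < 2 ^ k) (hd : d ≤ n * d) :
    ∃ (ι : Type) (_ : Fintype ι) (st : ι → Matrix (Fin n) (Fin n) F[X] → F), ∀ X : Type u,
      DynAdj μ n d st X (preCost μ n d k) (queryCost μ n d k) := by
  have hi := invCost_nonneg hμ
  have hG : 0 ≤ fftCost k := by
    rw [fftCost]
    exact mul_nonneg (by positivity) (polyCost_nonneg k)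
  by_cases hF : Infinite F ∨ 2 ^ k ≤ Nat.card F
  · obtain ⟨pt, hpt⟩ := exists_injOn_of_le_card hF
    refine ⟨_, inferInstance, _, fun X => (dynAdj_of_injOn hμ hpt hk hd).mono ?_ fun f => ?_⟩
    all_goals
      have hL : 1 ≤ extCost μ k := by
        have h1 : (1 : ℝ) ≤ (k : ℝ) ^ 3 := one_le_pow₀ (by exact_mod_cast hk1)
        have h2 : (0 : ℝ) ≤ (k : ℝ) ^ 2 := by positivity
        rw [extCost]
        linarith [hi k]
    · rw [preCost]
      refine (le_mul_of_one_le_left ?_ hL).trans (le_add_of_nonneg_right (by positivity))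
      have := hi n
      positivity
    · rw [queryCost, add_assoc]
      refine (le_mul_of_one_le_left ?_ hL).trans (le_add_of_nonneg_right (by positivity))
      have := hi f
      positivity
  · push Not at hF
    obtain ⟨hF1, hF2⟩ := hF
    have : NeZero k := ⟨by omega⟩
    obtain ⟨p, hp⟩ := CharP.exists F
    have : Fact p.Prime := ⟨(CharP.char_is_prime_or_zero F p).resolve_right fun h0 => by
      subst h0
      have := CharP.charP_to_charZero F
      exact not_finite F⟩
    have hc : Infinite (FiniteField.Extension F p k) ∨
        2 ^ k ≤ Nat.card (FiniteField.Extension F p k) := by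
      right
      rw [FiniteField.natCard_extension]
      exact Nat.pow_le_pow_left Finite.one_lt_card _
    obtain ⟨pt, hpt⟩ := exists_injOn_of_le_card hc
    let b := (Module.finBasisOfFinrankEq F (FiniteField.Extension F p k)
      (FiniteField.finrank_extension F p k))
    exact ⟨_, inferInstance, _, fun X => (dynAdj_of_injOn hμ hpt hk hd).restrict hμ b⟩

end AllFields

/-! ### Elementary estimates for the total costs. -/

section CostBounds

variable {ω c : ℝ}

theorem fftCost_eq (k : ℕ) : fftCost k = 51030 * 2 ^ k * ((k : ℝ) + 1) ^ 41 := by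
  rw [fftCost, polyCost]
  ring

theorem sq_le_rpow (hω : 2 ≤ ω) {n : ℕ} (hn : 1 ≤ n) : (n : ℝ) ^ 2 ≤ (n : ℝ) ^ ω := by
  rw [← Real.rpow_two]
  exact Real.rpow_le_rpow_of_exponent_le (by exact_mod_cast hn) hω

theorem extCost_le (hω : 2 ≤ ω) (hc : 1 ≤ c) {k : ℕ} (hk : 1 ≤ k) :
    extCost (fun n : ℕ => c * (n : ℝ) ^ ω) k ≤
      (5 + 600 * c * 2 ^ ω) * ((k : ℝ) + 1) ^ (⌈ω⌉₊ + 3) := by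
  have hl : (1 : ℝ) ≤ (k : ℝ) + 1 := by linarith [Nat.cast_nonneg (α := ℝ) k]
  have h1 := invCost_le_log hω hc hk
  have h2 : (k : ℝ) ^ ω ≤ ((k : ℝ) + 1) ^ ⌈ω⌉₊ := by
    rw [← Real.rpow_natCast]
    exact (Real.rpow_le_rpow (by positivity) (by linarith) (by linarith)).trans
      (Real.rpow_le_rpow_of_exponent_le hl (Nat.le_ceil ω))
  have h3 : (Nat.clog 2 k : ℝ) + 1 ≤ (k : ℝ) + 1 := by
    have : Nat.clog 2 k ≤ k := Nat.clog_le_of_le_pow Nat.lt_two_pow_self.le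
    have : (Nat.clog 2 k : ℝ) ≤ k := by exact_mod_cast this
    linarith
  have h4 : (k : ℝ) ^ 3 ≤ ((k : ℝ) + 1) ^ (⌈ω⌉₊ + 3) :=
    (pow_le_pow_left₀ (by positivity) (by linarith) 3).trans (pow_le_pow_right₀ hl (by omega))
  have h5 : (k : ℝ) ^ 2 ≤ ((k : ℝ) + 1) ^ (⌈ω⌉₊ + 3) :=
    (pow_le_pow_left₀ (by positivity) (by linarith) 2).trans (pow_le_pow_right₀ hl (by omega))
  have h6 : 600 * c * 2 ^ ω * (Nat.clog 2 k + 1) * (k : ℝ) ^ ω ≤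
      600 * c * 2 ^ ω * ((k : ℝ) + 1) ^ (⌈ω⌉₊ + 3) := by
    rw [mul_assoc]
    refine mul_le_mul_of_nonneg_left ?_ (by positivity)
    calc ((Nat.clog 2 k : ℝ) + 1) * (k : ℝ) ^ ω ≤ ((k : ℝ) + 1) * ((k : ℝ) + 1) ^ ⌈ω⌉₊ := by
          gcongr
      _ = ((k : ℝ) + 1) ^ (⌈ω⌉₊ + 1) := by rw [pow_succ]; ring
      _ ≤ _ := pow_le_pow_right₀ hl (by omega)
  rw [extCost]
  linarith

/-- The constant in the cost bounds. -/
noncomputable def costConst (ω c : ℝ) : ℝ :=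
  (5 + 600 * c * 2 ^ ω) * (204140 + 1200 * c * 2 ^ ω) + 2

/-- This is a common upper bound for preprocessing, with `f = n`, and queries. The condition `f ≤ 2
^ (2 * k)` keeps the logarithm from inversion below a multiple of `k + 1`. The exponent adds `⌈ω⌉₊ +
3` from the extension field and `41` from the transforms. -/
theorem cost_core_le (hω : 2 ≤ ω) (hc : 1 ≤ c) {k f : ℕ} (hk : 1 ≤ k) (hf : 1 ≤ f)
    (hfk : f ≤ 2 ^ (2 * k)) :
    extCost (fun n : ℕ => c * (n : ℝ) ^ ω) k * (4 * (f : ℝ) ^ ω * fftCost k +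
        2 ^ k * (invCost (fun n : ℕ => c * (n : ℝ) ^ ω) f + 12 * (f : ℝ) ^ ω)) +
      (f : ℝ) ^ ω * (2 ^ k * ((k : ℝ) + 1)) + (f : ℝ) ^ ω * 2 ^ k ≤
    costConst ω c * ((k : ℝ) + 1) ^ (⌈ω⌉₊ + 44) * (2 ^ k * (f : ℝ) ^ ω) := by
  have hμ := MulCost.rpow hω hc
  have hl : (1 : ℝ) ≤ (k : ℝ) + 1 := by linarith [Nat.cast_nonneg (α := ℝ) k]
  have h1 := invCost_le_log hω hc hf
  have hL := extCost_le hω hc hk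
  set B := 600 * c * (2 : ℝ) ^ ω with hB
  have hB0 : 0 ≤ B := by positivity
  set φ := (f : ℝ) ^ ω
  have hφ : 0 ≤ φ := by positivity
  set l := (k : ℝ) + 1
  have h2 : (Nat.clog 2 f : ℝ) + 1 ≤ 2 * l := by
    have : Nat.clog 2 f ≤ 2 * k := Nat.clog_le_of_le_pow hfk
    have : (Nat.clog 2 f : ℝ) ≤ 2 * k := by exact_mod_cast this
    simp only [l]
    linarith
  have hl41 : l ≤ l ^ 41 := le_self_pow₀ hl (by norm_num)
  have h3 : invCost (fun n : ℕ => c * (n : ℝ) ^ ω) f ≤ 2 * B * φ * l ^ 41 := by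
    refine h1.trans ?_
    calc B * (Nat.clog 2 f + 1) * φ ≤ B * (2 * l ^ 41) * φ := by
          gcongr
          linarith
      _ = _ := by ring
  have h4 : φ ≤ φ * l ^ 41 := le_mul_of_one_le_right hφ (hl.trans hl41)
  have hN : (0 : ℝ) < 2 ^ k := by positivity
  have h5 : 4 * φ * fftCost k + 2 ^ k * (invCost (fun n : ℕ => c * (n : ℝ) ^ ω) f + 12 * φ) ≤
      (204140 + 2 * B) * l ^ 41 * (2 ^ k * φ) := by
    rw [fftCost_eq]
    calc 4 * φ * (51030 * 2 ^ k * l ^ 41) +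
          2 ^ k * (invCost (fun n : ℕ => c * (n : ℝ) ^ ω) f + 12 * φ)
        ≤ 4 * φ * (51030 * 2 ^ k * l ^ 41) + 2 ^ k * (2 * B * φ * l ^ 41 + 12 * (φ * l ^ 41)) := by
          gcongr
      _ ≤ (204132 + 2 * B) * l ^ 41 * (2 ^ k * φ) := le_of_eq (by ring)
      _ ≤ _ := by
          gcongr
          norm_num
  have h6 : l ≤ l ^ (⌈ω⌉₊ + 44) := le_self_pow₀ hl (by omega)
  have h7 : 1 ≤ l ^ (⌈ω⌉₊ + 44) := hl.trans h6
  have hL0 : 0 ≤ extCost (fun n : ℕ => c * (n : ℝ) ^ ω) k := by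
    have := invCost_nonneg hμ k
    rw [extCost]
    positivity
  calc _ ≤ ((5 + B) * l ^ (⌈ω⌉₊ + 3)) * ((204140 + 2 * B) * l ^ 41 * (2 ^ k * φ)) +
        φ * (2 ^ k * l ^ (⌈ω⌉₊ + 44)) + φ * 2 ^ k * l ^ (⌈ω⌉₊ + 44) := by
        refine add_le_add (add_le_add (mul_le_mul hL h5 ?_ (by positivity)) ?_) ?_
        · have := invCost_nonneg hμ f
          rw [fftCost_eq]
          positivity
        · gcongr
        · exact le_mul_of_one_le_right (by positivity) h7
    _ = ((5 + B) * (204140 + 2 * B) + 2) * l ^ (⌈ω⌉₊ + 44) * (2 ^ k * φ) := by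
        ring
    _ = _ := by
        rw [costConst, hB]
        ring

/-- The second hypothesis bounds `k` by `3 + log (1 + g) / log 2`, so that powers of `k + 1` are
absorbed by the logarithm in `softBound`. -/
theorem le_softBound {M g φ : ℝ} {e k : ℕ} (hM : 0 ≤ M) (hg : 0 ≤ g) (hφ : 0 ≤ φ)
    (h1 : 2 ^ k * φ ≤ 6 * g)
    (h2 : (2 : ℝ) ^ k ≤ 8 * (1 + g)) :
    M * ((k : ℝ) + 1) ^ e * (2 ^ k * φ) ≤ 6 * M * 4 ^ e * softBound e g := by
  have hlog : 0 ≤ Real.log (1 + g) := Real.log_nonneg (by linarith)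
  have h3 : (k : ℝ) + 1 ≤ 4 * (1 + Real.log (1 + g)) := by
    have h4 := Real.log_le_log (by positivity) h2
    have h5 : Real.log 8 = 3 * Real.log 2 := by
      rw [show (8 : ℝ) = 2 ^ 3 by norm_num, Real.log_pow]
      norm_num
    rw [Real.log_mul (by norm_num) (by linarith), Real.log_pow, h5] at h4
    have h6 := Real.log_two_gt_d9
    by_contra! h
    nlinarith
  rw [softBound]
  calc M * ((k : ℝ) + 1) ^ e * (2 ^ k * φ)
      ≤ M * (4 * (1 + Real.log (1 + g))) ^ e * (6 * g) := by
        gcongr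
    _ = _ := by rw [mul_pow]; ring

theorem preCost_le (hω : 2 ≤ ω) (hc : 1 ≤ c) {n d k : ℕ} (hn : 1 ≤ n) (hd : 1 ≤ d) (hk : 1 ≤ k)
    (hk1 : 3 * (n * d) < 2 ^ k) :
    preCost (fun n : ℕ => c * (n : ℝ) ^ ω) n d k ≤
      costConst ω c * ((k : ℝ) + 1) ^ (⌈ω⌉₊ + 44) * (2 ^ k * (n : ℝ) ^ ω) := by
  have hnd : n ≤ n * d := Nat.le_mul_of_pos_right _ hd
  have hdn : d ≤ n * d := Nat.le_mul_of_pos_left _ hn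
  have hnk : n ≤ 2 ^ (2 * k) :=
    (by omega : n ≤ 2 ^ k).trans (Nat.pow_le_pow_right (by norm_num) (by omega))
  refine le_trans ?_ (cost_core_le hω hc hk hn hnk)
  have h1 := sq_le_rpow hω hn
  have h2 : (1 : ℝ) ≤ (n : ℝ) ^ 2 := one_le_pow₀ (by exact_mod_cast hn)
  have hμ := MulCost.rpow hω hc
  have hi := invCost_nonneg hμ
  have hL0 : 0 ≤ extCost (fun n : ℕ => c * (n : ℝ) ^ ω) k := by
    have := hi k
    rw [extCost]
    positivity
  have hG : 0 ≤ fftCost k := by rw [fftCost_eq]; positivity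
  have h3 : (d : ℝ) + 1 ≤ 2 ^ k := by exact_mod_cast (by omega : d + 1 ≤ 2 ^ k)
  have h4 : (n : ℝ) * d + 1 ≤ 2 ^ k := by exact_mod_cast (by omega : n * d + 1 ≤ 2 ^ k)
  have h5 : (0 : ℝ) ≤ 2 ^ k := by positivity
  rw [preCost, add_assoc, ← mul_add ((n : ℝ) ^ ω)]
  refine add_le_add (mul_le_mul_of_nonneg_left (add_le_add ?_ ?_) hL0) ?_
  · exact mul_le_mul_of_nonneg_right (by linarith) hG
  · exact mul_le_mul_of_nonneg_left (by linarith) h5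
  · gcongr
    linarith

theorem queryCost_le (hω : 2 ≤ ω) (hc : 1 ≤ c) {n d k f : ℕ} (hn : 1 ≤ n) (hd : 1 ≤ d)
    (hk : 1 ≤ k) (hk1 : 3 * (n * d) < 2 ^ k) (hf : 1 ≤ f) (hfn : f ≤ n ^ 2) :
    queryCost (fun n : ℕ => c * (n : ℝ) ^ ω) n d k f ≤
      costConst ω c * ((k : ℝ) + 1) ^ (⌈ω⌉₊ + 44) * (2 ^ k * (f : ℝ) ^ ω) := by
  have hnd : n ≤ n * d := Nat.le_mul_of_pos_right _ hd
  have hdn : d ≤ n * d := Nat.le_mul_of_pos_left _ hn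
  have hfk : f ≤ 2 ^ (2 * k) := by
    rw [mul_comm, pow_mul]
    exact hfn.trans (Nat.pow_le_pow_left (by omega) 2)
  refine le_trans ?_ (cost_core_le hω hc hk hf hfk)
  have h1 := sq_le_rpow hω hf
  have h2 : (1 : ℝ) ≤ f := by exact_mod_cast hf
  have h2' : (f : ℝ) ≤ (f : ℝ) ^ ω := (le_self_pow₀ h2 (by norm_num)).trans h1
  have hμ := MulCost.rpow hω hc
  have hi := invCost_nonneg hμ
  have hL0 : 0 ≤ extCost (fun n : ℕ => c * (n : ℝ) ^ ω) k := by
    have := hi k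
    rw [extCost]
    positivity
  have hG : 0 ≤ fftCost k := by rw [fftCost_eq]; positivity
  have h3 : (d : ℝ) + 1 ≤ 2 ^ k := by exact_mod_cast (by omega : d + 1 ≤ 2 ^ k)
  have h4 : (n : ℝ) * d + 1 ≤ 2 ^ k := by exact_mod_cast (by omega : n * d + 1 ≤ 2 ^ k)
  have h5 : (0 : ℝ) ≤ 2 ^ k := by positivity
  rw [queryCost]
  refine add_le_add (add_le_add (mul_le_mul_of_nonneg_left (add_le_add ?_ ?_) hL0) ?_) ?_
  · exact mul_le_mul_of_nonneg_right (by linarith) hG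
  · exact mul_le_mul_of_nonneg_left (by linarith) h5
  · gcongr
    linarith
  · exact h4.trans (le_mul_of_one_le_left h5 (h2.trans h2'))

end CostBounds

end AdjugateMaintenance

/-! ### The main theorem. -/

theorem mainTheorem6 (ω c : ℝ) :
    -- the constants depend on nothing but `ω` and `c`
    ∃ (K : ℝ) (k : ℕ), ∀ (F : Type u) [Field F], MatMulIn F ω c → ∀ n d : ℕ,
      -- the preprocessing `P`, which stores `s` field elements
      ∃ (s : ℕ) (P : ArithProg.Program F (Fin s) (Fin n × Fin n × Fin (d + 1))),
        (0 < d → (P.cost : ℝ) ≤ K * softBound k (d * (n : ℝ) ^ (ω + 1))) ∧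
        (d = 0 → 2 < ω → (P.cost : ℝ) ≤ K * (n : ℝ) ^ ω) ∧
        -- the query `Q` of the entry `(i, j)` after a change at the positions in `S`
        ∀ (S : Finset (Fin n × Fin n)) (i j : Fin n),
          ∃ Q : ArithProg.Program F (Fin (n * d + 1)) (Fin s ⊕ ({p // p ∈ S} × Fin (d + 1))),
            (0 < d → (Q.cost : ℝ) ≤ K * softBound k (d * n * (S.card : ℝ) ^ (ω + 1))) ∧
            (d = 0 → 2 < ω → (Q.cost : ℝ) ≤ K * (S.card : ℝ) ^ ω) ∧
            ∀ A C : Matrix (Fin n) (Fin n) (Polynomial F),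
              DegreeLE d A → A.det ≠ 0 →
              DegreeLE d C → (∀ p q, (p, q) ∉ S → C p q = 0) → (A + C).det ≠ 0 →
              polyOfCoeffs (Q.eval (Sum.elim (P.eval (denseCoeffs d A)) (sparseCoeffs d S C))) =
                (A + C).adjugate i j := by
  by_cases hωc : 2 ≤ ω ∧ 1 ≤ c
  swap
  -- No field satisfies the hypothesis for such `ω` and `c`.
  · exact ⟨0, 0, fun F _ hF => absurd hF.two_le_and_one_le hωc⟩
  obtain ⟨hω, hc⟩ := hωc
  obtain ⟨K₀, hK₀, hinv⟩ : ∃ K : ℝ, 0 ≤ K ∧ (2 < ω → ∀ n : ℕ, 1 ≤ n →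
      invCost (fun n : ℕ => c * (n : ℝ) ^ ω) n ≤ K * (n : ℝ) ^ ω) := by
    by_cases h : 2 < ω
    · obtain ⟨K, hK, h'⟩ := invCost_le h hc
      exact ⟨K, hK, fun _ => h'⟩
    · exact ⟨0, le_rfl, fun h' => absurd h' h⟩
  have hM : 0 ≤ costConst ω c := by rw [costConst]; positivity
  set e := ⌈ω⌉₊ + 44 with he
  set K₁ := 6 * costConst ω c * 4 ^ e with hK₁
  have hK₁0 : 0 ≤ K₁ := by positivity
  have hsoft : ∀ {g : ℝ}, 0 ≤ g → 0 ≤ softBound e g := by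
    intro g hg
    have := Real.log_nonneg (by linarith : 1 ≤ 1 + g)
    rw [softBound]
    positivity
  -- `K₁` serves `d ≥ 1` and `K₀ + 13` serves `d = 0`, where a query costs at most `invCost` plus
  -- `12 f ^ 2 + 1`.
  refine ⟨K₁ + (K₀ + 13), e, fun F _ hF n d => ?_⟩
  have hμ := MulCost.rpow hω hc
  rcases Nat.eq_zero_or_pos n with rfl | hn
  · refine ⟨0, .ret Fin.elim0, fun _ => ?_, fun _ _ => ?_, fun S i => i.elim0⟩
    · have : (0 : ℝ) ≤ d * ((0 : ℕ) : ℝ) ^ (ω + 1) := by positivity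
      have := hsoft this
      simp only [ArithProg.Program.cost, Nat.cast_zero] at *
      positivity
    · simp only [ArithProg.Program.cost, Nat.cast_zero]
      positivity
  have hn1 : (1 : ℝ) ≤ n := by exact_mod_cast hn
  rcases Nat.eq_zero_or_pos d with rfl | hd
  · obtain ⟨s, P, hP, h⟩ := DynAdj.exists_program hF fun X => dynAdj_const (X := X) (n := n) hμ
    refine ⟨s, P, fun h => absurd h (lt_irrefl 0), fun _ h2 => ?_, fun S i j => ?_⟩
    · have h3 := hinv h2 n hn
      have h4 := sq_le_rpow hω hn
      have h5 : 0 ≤ K₁ * (n : ℝ) ^ ω := by positivity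
      have h6 : (0 : ℝ) ≤ (n : ℝ) ^ ω := by positivity
      linarith
    · obtain ⟨Q, hQ0, hQ, hcorr⟩ := h S i j
      refine ⟨Q, fun h => absurd h (lt_irrefl 0), fun _ h2 => ?_, hcorr⟩
      rcases S.eq_empty_or_nonempty with hS | hS
      · rw [hQ0 hS, Nat.cast_zero]
        positivity
      · have h3 := hinv h2 S.card hS.card_pos
        have h4 := sq_le_rpow hω hS.card_pos
        have h5 : 0 ≤ K₁ * (S.card : ℝ) ^ ω := by positivity
        have h6 : (1 : ℝ) ≤ (S.card : ℝ) ^ 2 := one_le_pow₀ (by exact_mod_cast hS.card_pos)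
        have h7 := hQ hS
        linarith
  -- The least `k` with `3 n d < 2 ^ k`, so that also `2 ^ k ≤ 6 n d`.
  · obtain ⟨k, hk⟩ : ∃ k, k = Nat.log 2 (3 * (n * d)) + 1 := ⟨_, rfl⟩
    have hnd : 0 < n * d := Nat.mul_pos hn hd
    have hk1 : 1 ≤ k := by omega
    have hk2 : 3 * (n * d) < 2 ^ k := hk ▸ Nat.lt_pow_succ_log_self (by norm_num) _
    have hk3 : (2 : ℝ) ^ k ≤ 6 * (n * d) := by
      have h1 := Nat.pow_log_le_self 2 (x := 3 * (n * d)) (by omega)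
      have h2 : 2 ^ k ≤ 6 * (n * d) := by rw [hk, pow_succ]; omega
      exact_mod_cast h2
    obtain ⟨ι, _, st, hst⟩ := exists_dynAdj hμ F hk1 hk2 (Nat.le_mul_of_pos_left _ hn)
    obtain ⟨s, P, hP, h⟩ := DynAdj.exists_program hF hst
    have hfin : ∀ f : ℕ, 1 ≤ f → ∀ g : ℝ, (n : ℝ) * d * (f : ℝ) ^ ω ≤ g →
        costConst ω c * ((k : ℝ) + 1) ^ e * (2 ^ k * (f : ℝ) ^ ω) ≤
          (K₁ + (K₀ + 13)) * softBound e g := by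
      intro f hf g hg
      have h1 : (1 : ℝ) ≤ (f : ℝ) ^ ω := Real.one_le_rpow (by exact_mod_cast hf) (by linarith)
      have h2 : (0 : ℝ) < n * d := by exact_mod_cast hnd
      have h3 : (n : ℝ) * d ≤ g := (le_mul_of_one_le_right h2.le h1).trans hg
      have hg0 : 0 ≤ g := h2.le.trans h3
      refine (le_softBound hM hg0 (by positivity) ?_ (by linarith)).trans
        (mul_le_mul_of_nonneg_right (by linarith) (hsoft hg0))
      calc (2 : ℝ) ^ k * (f : ℝ) ^ ω ≤ 6 * (n * d) * (f : ℝ) ^ ω := by gcongr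
        _ ≤ 6 * g := by linarith
    refine ⟨s, P, fun _ => ?_, fun h0 => absurd h0 hd.ne', fun S i j => ?_⟩
    · refine hP.trans ((preCost_le hω hc hn hd hk1 hk2).trans (hfin n hn _ (le_of_eq ?_)))
      rw [Real.rpow_add_one (by positivity)]
      ring
    · obtain ⟨Q, hQ0, hQ, hcorr⟩ := h S i j
      refine ⟨Q, fun _ => ?_, fun h0 => absurd h0 hd.ne', hcorr⟩
      rcases S.eq_empty_or_nonempty with hS | hS
      · have := hsoft (g := d * n * (S.card : ℝ) ^ (ω + 1)) (by positivity)
        rw [hQ0 hS, Nat.cast_zero]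
        positivity
      · have hcard : S.card ≤ n ^ 2 := (Finset.card_le_univ S).trans_eq (by simp [sq])
        refine (hQ hS).trans ((queryCost_le hω hc hn hd hk1 hk2 hS.card_pos hcard).trans
          (hfin S.card hS.card_pos _ ?_))
        have h1 : (1 : ℝ) ≤ S.card := by exact_mod_cast hS.card_pos
        -- The estimate so far has `f ^ ω`; only `f ^ ω ≤ f ^ (ω + 1)` is left to use.
        rw [mul_comm (n : ℝ)]
        gcongr
        linarith
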